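/- **Conventions.** $\lambda$ is the security parameter; a function $f$ is negligible if $\lambda^c f(\lambda)\to 0$ for every $c$. Plaintexts, function descriptions, function values, keys, coins and classical ciphertexts are bit strings of polynomially bounded length. Classical algorithms are families of Boolean circuits of polynomial size (random coins are part of the input); honest quantum algorithms are families of general quantum circuits of polynomial size (gates $H$, $T$, CNOT, fresh qubits, discarding, measurements with classical processing and classical control). QPT adversaries and distinguishers are such families that may in addition use a quantum advice state of polynomially many qubits. A primitive is *sub-exponentially secure* if there is a constant $0<\alpha<1$ such that every QPT adversary has advantage $O(2^{-\lambda^\alpha})$. **SDFE.** A single-decryptor functional encryption scheme consists of classical algorithms $\mathsf{Setup}(1^\lambda)\to(\mathsf{pk},\mathsf{msk})$ and $\mathsf{Enc}(\mathsf{pk},x)\to\mathsf{ct}$ and quantum algorithms $\mathsf{QKG}(\mathsf{msk},f)\to sk_f$ (a quantum state) and $\mathsf{Dec}(sk_f,\mathsf{ct})\to y$; the functions $f$ of the function space are given by efficiently evaluable descriptions. In the adaptive security experiment with bit $\mathsf{coin}$ the adversary gets $\mathsf{pk}$; it makes adaptive key queries $f_i$, answered by $\mathsf{QKG}(\mathsf{msk},f_i)$;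 it sends one pair $(x_0,x_1)$ and gets $\mathsf{Enc}(\mathsf{pk},x_{\mathsf{coin}})$; it makes further key queries; and it outputs a bit, which is the output of the experiment. The experiment outputs $0$ if $f_i(x_0)\ne f_i(x_1)$ for some queried $f_i$. The advantage is $|\Pr[\mathrm{Exp}(0)=1]-\Pr[\mathrm{Exp}(1)=1]|$. The scheme is *adaptively secure* if the advantage of every QPT adversary (with any polynomial number of queries) is negligible; *adaptively single-key* security refers to adversaries with at most one key query. **PPRF.** A puncturable PRF has efficient algorithms $\mathsf{Gen}$, $F$, $\mathsf{Puncture}$ such that (i) the key $K_{\notin S}$ punctured at a set $S$ always gives the value $F_K(x)$ for every $x\notin S$; (ii) for every set $S$ of polynomial size, no QPT distinguisher can tell $(K_{\notin S},(F_K(x))_{x\in S})$ from $(K_{\notin S},\text{uniform})$, its distinguishing probability being its advantage. **IO.** An indistinguishability obfuscator for polynomial-size circuits is an efficient algorithm $i\mathcal O$ such that (i) $i\mathcal O(C)$ always computes the same function as $C$; (ii) for every PPT sampler that always outputs two functionally equivalent circuits $C_0,C_1$ of the same size and a string $\mathsf{aux}$, no QPT distinguisher can tell $(i\mathcal O(C_0),\mathsf{aux})$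 from $(i\mathcal O(C_1),\mathsf{aux})$. **Construction.** Let $\mathsf{1SDFE}$ be an SDFE scheme, $i\mathcal O$ an obfuscator, and let $F$, $F'$ be puncturable PRFs from $\{0,1\}^\ell$ to the sets of random coins of $\mathsf{1SDFE.Setup}$ and of $\mathsf{1SDFE.Enc}$. The key-bundled scheme $\mathsf{SDFE}$ is as follows. * $\mathsf{Setup}$: $K\gets\mathsf{Gen}$; $\widehat{\mathsf{pk}}=i\mathcal O(\mathsf S[K])$ and $\widehat{\mathsf{msk}}=K$, where the circuit $\mathsf S[K]$ maps a tag $\tau\in\{0,1\}^\ell$ to the public key $\mathsf{pk}_\tau$ of $(\mathsf{pk}_\tau,\mathsf{msk}_\tau)=\mathsf{1SDFE.Setup}(1^\lambda;F_K(\tau))$ and is padded to size $\mathsf{pad}_{\mathsf S}$. * $\mathsf{QKG}(K,f)$: choose $\tau\in\{0,1\}^\ell$ uniformly and output $(\tau,\mathsf{1SDFE.QKG}(\mathsf{msk}_\tau,f))$. * $\mathsf{Enc}(\widehat{\mathsf{pk}},x)$: $K'\gets\mathsf{Gen}'$; output $i\mathcal O(\mathsf E[\widehat{\mathsf{pk}},K',x])$,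 where $\mathsf E[\widehat{\mathsf{pk}},K',x]$ maps $\tau$ to $\mathsf{1SDFE.Enc}(\widehat{\mathsf{pk}}(\tau),x;F'_{K'}(\tau))$ and is padded to size $\mathsf{pad}_{\mathsf E}$. * $\mathsf{Dec}((\tau,sk),\widehat{\mathsf{ct}})$: output $\mathsf{1SDFE.Dec}(sk,\widehat{\mathsf{ct}}(\tau))$. **Theorem.** Let the tag length satisfy $\ell(\lambda)=\omega(\log\lambda)$ and $\ell(\lambda)=O(\log^c\lambda)$ for some constant $c$. Suppose that the algorithms of $\mathsf{1SDFE}$ are efficient and $\mathsf{1SDFE}$ is sub-exponentially adaptively single-key secure, that $i\mathcal O$ is a sub-exponentially secure indistinguishability obfuscator for polynomial-size circuits, and that $F$ and $F'$ are sub-exponentially secure puncturable PRFs. Then $\mathsf{SDFE}$ with sufficiently large polynomial padding is adaptively (collusion-resistantly) secure: there is a polynomially bounded $p_{\mathsf S}$ such that for every polynomially bounded $\mathsf{pad}_{\mathsf S}\ge p_{\mathsf S}$ there is a polynomially bounded $p_{\mathsf E}$ such that for every polynomially bounded $\mathsf{pad}_{\mathsf E}\ge p_{\mathsf E}$ the scheme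 $\mathsf{SDFE}$ is adaptively secure. -/

import Mathlib

open Filter Asymptotics
open scoped ComplexOrder BigOperators

noncomputable section

namespace KeyBundling

/-! ### Bit strings -/

/-- Bit strings of length `n`.  Concatenation is `Fin.append`. -/
abbrev Bits (n : ℕ) : Type := Fin n → Bool

/-- The first `m` bits of a string of length `m + n`. -/
def Bits.left {m n : ℕ} (x : Bits (m + n)) : Bits m := fun i => x (Fin.castAdd n i)

/-- The last `n` bits of a string of length `m + n`. -/
def Bits.right {m n : ℕ} (x : Bits (m + n)) : Bits n := fun i => x (Fin.natAdd m i)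

/-- Concatenation of `k` strings of length `n`. -/
def Bits.flatten {k n : ℕ} (S : Fin k → Bits n) : Bits (k * n) :=
  fun i => S (finProdFinEquiv.symm i).1 (finProdFinEquiv.symm i).2

/-- Expectation of `f r` over a uniformly random string `r` of `n` bits. -/
def expect {n : ℕ} (f : Bits n → ℝ) : ℝ := (∑ r : Bits n, f r) / 2 ^ n

/-! ### Boolean circuits

A circuit with `n` inputs, `s` inner gates and `m` output gates is a table with one row for each
gate and one column for each input and each inner gate; the row of a gate is the set of wires that
it reads.  Each gate is a NAND gate of unbounded fan-in (the NAND of no wire is `false`); inner gate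
number `i` reads inputs and inner gates of number `< i` (entries of its row in later columns are
ignored), and the output gates read inputs and inner gates.  A circuit *is* the bit string that
lists its table, so algorithms can take circuits as input and return them. -/

/-- Length of the description of a circuit. -/
abbrev descLen (n m s : ℕ) : ℕ := (s + m) * (n + s)

/-- Boolean circuits with `n` inputs, `m` outputs and `s` inner gates. The size of the circuit is
`s + m`, so that circuits with the same `n` and `m` have the same size iff they have the same `s`. -/
abbrev Circuit (n m s : ℕ) : Type := Bits (descLen n m s)

namespace Circuit

/-- Does the given (inner or output) gate read the given (input or inner) wire? -/
def cell {n m s : ℕ} (C : Circuit n m s) (i : Fin s ⊕ Fin m) (j : Fin n ⊕ Fin s) : Bool :=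
  C (finProdFinEquiv (finSumFinEquiv i, finSumFinEquiv j))

/-- The circuit with a given table. -/
def ofCells {n m s : ℕ} (c : Fin s ⊕ Fin m → Fin n ⊕ Fin s → Bool) : Circuit n m s :=
  fun k => c (finSumFinEquiv.symm (finProdFinEquiv.symm k).1)
    (finSumFinEquiv.symm (finProdFinEquiv.symm k).2)

/-- The NAND of those among the inputs `x` and the first `t` inner wires `v` that the gate reads. -/
def nand {n m s : ℕ} (C : Circuit n m s) (x : Bits n) (t : ℕ) (v : Bits s)
    (i : Fin s ⊕ Fin m) : Bool :=
  !decide ((∀ j : Fin n, C.cell i (Sum.inl j) = true → x j = true) ∧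
    ∀ j : Fin s, (j : ℕ) < t → C.cell i (Sum.inr j) = true → v j = true)

/-- The values of the inner wires after the evaluation of the first `t` inner gates. -/
def wires {n m s : ℕ} (C : Circuit n m s) (x : Bits n) : ℕ → Bits s
  | 0 => fun _ => false
  | t + 1 => fun i => if (i : ℕ) = t then C.nand x t (C.wires x t) (Sum.inl i) else C.wires x t i

/-- The function computed by a circuit. -/
def eval {n m s : ℕ} (C : Circuit n m s) (x : Bits n) : Bits m :=
  fun k => C.nand x s (C.wires x s) (Sum.inr k)

/-- The number of gates, each counted with its maximal fan-in. -/
def cost (n m s : ℕ) : ℕ := (s + m) * (n + s + 1)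

/-- Three consecutive blocks of gates. -/
def split3 {a k b : ℕ} (i : Fin (a + k + b)) : (Fin a ⊕ Fin k) ⊕ Fin b :=
  Sum.map finSumFinEquiv.symm id (finSumFinEquiv.symm i)

/-- Sequential composition: `x ↦ D (C x)`. -/
def comp {n k m a b : ℕ} (C : Circuit n k a) (D : Circuit k m b) : Circuit n m (a + k + b) :=
  ofCells fun i j =>
    match Sum.map split3 id i, Sum.map id split3 j with
    | .inl (.inl (.inl i)), .inl j => C.cell (.inl i) (.inl j)
    | .inl (.inl (.inl i)), .inr (.inl (.inl j)) => C.cell (.inl i) (.inr j)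
    | .inl (.inl (.inr i)), .inl j => C.cell (.inr i) (.inl j)
    | .inl (.inl (.inr i)), .inr (.inl (.inl j)) => C.cell (.inr i) (.inr j)
    | .inl (.inr i), .inr (.inl (.inr j)) => D.cell (.inl i) (.inl j)
    | .inl (.inr i), .inr (.inr j) => D.cell (.inl i) (.inr j)
    | .inr i, .inr (.inl (.inr j)) => D.cell (.inr i) (.inl j)
    | .inr i, .inr (.inr j) => D.cell (.inr i) (.inr j)
    | _, _ => false

/-- Hardwiring of the first `k` inputs to the constants `c`: the circuit `y ↦ C (c, y)`.  The first
inner gate has the value `false`, the next `k` inner gates have the values `c`. -/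
def hardwire {k n m s : ℕ} (C : Circuit (k + n) m s) (c : Bits k) : Circuit n m (1 + k + s) :=
  ofCells fun i j =>
    match Sum.map split3 id i, Sum.map id split3 j with
    | .inl (.inl (.inr i)), .inr (.inl (.inl _)) => c i
    | .inl (.inr i), .inl j => C.cell (.inl i) (.inl (Fin.natAdd k j))
    | .inl (.inr i), .inr (.inl (.inr j)) => C.cell (.inl i) (.inl (Fin.castAdd n j))
    | .inl (.inr i), .inr (.inr j) => C.cell (.inl i) (.inr j)
    | .inr i, .inl j => C.cell (.inr i) (.inl (Fin.natAdd k j))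
    | .inr i, .inr (.inl (.inr j)) => C.cell (.inr i) (.inl (Fin.castAdd n j))
    | .inr i, .inr (.inr j) => C.cell (.inr i) (.inr j)
    | _, _ => false

/-- Two circuits on the same input: `x ↦ (C x, D x)`. -/
def pair {n k m a b : ℕ} (C : Circuit n k a) (D : Circuit n m b) : Circuit n (k + m) (a + b) :=
  ofCells fun i j =>
    match Sum.map finSumFinEquiv.symm finSumFinEquiv.symm i, Sum.map id finSumFinEquiv.symm j with
    | .inl (.inl i), .inl j => C.cell (.inl i) (.inl j)
    | .inl (.inl i), .inr (.inl j) => C.cell (.inl i) (.inr j)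
    | .inl (.inr i), .inl j => D.cell (.inl i) (.inl j)
    | .inl (.inr i), .inr (.inr j) => D.cell (.inl i) (.inr j)
    | .inr (.inl i), .inl j => C.cell (.inr i) (.inl j)
    | .inr (.inl i), .inr (.inl j) => C.cell (.inr i) (.inr j)
    | .inr (.inr i), .inl j => D.cell (.inr i) (.inl j)
    | .inr (.inr i), .inr (.inr j) => D.cell (.inr i) (.inr j)
    | _, _ => false

/-- The circuit that returns only the first `p` output bits. -/
def take {n p q s : ℕ} (C : Circuit n (p + q) s) : Circuit n p s :=
  ofCells fun i j => C.cell (Sum.map id (Fin.castAdd q) i) j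

/-- Number of inner gates after padding to (at least) `t` inner gates: the maximum of `s`, `t`. -/
abbrev padded (s t : ℕ) : ℕ := s + (t - s)

/-- Padding to `t` inner gates by dummy gates that no gate reads. -/
def pad {n m s : ℕ} (C : Circuit n m s) (t : ℕ) : Circuit n m (padded s t) :=
  ofCells fun i j =>
    match Sum.map finSumFinEquiv.symm id i, Sum.map id finSumFinEquiv.symm j with
    | .inl (.inl i), .inl j => C.cell (.inl i) (.inl j)
    | .inl (.inl i), .inr (.inl j) => C.cell (.inl i) (.inr j)
    | .inr i, .inl j => C.cell (.inr i) (.inl j)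
    | .inr i, .inr (.inl j) => C.cell (.inr i) (.inr j)
    | _, _ => false

end Circuit

/-- A deterministic algorithm on `n` bits with `m` bits of output (at one value of the security
parameter).  A probabilistic algorithm takes uniformly random bits as a part of its input. -/
structure Alg (n m : ℕ) where
  gates : ℕ
  circ : Circuit n m gates

/-- The function computed by the algorithm. -/
def Alg.eval {n m : ℕ} (A : Alg n m) (x : Bits n) : Bits m := A.circ.eval x

/-- Running time. -/
def Alg.cost {n m : ℕ} (A : Alg n m) : ℕ := Circuit.cost n m A.gates

/-! ### Quantum circuits -/

/-- Operators on `n` qubits, as matrices in the computational basis. -/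
abbrev Op (n : ℕ) : Type := Matrix (Bits n) (Bits n) ℂ

/-- Density matrices. -/
def IsState {n : ℕ} (ρ : Op n) : Prop := ρ.PosSemidef ∧ ρ.trace = 1

/-- The state `|x⟩⟨x|`. -/
def ket {n : ℕ} (x : Bits n) : Op n := fun a b => if a = x ∧ b = x then 1 else 0

/-- Tensor product. -/
def tensor {m n : ℕ} (ρ : Op m) (σ : Op n) : Op (m + n) :=
  fun a b => ρ a.left b.left * σ a.right b.right

/-- The unnormalized state of the first `m` qubits after a measurement of the last `k` qubits in the
computational basis with outcome `y`; its trace is the probability of that outcome. -/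
def outcome {m k : ℕ} (ρ : Op (m + k)) (y : Bits k) : Op m :=
  fun a b => ρ (Fin.append a y) (Fin.append b y)

/-- The probability that the measurement of a single qubit gives `1`. -/
def accept (ρ : Op 1) : ℝ := (ρ (fun _ => true) (fun _ => true)).re

/-- Quantum circuits with `m` input qubits and `n` output qubits, over the gates `H`, `T`, `CNOT`,
with fresh qubits in state `|0⟩`, discarding of qubits, and measurements in the computational basis
whose results are processed by classical circuits or decide how to go on. -/
inductive QCirc : ℕ → ℕ → Type
  /-- rewiring: output wire `i` is input wire `e i` -/
  | wire {m n : ℕ} (e : Fin n ≃ Fin m) : QCirc m n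
  /-- first `P`, then `Q` -/
  | comp {m k n : ℕ} (P : QCirc m k) (Q : QCirc k n) : QCirc m n
  /-- `P` on the first `m` qubits, nothing on the last `k` qubits -/
  | extend {m n : ℕ} (P : QCirc m n) (k : ℕ) : QCirc (m + k) (n + k)
  | fresh : QCirc 0 1
  | discard : QCirc 1 0
  | hadamard : QCirc 1 1
  | tGate : QCirc 1 1
  | cnot : QCirc 2 2
  /-- measure all qubits and run a classical circuit on the result -/
  | classical {m n s : ℕ} (C : Circuit m n s) : QCirc m n
  /-- measure the first qubit and run `P` or `Q` on the others if the result is `0` or `1` -/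
  | branch {m n : ℕ} (P Q : QCirc m n) : QCirc (1 + m) n

namespace QCirc

/-- Number of gates. -/
def size : {m n : ℕ} → QCirc m n → ℕ
  | _, _, wire _ => 0
  | _, _, comp P Q => P.size + Q.size
  | _, _, extend P _ => P.size
  | _, _, fresh => 1
  | _, _, discard => 1
  | _, _, hadamard => 1
  | _, _, tGate => 1
  | _, _, cnot => 1
  | m, n, classical (s := s) _ => Circuit.cost m n s
  | _, _, branch P Q => P.size + Q.size + 1

/-- The quantum channel computed by a circuit. -/
def sem : {m n : ℕ} → QCirc m n → Op m → Op n
  | _, _, wire e, ρ => fun a b => ρ (a ∘ e.symm) (b ∘ e.symm)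
  | _, _, comp P Q, ρ => Q.sem (P.sem ρ)
  | _, _, extend P _, ρ => fun a b =>
      P.sem (fun x y => ρ (Fin.append x a.right) (Fin.append y b.right)) a.left b.left
  | _, _, fresh, ρ => fun a b => if a 0 = false ∧ b 0 = false then ρ ![] ![] else 0
  | _, _, discard, ρ => fun _ _ => ∑ x : Bits 1, ρ x x
  | _, _, hadamard, ρ => fun a b => ∑ x : Bits 1, ∑ y : Bits 1,
      (if a 0 && x 0 then -1 else 1) * (if b 0 && y 0 then -1 else 1) * ρ x y / 2
  | _, _, tGate, ρ => fun a b =>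
      (if a 0 then Complex.exp (Real.pi / 4 * Complex.I) else 1) * ρ a b *
        (if b 0 then Complex.exp (-(Real.pi / 4 * Complex.I)) else 1)
  | _, _, cnot, ρ => fun a b => ρ ![a 0, xor (a 0) (a 1)] ![b 0, xor (b 0) (b 1)]
  | m, _, classical C, ρ => ∑ x : Bits m, ρ x x • ket (C.eval x)
  | _, _, branch P Q, ρ =>
      P.sem (fun a b => ρ (Fin.append ![false] a) (Fin.append ![false] b)) +
      Q.sem (fun a b => ρ (Fin.append ![true] a) (Fin.append ![true] b))

end QCirc

/-! ### Asymptotics, and quantum polynomial-time distinguishers -/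

/-- Bounded by a polynomial in the security parameter. -/
def PolyBounded (f : ℕ → ℕ) : Prop := ∃ p : Polynomial ℕ, ∀ l, f l ≤ p.eval l

/-- Negligible functions of the security parameter. -/
def Negligible (f : ℕ → ℝ) : Prop := SuperpolynomialDecay atTop (fun l : ℕ => (l : ℝ)) f

/-- `f(l) = O(2 ^ (- l ^ α))`. -/
def SubExpSmall (α : ℝ) (f : ℕ → ℝ) : Prop :=
  f =O[atTop] fun l : ℕ => (2 : ℝ) ^ (-((l : ℝ) ^ α))

/-- A quantum algorithm that takes an `n`-bit string and returns a bit (at one value of the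
security parameter); it may use a quantum advice state. -/
structure Distinguisher (n : ℕ) where
  anc : ℕ
  advice : Op anc
  advice_isState : IsState advice
  circ : QCirc (n + anc) 1

/-- The probability that the distinguisher returns `1` on input `x`. -/
def Distinguisher.prob {n : ℕ} (D : Distinguisher n) (x : Bits n) : ℝ :=
  accept (D.circ.sem (tensor (ket x) D.advice))

/-- Number of gates and of advice qubits. -/
def Distinguisher.cost {n : ℕ} (D : Distinguisher n) : ℕ := D.circ.size + D.anc

/-! ### Puncturable pseudorandom functions -/

/-- The algorithms of a puncturable PRF with functions from `inLen l` bits to `outLen l` bits: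
`gen` makes a key from random coins; `fn` takes a key and a point; `puncture` takes a key, a list of
`k` points and random coins, and returns a punctured key; `fnPunct` takes a punctured key and a
point. -/
structure PPRF (inLen outLen : ℕ → ℕ) where
  key : ℕ → ℕ
  genCoins : ℕ → ℕ
  gen : ∀ l, Alg (genCoins l) (key l)
  fn : ∀ l, Alg (key l + inLen l) (outLen l)
  punctKey : ℕ → ℕ → ℕ
  punctCoins : ℕ → ℕ → ℕ
  puncture : ∀ l k, Alg (key l + k * inLen l + punctCoins l k) (punctKey l k)
  fnPunct : ∀ l k, Alg (punctKey l k + inLen l) (outLen l)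

namespace PPRF

variable {inLen outLen : ℕ → ℕ} (F : PPRF inLen outLen)

/-- A key, generated with the coins `g`. -/
def genKey (l : ℕ) (g : Bits (F.genCoins l)) : Bits (F.key l) := (F.gen l).eval g

/-- The value at `x` of the function with key `K`. -/
def value (l : ℕ) (K : Bits (F.key l)) (x : Bits (inLen l)) : Bits (outLen l) :=
  (F.fn l).eval (Fin.append K x)

/-- The key `K` punctured at the points `S`, with coins `r`. -/
def punctured (l : ℕ) {k : ℕ} (K : Bits (F.key l)) (S : Fin k → Bits (inLen l))
    (r : Bits (F.punctCoins l k)) : Bits (F.punctKey l k) :=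
  (F.puncture l k).eval (Fin.append (Fin.append K (Bits.flatten S)) r)

/-- All algorithms run in polynomial time (in the security parameter and the number of punctured
points). -/
def Efficient : Prop :=
  PolyBounded (fun l => inLen l + outLen l + F.key l + F.genCoins l + (F.gen l).cost +
    (F.fn l).cost) ∧
  ∃ p : Polynomial ℕ, ∀ l k, F.punctKey l k + F.punctCoins l k + (F.puncture l k).cost +
    (F.fnPunct l k).cost ≤ p.eval (l + k)

/-- A punctured key determines the function outside of the punctured set. -/
def PuncturedCorrectness : Prop :=
  ∀ (l k : ℕ) (S : Fin k → Bits (inLen l)), Function.Injective S →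
    ∀ (g : Bits (F.genCoins l)) (r : Bits (F.punctCoins l k)) (x : Bits (inLen l)),
      x ∉ Set.range S →
        (F.fnPunct l k).eval (Fin.append (F.punctured l (F.genKey l g) S r) x) =
          F.value l (F.genKey l g) x

/-- The probability that `D` returns `1`, given a key punctured at `S` and the true values of the
function at the points of `S`. -/
def realProb (l : ℕ) {k : ℕ} (S : Fin k → Bits (inLen l))
    (D : Distinguisher (F.punctKey l k + k * outLen l)) : ℝ :=
  expect fun g => expect fun r =>
    D.prob (Fin.append (F.punctured l (F.genKey l g) S r)
      (Bits.flatten fun i => F.value l (F.genKey l g) (S i)))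

/-- The same with independent uniformly random strings in place of the values. -/
def idealProb (l : ℕ) {k : ℕ} (S : Fin k → Bits (inLen l))
    (D : Distinguisher (F.punctKey l k + k * outLen l)) : ℝ :=
  expect fun g => expect fun r => expect fun u =>
    D.prob (Fin.append (F.punctured l (F.genKey l g) S r) u)

/-- Sub-exponential pseudorandomness at punctured points. -/
def SubExpPseudorandom : Prop :=
  ∃ α : ℝ, 0 < α ∧ α < 1 ∧
    ∀ (k : ℕ → ℕ) (S : ∀ l, Fin (k l) → Bits (inLen l))
      (D : ∀ l, Distinguisher (F.punctKey l (k l) + k l * outLen l)),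
      PolyBounded k → (∀ l, Function.Injective (S l)) → PolyBounded (fun l => (D l).cost) →
        SubExpSmall α fun l => F.realProb l (S l) (D l) - F.idealProb l (S l) (D l)

/-- Sub-exponentially secure puncturable PRFs. -/
def SubExpSecure : Prop := F.Efficient ∧ F.PuncturedCorrectness ∧ F.SubExpPseudorandom

end PPRF

/-! ### Indistinguishability obfuscation -/

/-- An obfuscator takes the security parameter `l`, a circuit with `n` inputs, `m` outputs and `s`
inner gates, and random coins, and returns a circuit with `n` inputs and `m` outputs. -/
structure Obfuscator where
  coins : ℕ → ℕ → ℕ → ℕ → ℕ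
  outGates : ℕ → ℕ → ℕ → ℕ → ℕ
  alg : ∀ l n m s, Alg (descLen n m s + coins l n m s) (descLen n m (outGates l n m s))

/-- A sampler (at one value of the security parameter): from random coins, it makes two circuits of
the same size and an auxiliary string. -/
structure Sampler where
  (n m s aux coins : ℕ)
  alg : Alg coins (descLen n m s + descLen n m s + aux)

namespace Sampler

/-- The first circuit (for `false`) or the second one (for `true`). -/
def circuit (P : Sampler) (b : Bool) (r : Bits P.coins) : Circuit P.n P.m P.s :=
  if b then (P.alg.eval r).left.right else (P.alg.eval r).left.left

/-- The auxiliary string. -/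
def auxiliary (P : Sampler) (r : Bits P.coins) : Bits P.aux := (P.alg.eval r).right

/-- Running time and lengths. -/
def cost (P : Sampler) : ℕ := P.n + P.m + P.s + P.aux + P.coins + P.alg.cost

/-- The two circuits always compute the same function. -/
def Equivalent (P : Sampler) : Prop :=
  ∀ r x, (P.circuit false r).eval x = (P.circuit true r).eval x

end Sampler

namespace Obfuscator

variable (O : Obfuscator)

/-- The obfuscation of `C`, with coins `r`. -/
def obf (l : ℕ) {n m s : ℕ} (C : Circuit n m s) (r : Bits (O.coins l n m s)) :
    Circuit n m (O.outGates l n m s) :=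
  (O.alg l n m s).eval (Fin.append C r)

/-- Polynomial running time, in the security parameter and the size of the circuit. -/
def Efficient : Prop :=
  ∃ p : Polynomial ℕ, ∀ l n m s,
    O.coins l n m s + O.outGates l n m s + (O.alg l n m s).cost ≤ p.eval (l + n + m + s)

/-- Obfuscation preserves the function. -/
def Functionality : Prop :=
  ∀ (l n m s : ℕ) (C : Circuit n m s) (r : Bits (O.coins l n m s)) (x : Bits n),
    (O.obf l C r).eval x = C.eval x

/-- The probability that `D` returns `1`, given the obfuscation of one of the two sampled circuits
and the auxiliary string. -/
def prob (l : ℕ) (P : Sampler) (D : Distinguisher (descLen P.n P.m (O.outGates l P.n P.m P.s) +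
    P.aux)) (b : Bool) : ℝ :=
  expect fun r => expect fun c =>
    D.prob (Fin.append (O.obf l (P.circuit b r) c) (P.auxiliary r))

/-- Sub-exponential indistinguishability of the obfuscations of equivalent circuits. -/
def SubExpIndistinguishable : Prop :=
  ∃ α : ℝ, 0 < α ∧ α < 1 ∧
    ∀ (P : ℕ → Sampler) (D : ∀ l, Distinguisher
      (descLen (P l).n (P l).m (O.outGates l (P l).n (P l).m (P l).s) + (P l).aux)),
      PolyBounded (fun l => (P l).cost) → (∀ l, (P l).Equivalent) →
        PolyBounded (fun l => (D l).cost) →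
          SubExpSmall α fun l => O.prob l (P l) (D l) false - O.prob l (P l) (D l) true

/-- Sub-exponentially secure indistinguishability obfuscators for polynomial-size circuits. -/
def SubExpSecure : Prop := O.Efficient ∧ O.Functionality ∧ O.SubExpIndistinguishable

end Obfuscator

/-! ### Single-decryptor functional encryption and its adaptive security -/

/-- A single-decryptor functional encryption scheme at one value of the security parameter.
Plaintexts, descriptions of functions and values of functions are bit strings, and `app f x` is the
value at `x` of the function with description `f`.  `setup` returns the public key and the master
secret key; `setup` and `enc` take their random coins as the last argument.  The last `out` qubits
that `dec` returns hold the decrypted value, the first one signals a failure. -/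
structure SDFE where
  (pk msk fn inp out sk ct setupCoins encCoins : ℕ)
  app : Bits fn → Bits inp → Bits out
  setup : Bits setupCoins → Bits pk × Bits msk
  qkg : Bits msk → Bits fn → Op sk
  enc : Bits pk → Bits inp → Bits encCoins → Bits ct
  dec : Op sk → Bits ct → Op (1 + out)

/-- One round of key queries of an adversary with `w` qubits of memory: `ask` returns the new memory
and a message; if the first bit of the message is `1`, then the rest of the message is queried, and
`receive` takes the memory and the secret key; otherwise there is no query in this round. -/
structure Round (w fn sk : ℕ) where
  ask : QCirc w (w + (1 + fn))
  receive : QCirc (w + sk) w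

/-- An adversary in the adaptive security experiment (at one value of the security parameter), with
`w` qubits of memory and a quantum advice state of `anc` qubits. -/
structure Adversary (pk fn inp sk ct : ℕ) where
  (w anc : ℕ)
  advice : Op anc
  advice_isState : IsState advice
  start : QCirc (pk + anc) w
  pre : List (Round w fn sk)
  challenge : QCirc w (w + (inp + inp))
  receive : QCirc (w + ct) w
  post : List (Round w fn sk)
  guess : QCirc w 1

/-- Number of gates, rounds, and qubits of memory and advice. -/
def Adversary.cost {pk fn inp sk ct : ℕ} (A : Adversary pk fn inp sk ct) : ℕ :=
  A.w + A.anc + A.start.size + A.challenge.size + A.receive.size + A.guess.size +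
    (A.pre.map fun R => R.ask.size + R.receive.size + 1).sum +
    (A.post.map fun R => R.ask.size + R.receive.size + 1).sum

namespace SDFE

variable (S : SDFE)

open Classical in
/-- A sequence of rounds of key queries.  `Q` is the list of the functions queried so far, `ρ` the
(unnormalized) state of the memory, and `k` the probability to win (the experiment returns `1`) as
a function of the list of queries and the memory after these rounds.  The experiment stops with
output `0` as soon as the list of queries is not `allowed`. -/
def queries (msk : Bits S.msk) (allowed : List (Bits S.fn) → Prop) {w : ℕ}
    (k : List (Bits S.fn) → Op w → ℝ) :
    List (Round w S.fn S.sk) → List (Bits S.fn) → Op w → ℝ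
  | [], Q, ρ => k Q ρ
  | R :: Rs, Q, ρ => ∑ y : Bits (1 + S.fn),
      if y.left 0 = false then queries msk allowed k Rs Q (outcome (R.ask.sem ρ) y)
      else if allowed (y.right :: Q) then
        queries msk allowed k Rs (y.right :: Q)
          (R.receive.sem (tensor (outcome (R.ask.sem ρ) y) (S.qkg msk y.right)))
      else 0

open Classical in
/-- The probability that the adaptive security experiment with the bit `coin` and at most `bound`
key queries returns `1`.  The experiment returns `0` if there are more queries or if one of the
queried functions separates the two challenge plaintexts. -/
def experiment (bound : ℕ∞) (A : Adversary S.pk S.fn S.inp S.sk S.ct) (coin : Bool) : ℝ :=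
  expect fun r : Bits S.setupCoins =>
    S.queries (S.setup r).2 (fun Q => (Q.length : ℕ∞) ≤ bound)
      (fun Q ρ => ∑ x : Bits (S.inp + S.inp),
        if ∀ f ∈ Q, S.app f x.left = S.app f x.right then
          expect fun e : Bits S.encCoins =>
            S.queries (S.setup r).2
              (fun Q' => (Q'.length : ℕ∞) ≤ bound ∧ ∀ f ∈ Q', S.app f x.left = S.app f x.right)
              (fun _ ρ' => accept (A.guess.sem ρ'))
              A.post Q
              (A.receive.sem (tensor (outcome (A.challenge.sem ρ) x)
                (ket (S.enc (S.setup r).1 (if coin then x.right else x.left) e))))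
        else 0)
      A.pre [] (A.start.sem (tensor (ket (S.setup r).1) A.advice))

/-- The advantage of an adversary. -/
def advantage (bound : ℕ∞) (A : Adversary S.pk S.fn S.inp S.sk S.ct) : ℝ :=
  |S.experiment bound A false - S.experiment bound A true|

end SDFE

/-- Adaptive security: no bound on the number of key queries. -/
def AdaptivelySecure (S : ℕ → SDFE) : Prop :=
  ∀ A : ∀ l, Adversary (S l).pk (S l).fn (S l).inp (S l).sk (S l).ct,
    PolyBounded (fun l => (A l).cost) → Negligible fun l => (S l).advantage ⊤ (A l)

/-- Sub-exponential adaptive single-key security: at most one key query. -/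
def SubExpAdaptivelySingleKeySecure (S : ℕ → SDFE) : Prop :=
  ∃ α : ℝ, 0 < α ∧ α < 1 ∧
    ∀ A : ∀ l, Adversary (S l).pk (S l).fn (S l).inp (S l).sk (S l).ct,
      PolyBounded (fun l => (A l).cost) → SubExpSmall α fun l => (S l).advantage 1 (A l)

/-- The algorithms of a single-decryptor functional encryption scheme: `app` takes a function and a
plaintext; `setup` takes coins; `qkg` takes a master secret key and a function; `enc` takes a
plaintext, a public key and coins; `dec` takes a quantum secret key and a ciphertext. -/
structure SDFEAlgs where
  (pk msk fn inp out sk ct setupCoins encCoins : ℕ → ℕ)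
  app : ∀ l, Alg (fn l + inp l) (out l)
  setup : ∀ l, Alg (setupCoins l) (pk l + msk l)
  qkg : ∀ l, QCirc (msk l + fn l) (sk l)
  enc : ∀ l, Alg (inp l + (pk l + encCoins l)) (ct l)
  dec : ∀ l, QCirc (sk l + ct l) (1 + out l)

namespace SDFEAlgs

variable (E : SDFEAlgs)

/-- The scheme given by the algorithms. -/
def scheme (l : ℕ) : SDFE where
  pk := E.pk l
  msk := E.msk l
  fn := E.fn l
  inp := E.inp l
  out := E.out l
  sk := E.sk l
  ct := E.ct l
  setupCoins := E.setupCoins l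
  encCoins := E.encCoins l
  app f x := (E.app l).eval (Fin.append f x)
  setup r := (((E.setup l).eval r).left, ((E.setup l).eval r).right)
  qkg K f := (E.qkg l).sem (ket (Fin.append K f))
  enc P x r := (E.enc l).eval (Fin.append x (Fin.append P r))
  dec ρ c := (E.dec l).sem (tensor ρ (ket c))

/-- All algorithms run in polynomial time. -/
def Efficient : Prop :=
  PolyBounded fun l => E.pk l + E.msk l + E.fn l + E.inp l + E.out l + E.sk l + E.ct l +
    E.setupCoins l + E.encCoins l + (E.app l).cost + (E.setup l).cost + (E.qkg l).size +
    (E.enc l).cost + (E.dec l).size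

end SDFEAlgs

/-! ### Key bundling -/

section Bundling

variable {tag : ℕ → ℕ} (E : SDFEAlgs) (F : PPRF tag E.setupCoins) (G : PPRF tag E.encCoins)
  (O : Obfuscator) (padS padE : ℕ → ℕ)

/-- Number of inner gates of the setup circuit. -/
abbrev setupGates (l : ℕ) : ℕ :=
  Circuit.padded (1 + F.key l + (F.fn l).gates + E.setupCoins l + (E.setup l).gates) (padS l)

/-- The setup circuit with hardwired key `K`: on input a tag `τ`, it computes the coins
`r = F_K(τ)` and returns the public key made by the setup algorithm with coins `r`. -/
def setupCircuit (l : ℕ) (K : Bits (F.key l)) :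
    Circuit (tag l) (E.pk l) (setupGates E F padS l) :=
  ((Circuit.hardwire (F.fn l).circ K).comp (Circuit.take (E.setup l).circ)).pad (padS l)

/-- Number of inner gates of the obfuscated setup circuit. -/
abbrev pkGates (l : ℕ) : ℕ := O.outGates l (tag l) (E.pk l) (setupGates E F padS l)

/-- Number of inner gates of the encryption circuit. -/
abbrev encGates (l : ℕ) : ℕ :=
  Circuit.padded (pkGates E F O padS l + (1 + G.key l + (G.fn l).gates) +
    (E.pk l + E.encCoins l) + (1 + E.inp l + (E.enc l).gates)) (padE l)

/-- The encryption circuit with hardwired circuit `P`, key `K` and plaintext `x`: on input a tag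
`τ`, it computes the public key `P(τ)` and the coins `r = G_K(τ)`, and returns the encryption of `x`
under that public key with coins `r`. -/
def encCircuit (l : ℕ) (P : Circuit (tag l) (E.pk l) (pkGates E F O padS l)) (K : Bits (G.key l))
    (x : Bits (E.inp l)) : Circuit (tag l) (E.ct l) (encGates E F G O padS padE l) :=
  ((P.pair (Circuit.hardwire (G.fn l).circ K)).comp
    (Circuit.hardwire (E.enc l).circ x)).pad (padE l)

/-- Number of inner gates of the obfuscated encryption circuit. -/
abbrev ctGates (l : ℕ) : ℕ := O.outGates l (tag l) (E.ct l) (encGates E F G O padS padE l)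

/-- The key-bundled scheme.
* Setup: make a key `K` of `F`; the public key is the obfuscated setup circuit, the master secret
  key is `K`.
* Key generation: choose a random tag `τ`, run the setup of `E` with coins `F_K(τ)`, and return `τ`
  and a quantum key for `f` under the resulting master secret key.
* Encryption: make a key `K'` of `G`; the ciphertext is the obfuscated encryption circuit.
* Decryption: read the tag `τ`, evaluate the ciphertext (a circuit) at `τ`, and decrypt the result
  with the quantum key. -/
def bundled (l : ℕ) : SDFE where
  pk := descLen (tag l) (E.pk l) (pkGates E F O padS l)
  msk := F.key l
  fn := E.fn l
  inp := E.inp l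
  out := E.out l
  sk := E.sk l + tag l
  ct := descLen (tag l) (E.ct l) (ctGates E F G O padS padE l)
  setupCoins := F.genCoins l + O.coins l (tag l) (E.pk l) (setupGates E F padS l)
  encCoins := G.genCoins l + O.coins l (tag l) (E.ct l) (encGates E F G O padS padE l)
  app := (E.scheme l).app
  setup r := (O.obf l (setupCircuit E F padS l (F.genKey l r.left)) r.right, F.genKey l r.left)
  qkg K f := ((2 : ℂ) ^ tag l)⁻¹ • ∑ τ : Bits (tag l),
    tensor ((E.scheme l).qkg ((E.scheme l).setup (F.value l K τ)).2 f) (ket τ)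
  enc P x r := O.obf l (encCircuit E F G O padS padE l P (G.genKey l r.left) x) r.right
  dec ρ c := ∑ τ : Bits (tag l), (E.scheme l).dec (outcome ρ τ) (Circuit.eval c τ)

end Bundling

end KeyBundling

end

open KeyBundling

/-! Why the theorem is true. The tag attached to a secret key is independent of everything else, so
the tags of all query rounds can be drawn before the experiment begins; by linearity of quantum
channels the experiment is the average, over lists of tags, of a game with fixed tags
(`untagged_eq_avg`, `experiment_bundled`). By the birthday bound `avgL_not_nodup_le` the tags are
distinct except with probability quadratic in the number of rounds times `2 ^ (-tag)`, which is
negligible because the tag length is superlogarithmic. What remains is a game with fixed, pairwise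
distinct tags (`exists_bound_real`).

In that game the plaintext is exchanged tag by tag, in the lexicographic order of all `2 ^ tag`
tags. Hybrid `(i, b)` encrypts the second plaintext below `i`, the first one above `i`, and
plaintext number `b` at `i`. The ciphertext circuits of `(i, true)` and of `(i + 1, false)` compute
the same function, so obfuscation hides the difference. To pass from `(i, false)` to `(i, true)`,
the encryption PRF is punctured at `i` and its value there replaced by random coins; then the
obfuscated setup circuit is replaced by one with a punctured key and a hardwired public key at `i`,
and the setup coins at `i` are made random too. At this point the tag `i` carries an independent
instance of the single-key scheme, for which at most one key is queried because the tags are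
distinct; its security exchanges the plaintext, and the replacements are undone. The total loss is
at most `9 * 2 ^ tag` times a bound of the form `C * 2 ^ (-l ^ α)`, negligible since the tag length
is polylogarithmic (`negligible_two_pow_mul_subExp`).

Three matters make the argument long. Firstly, the plaintexts are chosen adaptively, while
obfuscation security speaks of circuits fixed in advance. Adversaries have quantum advice, so the
memory at the moment of the challenge can be taken as advice and the plaintexts as constants
(`abs_game_le_of_fromChallenge`). All other data that a reduction does not receive are likewise
fixed to arbitrary values; this requires constants that are uniform in those values and in the
exponentially many tags, which `exists_uniform_bound` extracts from the asymptotic hypotheses.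

Secondly, each reduction must be an actual quantum circuit of polynomial size. It carries a
classical record of the queries and decides only at the end whether they were admissible
(`SimCircuits.value_rounds`); against the single-key scheme it forwards the queries for one tag and
answers the others itself (`SimCircuits.untagged_outerRounds`).

Thirdly, the hybrid circuits must have exactly the padded size and must be computable from the data
that a reduction holds. This is what the calculus `PolyC` of functions with polynomial-size circuits
and the lemma `PolyC.exists_circuits` provide. -/

noncomputable section

namespace KeyBundling

/-! ### Evaluation of circuits -/

theorem Bits.append_left {m n : ℕ} (a : Bits m) (b : Bits n) :
    Bits.left (Fin.append a b : Bits (m + n)) = a := by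
  funext i; simp [Bits.left]

theorem Bits.append_right {m n : ℕ} (a : Bits m) (b : Bits n) :
    Bits.right (Fin.append a b : Bits (m + n)) = b := by
  funext i; simp [Bits.right]

theorem Bits.append_eta {m n : ℕ} (x : Bits (m + n)) : Fin.append x.left x.right = x := by
  funext i
  refine Fin.addCases (fun j => ?_) (fun j => ?_) i <;> simp [Bits.left, Bits.right]

theorem forall_fin_add {m n : ℕ} {p : Fin (m + n) → Prop} :
    (∀ i, p i) ↔ (∀ i, p (Fin.castAdd n i)) ∧ ∀ i, p (Fin.natAdd m i) :=
  ⟨fun h => ⟨fun _ => h _, fun _ => h _⟩, fun h i => Fin.addCases h.1 h.2 i⟩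

namespace Circuit

variable {n m k s a b : ℕ}

@[simp] theorem cell_ofCells (c : Fin s ⊕ Fin m → Fin n ⊕ Fin s → Bool) (i j) :
    (ofCells c : Circuit n m s).cell i j = c i j := by
  simp [cell, ofCells]

/-- The values of all inner wires. -/
def inner (C : Circuit n m s) (x : Bits n) : Bits s := C.wires x s

theorem nand_congr (C : Circuit n m s) (x : Bits n) (t : ℕ) {v v' : Bits s}
    (h : ∀ j : Fin s, (j : ℕ) < t → v j = v' j) (i) : C.nand x t v i = C.nand x t v' i := by
  unfold nand
  congr 2
  apply propext
  refine and_congr_right fun _ => forall_congr' fun j => ?_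
  refine forall_congr' fun hj => ?_
  rw [h j hj]

/-- A gate reads only wires of smaller number, so the gate equations have a unique solution, found
by induction on the evaluation time. -/
theorem wires_eq_of_fixed (C : Circuit n m s) (x : Bits n) (v : Bits s)
    (h : ∀ i : Fin s, v i = C.nand x i v (Sum.inl i)) (t : ℕ) :
    ∀ j : Fin s, (j : ℕ) < t → C.wires x t j = v j := by
  induction t with
  | zero => intro j hj; omega
  | succ t ih =>
    intro j hj
    simp only [wires]
    split_ifs with hjt
    · rw [h j, hjt]
      exact nand_congr C x t ih _
    · exact ih j (by omega)

theorem inner_eq_of_fixed (C : Circuit n m s) (x : Bits n) (v : Bits s)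
    (h : ∀ i : Fin s, v i = C.nand x i v (Sum.inl i)) : C.inner x = v :=
  funext fun j => wires_eq_of_fixed C x v h s j j.2

theorem wires_stable (C : Circuit n m s) (x : Bits n) (t d : ℕ) (j : Fin s) (hj : (j : ℕ) < t) :
    C.wires x (t + d) j = C.wires x t j := by
  induction d with
  | zero => rfl
  | succ d ih =>
    rw [← add_assoc, ← ih]
    exact if_neg (by omega)

/-- Wire `i` gets its value at time `i + 1` and keeps it, and gate `i` does not look at later wires.
-/
theorem inner_fixed (C : Circuit n m s) (x : Bits n) (i : Fin s) :
    C.inner x i = C.nand x i (C.inner x) (Sum.inl i) := by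
  have key : ∀ t : ℕ, (t ≤ s) → ∀ j : Fin s, (j : ℕ) < t → C.inner x j = C.wires x t j := by
    intro t ht j hj
    obtain ⟨d, rfl⟩ := Nat.exists_eq_add_of_le ht
    exact wires_stable C x t d j hj
  rw [key (i + 1) i.2 i (Nat.lt_succ_self _)]
  refine (if_pos rfl).trans ?_
  exact nand_congr C x i (fun j hj => (key i i.2.le j hj).symm) _

theorem eval_eq (C : Circuit n m s) (x : Bits n) (o : Fin m) :
    C.eval x o = C.nand x s (C.inner x) (Sum.inr o) := rfl

/-- To evaluate a composed circuit it suffices to guess the values of its inner wires and to check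
the gate equations; the time-step recursion need not be followed again. -/
theorem eval_of_fixed (C : Circuit n m s) (x : Bits n) (v : Bits s)
    (h : ∀ i : Fin s, v i = C.nand x i v (Sum.inl i)) (o : Fin m) :
    C.eval x o = C.nand x s v (Sum.inr o) := by
  rw [eval_eq, inner_eq_of_fixed C x v h]

@[simp] theorem split3_left (i : Fin a) :
    split3 (Fin.castAdd b (Fin.castAdd k i)) = .inl (.inl i) := by
  simp [split3]

@[simp] theorem split3_mid (i : Fin k) :
    split3 (Fin.castAdd b (Fin.natAdd a i)) = .inl (.inr i) := by
  simp [split3]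

@[simp] theorem split3_right (i : Fin b) :
    split3 (Fin.natAdd (a + k) i) = .inr i := by
  simp [split3]

theorem eval_comp (C : Circuit n k a) (D : Circuit k m b) (x : Bits n) :
    (C.comp D).eval x = D.eval (C.eval x) := by
  funext o
  -- The guess: the inner wires of `C`, then its outputs (now inner wires of the composite), then
  -- the inner wires of `D` on these outputs.
  rw [eval_of_fixed _ x (Fin.append (Fin.append (C.inner x) (C.eval x)) (D.inner (C.eval x)))]
  · rw [eval_eq]
    simp [nand, comp, forall_fin_add]
  · refine forall_fin_add.2 ⟨forall_fin_add.2 ⟨fun i => ?_, fun i => ?_⟩, fun i => ?_⟩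
    · simp only [Fin.append_left]
      rw [inner_fixed]
      simp [nand, comp, forall_fin_add]
    · simp only [Fin.append_left, Fin.append_right]
      -- An output gate of `C` becomes inner gate `a + i`; all inner wires of `C` precede it, so the
      -- restriction to earlier wires is void.
      have e : ∀ j : Fin a, (j : ℕ) < a + i := fun j => by omega
      rw [eval_eq]
      simp [nand, comp, forall_fin_add, e]
    · simp only [Fin.append_right]
      have e : ∀ j : Fin k, a + (j : ℕ) < a + k + i := fun j => by omega
      rw [inner_fixed]
      simp [nand, comp, forall_fin_add, e]

/-- The gate of a constant bit reads the constant `false` wire if the bit is true, and no wire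
otherwise: the NAND of `false` is true and the NAND of nothing is false. -/
theorem eval_hardwire (C : Circuit (k + n) m s) (c : Bits k) (x : Bits n) :
    (C.hardwire c).eval x = C.eval (Fin.append c x) := by
  funext o
  rw [eval_of_fixed _ x (Fin.append (Fin.append (fun _ : Fin 1 => false) c)
    (C.inner (Fin.append c x)))]
  · rw [eval_eq]
    simp [nand, hardwire, forall_fin_add, Bool.or_assoc, Bool.or_left_comm]
  · refine forall_fin_add.2 ⟨forall_fin_add.2 ⟨fun i => ?_, fun i => ?_⟩, fun i => ?_⟩
    · simp [nand, hardwire]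
    · simp [nand, hardwire, forall_fin_add]
    · simp only [Fin.append_right]
      have e : ∀ j : Fin k, 1 + (j : ℕ) < 1 + k + i := fun j => by omega
      rw [inner_fixed]
      simp [nand, hardwire, forall_fin_add, e, Bool.or_assoc, Bool.or_left_comm]

theorem eval_pair (C : Circuit n k a) (D : Circuit n m b) (x : Bits n) :
    (C.pair D).eval x = Fin.append (C.eval x) (D.eval x) := by
  have h : ∀ o, (C.pair D).eval x o = (C.pair D).nand x (a + b)
      (Fin.append (C.inner x) (D.inner x)) (Sum.inr o) := by
    apply eval_of_fixed
    refine forall_fin_add.2 ⟨fun i => ?_, fun i => ?_⟩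
    · simp only [Fin.append_left]
      rw [inner_fixed]
      simp [nand, pair, forall_fin_add]
    · simp only [Fin.append_right]
      rw [inner_fixed]
      simp [nand, pair, forall_fin_add]
  funext o
  rw [h]
  revert o
  refine forall_fin_add.2 ⟨fun i => ?_, fun i => ?_⟩
  · simp only [Fin.append_left]
    rw [eval_eq]
    simp [nand, pair, forall_fin_add]
  · simp only [Fin.append_right]
    rw [eval_eq]
    simp [nand, pair, forall_fin_add]

theorem eval_take {q : ℕ} (C : Circuit n (m + q) s) (x : Bits n) :
    C.take.eval x = (C.eval x).left := by
  funext o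
  rw [eval_of_fixed _ x (C.inner x)]
  · simp [Bits.left, eval_eq, nand, take]
  · intro i
    rw [inner_fixed]
    simp [nand, take]

theorem eval_pad (C : Circuit n m s) (t : ℕ) (x : Bits n) : (C.pad t).eval x = C.eval x := by
  funext o
  rw [eval_of_fixed _ x (Fin.append (C.inner x) (fun _ : Fin (t - s) => false))]
  · rw [eval_eq]
    simp [nand, pad, forall_fin_add]
  · refine forall_fin_add.2 ⟨fun i => ?_, fun i => ?_⟩
    · simp only [Fin.append_left]
      rw [inner_fixed]
      simp [nand, pad, forall_fin_add]
    · simp [nand, pad]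

theorem exists_gates_of_le (C : Circuit n m s) {t : ℕ} (h : s ≤ t) :
    ∃ C' : Circuit n m t, ∀ x, C'.eval x = C.eval x := by
  have e : padded s t = t := by unfold padded; omega
  exact e ▸ ⟨C.pad t, fun x => eval_pad C t x⟩

/-- The circuit each of whose outputs is a constant or an input. -/
def rewire (g : Fin m → Bool ⊕ Fin n) : Circuit n m (n + 1) :=
  ofCells fun i j =>
    match Sum.map finSumFinEquiv.symm g i, Sum.map id finSumFinEquiv.symm j with
    | .inl (.inl i), .inl j => decide (i = j)
    | .inr (.inl b), .inr (.inr _) => b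
    | .inr (.inr i), .inr (.inl j) => decide (i = j)
    | _, _ => false

theorem eval_rewire (g : Fin m → Bool ⊕ Fin n) (x : Bits n) (o : Fin m) :
    (rewire g).eval x o = Sum.elim id x (g o) := by
  -- The inner gates negate the inputs, and one more reads nothing and is `false`. An output negates
  -- a negated input, or reads the `false` wire precisely when it has to be true.
  rw [eval_of_fixed _ x (Fin.append (fun j => !(x j)) (fun _ : Fin 1 => false))]
  · rcases h : g o with b | j <;> simp [nand, rewire, forall_fin_add, h]
  · refine forall_fin_add.2 ⟨fun i => ?_, fun i => ?_⟩
    · simp [nand, rewire]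
    · simp [nand, rewire]

/-- The NAND of all inputs. -/
def nandAll (n : ℕ) : Circuit n 1 0 := ofCells fun _ _ => true

theorem eval_nandAll (x : Bits n) (o : Fin 1) :
    (nandAll n).eval x o = !decide (∀ j, x j = true) := by
  rw [eval_eq]
  simp [nand, nandAll]

/-- One circuit per output bit, placed side by side; `pair` adds the numbers of inner gates. This
permits arguing bit by bit below. -/
theorem exists_of_outputs {X : Type} (e : X → Bits n) (g : Fin m → X → Bool)
    (h : ∀ k, ∃ C : Circuit n 1 s, ∀ x o, C.eval (e x) o = g k x) :
    ∃ C : Circuit n m (s * m), ∀ x k, C.eval (e x) k = g k x := by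
  induction m with
  | zero => exact ⟨fun _ => false, fun _ k => k.elim0⟩
  | succ m ih =>
    obtain ⟨C, hC⟩ := ih (fun k => g k.castSucc) fun k => h k.castSucc
    obtain ⟨D, hD⟩ := h (Fin.last m)
    refine ⟨C.pair D, fun x k => ?_⟩
    rw [eval_pair]
    induction k using Fin.lastCases with
    | last => exact (Fin.append_right _ _ (0 : Fin 1)).trans (hD x 0)
    | cast k => exact (Fin.append_left _ _ k).trans (hC x k)

end Circuit

/-! ### Families of functions with circuits of polynomial size -/

theorem polynomial_eval_mono (p : Polynomial ℕ) {a b : ℕ} (h : a ≤ b) : p.eval a ≤ p.eval b := by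
  rw [Polynomial.eval_eq_sum, Polynomial.eval_eq_sum]
  exact Finset.sum_le_sum fun i _ => Nat.mul_le_mul_left _ (Nat.pow_le_pow_left h i)

section PolyIn

variable {I J : Type} {B f g : I → ℕ}

/-- `f` is bounded by a polynomial in `B`. -/
def PolyIn (B f : I → ℕ) : Prop := ∃ p : Polynomial ℕ, ∀ i, f i ≤ p.eval (B i)

theorem PolyIn.mono (hg : PolyIn B g) (h : ∀ i, f i ≤ g i) : PolyIn B f :=
  hg.imp fun _ hp i => (h i).trans (hp i)

theorem PolyIn.self : PolyIn B B := ⟨Polynomial.X, fun i => by simp⟩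

theorem PolyIn.const (n : ℕ) : PolyIn B fun _ => n := ⟨Polynomial.C n, fun i => by simp⟩

theorem PolyIn.add (hf : PolyIn B f) (hg : PolyIn B g) : PolyIn B fun i => f i + g i := by
  obtain ⟨p, hp⟩ := hf
  obtain ⟨q, hq⟩ := hg
  exact ⟨p + q, fun i => by simpa using add_le_add (hp i) (hq i)⟩

theorem PolyIn.mul (hf : PolyIn B f) (hg : PolyIn B g) : PolyIn B fun i => f i * g i := by
  obtain ⟨p, hp⟩ := hf
  obtain ⟨q, hq⟩ := hg
  exact ⟨p * q, fun i => by simpa using Nat.mul_le_mul (hp i) (hq i)⟩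

theorem PolyIn.eval (hf : PolyIn B f) (q : Polynomial ℕ) : PolyIn B fun i => q.eval (f i) := by
  obtain ⟨p, hp⟩ := hf
  exact ⟨q.comp p, fun i => by
    rw [Polynomial.eval_comp]; exact polynomial_eval_mono q (hp i)⟩

theorem PolyIn.reindex (hf : PolyIn B f) (φ : J → I) : PolyIn (fun j => B (φ j)) fun j => f (φ j) :=
  hf.imp fun _ hp j => hp (φ j)

theorem PolyIn.cost {n m s : I → ℕ} (hn : PolyIn B n) (hm : PolyIn B m) (hs : PolyIn B s) :
    PolyIn B fun i => Circuit.cost (n i) (m i) (s i) :=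
  (hs.add hm).mul ((hn.add hs).add (.const 1))

theorem PolyIn.descLen {n m s : I → ℕ} (hn : PolyIn B n) (hm : PolyIn B m) (hs : PolyIn B s) :
    PolyIn B fun i => descLen (n i) (m i) (s i) :=
  (hs.add hm).mul (hn.add hs)

end PolyIn

/-- Types with an encoding as bit strings of some length. -/
class Enc (X : Type) where
  len : ℕ
  enc : X → Bits len

open Enc

instance (n : ℕ) : Enc (Bits n) := ⟨n, id⟩

instance : Enc Bool := ⟨1, fun b _ => b⟩

instance {X Y : Type} [Enc X] [Enc Y] : Enc (X × Y) :=
  ⟨len X + len Y, fun p => Fin.append (enc p.1) (enc p.2)⟩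

theorem enc_prod {X Y : Type} [Enc X] [Enc Y] (x : X) (y : Y) :
    enc (x, y) = Fin.append (enc x) (enc y) := rfl

section PolyC

variable {I J : Type} {B : I → ℕ}

/-- Encodings of polynomial length. -/
def PolyT (B : I → ℕ) (X : I → Type) [∀ i, Enc (X i)] : Prop := PolyIn B fun i => len (X i)

/-- The functions `f i` are computed by circuits of size polynomial in `B i`. -/
structure PolyC (B : I → ℕ) {X Y : I → Type} [∀ i, Enc (X i)] [∀ i, Enc (Y i)]
    (f : ∀ i, X i → Y i) : Prop where
  dom : PolyT B X
  cod : PolyT B Y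
  circ : ∃ p : Polynomial ℕ, ∀ i, ∃ C : Circuit (len (X i)) (len (Y i)) (p.eval (B i)),
    ∀ x, C.eval (enc x) = enc (f i x)

variable {X Y Z D : I → Type} [∀ i, Enc (X i)] [∀ i, Enc (Y i)] [∀ i, Enc (Z i)] [∀ i, Enc (D i)]
  {n m k : I → ℕ}

theorem PolyT.bits (h : PolyIn B n) : PolyT B fun i => Bits (n i) := h

theorem PolyT.bool : PolyT B fun _ => Bool := PolyIn.const 1

theorem PolyT.prod (hX : PolyT B X) (hY : PolyT B Y) : PolyT B fun i => X i × Y i :=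
  PolyIn.add hX hY

namespace PolyC

theorem of_gates {f : ∀ i, X i → Y i} (hX : PolyT B X) (hY : PolyT B Y) {s : I → ℕ}
    (hs : PolyIn B s) (h : ∀ i, ∃ C : Circuit (len (X i)) (len (Y i)) (s i),
      ∀ x, C.eval (enc x) = enc (f i x)) : PolyC B f := by
  obtain ⟨p, hp⟩ := hs
  refine ⟨hX, hY, p, fun i => ?_⟩
  obtain ⟨C, hC⟩ := h i
  obtain ⟨C', hC'⟩ := C.exists_gates_of_le (hp i)
  exact ⟨C', fun x => (hC' _).trans (hC x)⟩

theorem reindex {f : ∀ i, X i → Y i} (hf : PolyC B f) (φ : J → I) :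
    PolyC (fun j => B (φ j)) fun j => f (φ j) :=
  ⟨PolyIn.reindex hf.dom φ, PolyIn.reindex hf.cod φ, hf.circ.imp fun _ hp j => hp (φ j)⟩

/-- Covers all rearrangements of data (projections, concatenations, constants) at the price of one
gate per input and one for constants. -/
theorem of_proj {f : ∀ i, X i → Y i} (hX : PolyT B X) (hY : PolyT B Y)
    (h : ∀ i k, (∃ b, ∀ x, enc (f i x) k = b) ∨ ∃ j, ∀ x, enc (f i x) k = enc x j) :
    PolyC B f := by
  refine of_gates hX hY (PolyIn.add hX (.const 1)) fun i => ?_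
  have h' : ∀ k, ∃ g : Bool ⊕ Fin (len (X i)), ∀ x, enc (f i x) k = Sum.elim id (enc x) g := by
    intro k
    rcases h i k with ⟨b, hb⟩ | ⟨j, hj⟩
    · exact ⟨.inl b, hb⟩
    · exact ⟨.inr j, hj⟩
  choose g hg using h'
  exact ⟨Circuit.rewire g, fun x => funext fun k => by rw [Circuit.eval_rewire, hg]⟩

theorem id (hX : PolyT B X) : PolyC B fun i (x : X i) => x :=
  of_proj hX hX fun _ k => .inr ⟨k, fun _ => rfl⟩

theorem const (hX : PolyT B X) (hY : PolyT B Y) (c : ∀ i, Y i) :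
    PolyC B fun i (_ : X i) => c i :=
  of_proj hX hY fun _ _ => .inl ⟨_, fun _ => rfl⟩

theorem comp {f : ∀ i, X i → Y i} {g : ∀ i, Y i → Z i} (hg : PolyC B g) (hf : PolyC B f) :
    PolyC B fun i x => g i (f i x) := by
  obtain ⟨p, hp⟩ := hf.circ
  obtain ⟨q, hq⟩ := hg.circ
  refine of_gates hf.dom hg.cod
    (((PolyIn.self.eval p).add hf.cod).add (PolyIn.self.eval q)) fun i => ?_
  obtain ⟨C, hC⟩ := hp i
  obtain ⟨D, hD⟩ := hq i
  exact ⟨C.comp D, fun x => by rw [Circuit.eval_comp, hC, hD]⟩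

theorem pair {f : ∀ i, X i → Y i} {g : ∀ i, X i → Z i} (hf : PolyC B f) (hg : PolyC B g) :
    PolyC B fun i x => (f i x, g i x) := by
  obtain ⟨p, hp⟩ := hf.circ
  obtain ⟨q, hq⟩ := hg.circ
  refine of_gates hf.dom (hf.cod.prod hg.cod)
    ((PolyIn.self.eval p).add (PolyIn.self.eval q)) fun i => ?_
  obtain ⟨C, hC⟩ := hp i
  obtain ⟨D, hD⟩ := hq i
  exact ⟨C.pair D, fun x => by rw [Circuit.eval_pair, hC, hD, enc_prod]⟩

theorem fst {f : ∀ i, X i → Y i × Z i} (hY : PolyT B Y) (hZ : PolyT B Z) (hf : PolyC B f) :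
    PolyC B fun i x => (f i x).1 :=
  comp (g := fun _ (p : Y _ × Z _) => p.1) (of_proj (hY.prod hZ) hY fun _ k =>
    .inr ⟨Fin.castAdd _ k, fun p => (Fin.append_left (enc p.1) (enc p.2) k).symm⟩) hf

theorem snd {f : ∀ i, X i → Y i × Z i} (hY : PolyT B Y) (hZ : PolyT B Z) (hf : PolyC B f) :
    PolyC B fun i x => (f i x).2 :=
  comp (g := fun _ (p : Y _ × Z _) => p.2) (of_proj (hY.prod hZ) hZ fun _ k =>
    .inr ⟨Fin.natAdd _ k, fun p => (Fin.append_right (enc p.1) (enc p.2) k).symm⟩) hf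

theorem bit {f : ∀ i, X i → Y i} (hf : PolyC B f) (k : ∀ i, Fin (len (Y i))) :
    PolyC B fun i x => enc (f i x) (k i) :=
  comp (Y := Y) (Z := fun _ => Bool) (g := fun i (y : Y i) => enc y (k i))
    (of_proj hf.cod PolyT.bool fun i _ => .inr ⟨k i, fun _ => rfl⟩) hf

/-- The index is enlarged by the output position, so that a single polynomial bounds the circuits of
all output bits; without this uniformity the sum over the positions need not be polynomial. -/
theorem of_bits {f : ∀ i, X i → Y i} (hX : PolyT B X) (hY : PolyT B Y)
    (h : PolyC (I := Σ i, Fin (len (Y i))) (fun j => B j.1) (X := fun j => X j.1)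
      (Y := fun _ => Bool) fun j x => enc (f j.1 x) j.2) : PolyC B f := by
  obtain ⟨p, hp⟩ := h.circ
  refine of_gates hX hY (s := fun i => p.eval (B i) * len (Y i))
    ((PolyIn.self.eval p).mul hY) fun i => ?_
  obtain ⟨C, hC⟩ := Circuit.exists_of_outputs (s := p.eval (B i)) (enc : X i → _)
    (fun k x => enc (f i x) k) fun k => by
      obtain ⟨C, hC⟩ := hp ⟨i, k⟩
      exact ⟨C, fun x o => congrFun (hC x) o⟩
  exact ⟨C, fun x => funext (hC x)⟩

theorem append {f : ∀ i, X i → Bits (m i)} {g : ∀ i, X i → Bits (n i)} (hf : PolyC B f)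
    (hg : PolyC B g) : PolyC B fun i x => (Fin.append (f i x) (g i x) : Bits (m i + n i)) :=
  ⟨hf.dom, hf.cod.add hg.cod, (hf.pair hg).circ⟩

theorem mapBits {f : ∀ i, X i → Bits (m i)} (hf : PolyC B f) (hn : PolyIn B n)
    (φ : ∀ i, Fin (n i) → Fin (m i)) : PolyC B fun i x => (fun k => f i x (φ i k) : Bits (n i)) :=
  comp (Y := fun i => Bits (m i)) (Z := fun i => Bits (n i))
    (g := fun i (y : Bits (m i)) => fun k => y (φ i k))
    (of_proj hf.cod hn fun i k => .inr ⟨φ i k, fun _ => rfl⟩) hf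

theorem left {f : ∀ i, X i → Bits (m i + n i)} (hf : PolyC B f) :
    PolyC B fun i x => (f i x).left :=
  hf.mapBits (hf.cod.mono fun _ => Nat.le_add_right _ _) _

theorem right {f : ∀ i, X i → Bits (m i + n i)} (hf : PolyC B f) :
    PolyC B fun i x => (f i x).right :=
  hf.mapBits (hf.cod.mono fun _ => Nat.le_add_left _ _) _

theorem alg {f : ∀ i, X i → Bits (n i)} (hf : PolyC B f) {A : ∀ i, Alg (n i) (m i)}
    (hA : PolyIn B fun i => (A i).cost) : PolyC B fun i x => (A i).eval (f i x) := by
  refine comp (Y := fun i => Bits (n i)) (Z := fun i => Bits (m i)) (g := fun i => (A i).eval)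
    (of_gates hf.cod ?_ (s := fun i => (A i).gates) ?_ fun i => ⟨(A i).circ, fun x => rfl⟩) hf
  · refine hA.mono fun i => ?_
    show m i ≤ _
    unfold Alg.cost Circuit.cost
    nlinarith [Nat.zero_le ((A i).gates + m i), Nat.zero_le (n i + (A i).gates)]
  · refine hA.mono fun i => ?_
    unfold Alg.cost Circuit.cost
    nlinarith [Nat.zero_le ((A i).gates + m i), Nat.zero_le (n i + (A i).gates)]

/-! Boolean functions -/

/-- Fan-in is unbounded, so a NAND of many bits is a single gate. Connectives, equality tests and
bounded quantifiers are all derived from this. -/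
theorem nandBits {f : ∀ i, X i → Bits (n i)} (hf : PolyC B f) :
    PolyC B fun i x => !decide (∀ k, f i x k = true) :=
  comp (Y := fun i => Bits (n i)) (Z := fun _ => Bool)
    (g := fun i (y : Bits (n i)) => !decide (∀ k, y k = true))
    (of_gates hf.cod PolyT.bool (PolyIn.const 0) fun _ => ⟨Circuit.nandAll _, fun _ => funext fun _ =>
      Circuit.eval_nandAll _ _⟩) hf

theorem not {f : ∀ i, X i → Bool} (hf : PolyC B f) : PolyC B fun i x => !f i x := by
  have h := nandBits (n := fun _ => 1) (f := fun i x => fun _ => f i x)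
    ⟨hf.dom, hf.cod, hf.circ⟩
  simpa using h

theorem and {f g : ∀ i, X i → Bool} (hf : PolyC B f) (hg : PolyC B g) :
    PolyC B fun i x => f i x && g i x := by
  have h := nandBits (n := fun _ => 1 + 1)
    (f := fun i x => Fin.append (fun _ => f i x) (fun _ => g i x))
    ⟨hf.dom, hf.cod.add hg.cod, (hf.pair hg).circ⟩
  have e : ∀ i x, (!(!decide (∀ k, (Fin.append (fun _ => f i x) (fun _ => g i x) : Bits (1 + 1)) k
      = true))) = (f i x && g i x) := by
    intro i x
    rw [Bool.not_not, Bool.eq_iff_iff, decide_eq_true_eq, forall_fin_add]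
    simp only [Fin.append_left, Fin.append_right, forall_const, Bool.and_eq_true]
  simpa only [e] using h.not

theorem or {f g : ∀ i, X i → Bool} (hf : PolyC B f) (hg : PolyC B g) :
    PolyC B fun i x => f i x || g i x := by
  simpa using (hf.not.and hg.not).not

theorem beq {f g : ∀ i, X i → Bool} (hf : PolyC B f) (hg : PolyC B g) :
    PolyC B fun i x => decide (f i x = g i x) := by
  have h := (hf.and hg).or (hf.not.and hg.not)
  have e : ∀ a b : Bool, (a && b || !a && !b) = decide (a = b) := by decide
  simpa only [e] using h

theorem all (hX : PolyT B X) (hn : PolyIn B n) {f : ∀ j : Σ i, Fin (n i), X j.1 → Bool}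
    (hf : PolyC (fun j : Σ i, Fin (n i) => B j.1) (X := fun j => X j.1) f) :
    PolyC B fun i x => decide (∀ k, f ⟨i, k⟩ x = true) := by
  have h := nandBits (f := fun i x => fun k => f ⟨i, k⟩ x)
    (of_bits (Y := fun i => Bits (n i)) hX hn hf)
  simpa using h.not

theorem encAt {f : ∀ i, X i → Y i} (hf : PolyC B f) :
    PolyC (fun j : Σ i, Fin (len (Y i)) => B j.1) (X := fun j => X j.1) (Y := fun _ => Bool)
      fun j x => enc (f j.1 x) j.2 :=
  bit (X := fun j : Σ i, Fin (len (Y i)) => X j.1) (Y := fun j => Y j.1) (f := fun j => f j.1)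
    (hf.reindex Sigma.fst) fun j => j.2

theorem atIndex {f : ∀ i, X i → Bits (n i)} (hf : PolyC B f) :
    PolyC (fun j : Σ i, Fin (n i) => B j.1) (X := fun j => X j.1) (Y := fun _ => Bool)
      fun j x => f j.1 x j.2 :=
  encAt hf

theorem lift {f : ∀ i, X i → Y i} (hf : PolyC B f) (n : I → ℕ) :
    PolyC (fun j : Σ i, Fin (n i) => B j.1) (X := fun j => X j.1) (Y := fun j => Y j.1)
      fun j => f j.1 :=
  hf.reindex Sigma.fst

theorem decEq {f g : ∀ i, X i → Bits (n i)} (hf : PolyC B f) (hg : PolyC B g) :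
    PolyC B fun i x => decide (f i x = g i x) := by
  have h := all (n := n) hf.dom hf.cod (hf.atIndex.beq hg.atIndex)
  simpa [funext_iff] using h

theorem ite {c : ∀ i, X i → Bool} {f g : ∀ i, X i → Y i} (hc : PolyC B c) (hf : PolyC B f)
    (hg : PolyC B g) : PolyC B fun i x => if c i x = true then f i x else g i x := by
  refine of_bits hf.dom hf.cod ?_
  have h := ((hc.lift _).and hf.encAt).or ((hc.lift _).not.and hg.encAt)
  convert h using 3 with j x
  cases c j.1 x <;> simp

/-- The lexicographic order. -/
def _root_.KeyBundling.Bits.lt {n : ℕ} (x y : Bits n) : Bool :=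
  decide (∃ j, (∀ k, k < j → x k = y k) ∧ x j < y j)

/-- The existential quantifier over the deciding position is a negated universal one. The guard `k <
j` costs nothing: both positions belong to the index, so it is a constant. -/
theorem lexLt {f : ∀ i, X i → Bits (n i)} (hf : PolyC B f) (c : ∀ i, Bits (n i)) :
    PolyC B fun i x => (f i x).lt (c i) := by
  have hc : PolyC B fun i (_ : X i) => c i := const hf.dom hf.cod c
  have h1 := all (B := fun j : Σ i, Fin (n i) => B j.1) (X := fun j => X j.1) (n := fun j => n j.1)
    (hf.lift n).dom (hf.lift n).cod
    ((const (X := fun j : Σ j : Σ i, Fin (n i), Fin (n j.1) => X j.1.1)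
      (hf.atIndex.lift _).dom PolyT.bool fun j => !decide (j.2 < j.1.2)).or
      ((hf.lift n).atIndex.beq (hc.lift n).atIndex))
  have h2 := (all hf.dom hf.cod (h1.and (hf.atIndex.not.and hc.atIndex)).not).not
  convert h2 using 3 with i x
  rw [Bool.eq_iff_iff]
  simp only [Bits.lt, decide_eq_true_eq, Bool.not_eq_true', decide_eq_false_iff_not, not_forall,
    Bool.or_eq_true, Bool.and_eq_true, Bool.not_eq_false, Bool.lt_iff, imp_iff_not_or]
  exact Iff.rfl

end PolyC

/-! ### Circuits with hardwired data -/

section Smn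

variable {W : Type} [Enc W] {n m k s a b : ℕ}

/-- A constant or a bit of the encoding. -/
def Proj (g : W → Bool) : Prop := (∃ b, ∀ x, g x = b) ∨ ∃ j, ∀ x, g x = enc x j

theorem Proj.const (b : Bool) : Proj fun _ : W => b := .inl ⟨b, fun _ => rfl⟩

/-- Circuits each of whose table entries is a constant or a bit of the encoding. -/
def ProjCells (C : W → Circuit n m s) : Prop := ∀ i j, Proj fun x => (C x).cell i j

theorem ProjCells.proj {C : W → Circuit n m s} (hC : ProjCells C) (l) : Proj fun x => C x l := by
  have h := hC (finSumFinEquiv.symm (finProdFinEquiv.symm l).1)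
    (finSumFinEquiv.symm (finProdFinEquiv.symm l).2)
  simpa only [Circuit.cell, Equiv.apply_symm_apply, Prod.mk.eta] using h

theorem ProjCells.of_proj {C : W → Circuit n m s} (hC : ∀ l, Proj fun x => C x l) :
    ProjCells C :=
  fun _ _ => hC _

theorem ProjCells.comp {C : W → Circuit n k a} {D : W → Circuit k m b} (hC : ProjCells C)
    (hD : ProjCells D) : ProjCells fun x => (C x).comp (D x) := by
  intro i j
  simp only [Circuit.comp, Circuit.cell_ofCells]
  split <;> first | exact hC _ _ | exact hD _ _ | exact Proj.const _

theorem ProjCells.hardwire {C : W → Circuit (k + n) m s} {c : W → Bits k} (hC : ProjCells C)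
    (hc : ∀ l, Proj fun x => c x l) : ProjCells fun x => (C x).hardwire (c x) := by
  intro i j
  simp only [Circuit.hardwire, Circuit.cell_ofCells]
  split <;> first | exact hC _ _ | exact hc _ | exact Proj.const _

theorem ProjCells.pair {C : W → Circuit n k a} {D : W → Circuit n m b} (hC : ProjCells C)
    (hD : ProjCells D) : ProjCells fun x => (C x).pair (D x) := by
  intro i j
  simp only [Circuit.pair, Circuit.cell_ofCells]
  split <;> first | exact hC _ _ | exact hD _ _ | exact Proj.const _

theorem ProjCells.pad {C : W → Circuit n m s} (hC : ProjCells C) (t : ℕ) :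
    ProjCells fun x => (C x).pad t := by
  intro i j
  simp only [Circuit.pad, Circuit.cell_ofCells]
  split <;> first | exact hC _ _ | exact Proj.const _

theorem ProjCells.exists_gates {C : W → Circuit n m s} (hC : ProjCells C) {t : ℕ} (h : s ≤ t) :
    ∃ C' : W → Circuit n m t, (∀ x y, (C' x).eval y = (C x).eval y) ∧ ProjCells C' := by
  have e : Circuit.padded s t = t := by unfold Circuit.padded; omega
  exact e ▸ ⟨fun x => (C x).pad t, fun x => Circuit.eval_pad (C x) t, hC.pad t⟩

end Smn

/-- Circuits that apply a fixed function to hardwired data, the input, and the output of another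
circuit on that input. -/
theorem PolyC.exists_circuits {f : ∀ i, D i × (Bits (k i) × Bits (n i)) → Bits (m i)}
    (hf : PolyC B f) (hD : PolyT B D) (hk : PolyIn B k) (hn : PolyIn B n) {a : I → ℕ}
    (ha : PolyIn B a) :
    ∃ q : Polynomial ℕ, ∀ t : I → ℕ, PolyIn B t → (∀ i, q.eval (B i) ≤ t i) →
      ∃ alt : ∀ i, D i × Circuit (n i) (k i) (a i) → Circuit (n i) (m i) (t i),
        (∀ i d P x, (alt i (d, P)).eval x = f i (d, (P.eval x, x))) ∧ PolyC B alt := by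
  obtain ⟨p, hp⟩ := hf.circ
  obtain ⟨q, hq⟩ := ((ha.add (hn.add (.const 1))).add (hk.add hn)).add
    (((PolyIn.const 1).add hD).add (PolyIn.self.eval p))
  refine ⟨q, fun t ht hqt => ?_⟩
  have h : ∀ i, ∃ alt : D i × Circuit (n i) (k i) (a i) → Circuit (n i) (m i) (t i),
      (∀ d P x, (alt (d, P)).eval x = f i (d, (P.eval x, x))) ∧ ProjCells alt := by
    intro i
    obtain ⟨C, hC⟩ := hp i
    -- The circuit runs `P` beside the identity and feeds both into `C` with the data hardwired. Its
    -- table only copies bits of the data and of the table of `P`, so the map that produces the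
    -- circuit is a projection.
    have h2 : ProjCells fun y : D i × Circuit (n i) (k i) (a i) =>
        (y.2.pair (Circuit.rewire (m := n i) .inr)).comp (Circuit.hardwire C (enc y.1)) := by
      refine .comp (.pair (.of_proj fun l => ?_) fun _ _ => .const _)
        (.hardwire (fun _ _ => .const _) fun l => ?_)
      · exact .inr ⟨Fin.natAdd _ l, fun y => (Fin.append_right (enc y.1) (enc y.2) l).symm⟩
      · exact .inr ⟨Fin.castAdd _ l, fun y => (Fin.append_left (enc y.1) (enc y.2) l).symm⟩
    obtain ⟨alt, h3, h4⟩ := h2.exists_gates ((hq i).trans (hqt i))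
    refine ⟨alt, fun d P x => ?_, h4⟩
    rw [h3, Circuit.eval_comp, Circuit.eval_pair, Circuit.eval_hardwire]
    have e : (Circuit.rewire (m := n i) .inr).eval x = x :=
      funext fun o => Circuit.eval_rewire _ _ _
    rw [e]
    exact hC (d, (P.eval x, x))
  choose alt h1 h2 using h
  exact ⟨alt, h1, .of_proj (hD.prod (PolyIn.descLen hn hk ha)) (PolyIn.descLen hn hf.cod ht)
    fun i l => (h2 i).proj l⟩

end PolyC

/-! ### Semantics of quantum circuits -/

theorem sum_bits_add {M : Type*} [AddCommMonoid M] {m n : ℕ} (f : Bits (m + n) → M) :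
    ∑ x, f x = ∑ a : Bits m, ∑ b : Bits n, f (Fin.append a b) := by
  rw [← Fintype.sum_prod_type' (f := fun (a : Bits m) (b : Bits n) => f (Fin.append a b))]
  exact ((Fin.appendEquiv m n).sum_comp f).symm

theorem append_eq_iff {m n : ℕ} {a : Bits m} {b : Bits n} {x : Bits (m + n)} :
    Fin.append a b = x ↔ a = x.left ∧ b = x.right := by
  constructor
  · rintro rfl
    exact ⟨(Bits.append_left a b).symm, (Bits.append_right a b).symm⟩
  · rintro ⟨rfl, rfl⟩
    exact Bits.append_eta x

open scoped ComplexConjugate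

namespace QCirc

/-- Kraus decomposition. -/
theorem exists_kraus {m n : ℕ} (Q : QCirc m n) :
    ∃ (ι : Type) (_ : Fintype ι) (K : ι → Bits n → Bits m → ℂ),
      ∀ ρ a b, Q.sem ρ a b = ∑ i, ∑ x, ∑ y, K i a x * ρ x y * conj (K i b y) := by
  induction Q with
  | wire e =>
    exact ⟨Unit, inferInstance, fun _ a x => if x = a ∘ e.symm then 1 else 0, fun ρ a b => by
      simp [sem]⟩
  | comp P Q hP hQ =>
    obtain ⟨ι, _, K, hK⟩ := hP
    obtain ⟨κ, _, L, hL⟩ := hQ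
    refine ⟨κ × ι, inferInstance, fun j a x => ∑ z, L j.1 a z * K j.2 z x, fun ρ a b => ?_⟩
    simp only [sem, hK, hL, Fintype.sum_prod_type, map_sum, map_mul, Finset.mul_sum,
      Finset.sum_mul]
    refine Finset.sum_congr rfl fun i _ => ?_
    simp only [Finset.sum_sigma']
    -- Kraus operators of a composite are products; the two sides differ by the order of the five
    -- remaining summations.
    refine Finset.sum_bij' (fun p _ => ⟨p.2.2.1, p.2.2.2.1, p.2.2.2.2, p.2.1, p.1⟩)
      (fun p _ => ⟨p.2.2.2.2, p.2.2.2.1, p.1, p.2.1, p.2.2.1⟩) ?_ ?_ ?_ ?_ ?_ <;> simp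
    intros; ring
  | @extend m n P k hP =>
    obtain ⟨ι, _, K, hK⟩ := hP
    -- The Kraus operators of `P` tensored with the identity.
    refine ⟨ι, inferInstance, fun i a x => if x.right = a.right then K i a.left x.left else 0,
      fun ρ a b => ?_⟩
    refine (hK _ _ _).trans ?_
    simp only [sum_bits_add, Bits.append_left, Bits.append_right,
      apply_ite (starRingEnd ℂ), map_zero]
    simp
  | fresh =>
    refine ⟨Unit, inferInstance, fun _ a _ => if a 0 = false then 1 else 0, fun ρ a b => ?_⟩
    cases h : a 0 <;> cases h' : b 0 <;> simp [sem, h, h']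
    exact congrArg₂ ρ (Subsingleton.elim _ _) (Subsingleton.elim _ _)
  | discard =>
    exact ⟨Bits 1, inferInstance, fun z _ x => if x = z then 1 else 0, fun ρ a b => by
      simp [sem]⟩
  | hadamard =>
    refine ⟨Unit, inferInstance, fun _ a x =>
      (if a 0 && x 0 then -1 else 1) * ((Real.sqrt 2 : ℝ) : ℂ)⁻¹, fun ρ a b => ?_⟩
    have h2 : ((Real.sqrt 2 : ℝ) : ℂ)⁻¹ * ((Real.sqrt 2 : ℝ) : ℂ)⁻¹ = 2⁻¹ := by
      rw [← mul_inv, ← Complex.ofReal_mul, Real.mul_self_sqrt (by norm_num)]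
      simp
    simp only [sem, Finset.univ_unique, Finset.sum_singleton]
    refine Finset.sum_congr rfl fun x _ => Finset.sum_congr rfl fun y _ => ?_
    have h3 : conj ((if (b 0 && y 0) = true then (-1 : ℂ) else 1) * ((Real.sqrt 2 : ℝ) : ℂ)⁻¹) =
        (if (b 0 && y 0) = true then (-1 : ℂ) else 1) * ((Real.sqrt 2 : ℝ) : ℂ)⁻¹ := by
      rw [map_mul, map_inv₀, Complex.conj_ofReal]
      congr 1
      split_ifs <;> simp
    rw [h3, div_eq_mul_inv, ← h2]
    ring
  | tGate =>
    refine ⟨Unit, inferInstance, fun _ a x => if x = a then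
      (if a 0 then Complex.exp (Real.pi / 4 * Complex.I) else 1) else 0, fun ρ a b => ?_⟩
    have h : conj (if b 0 = true then Complex.exp (Real.pi / 4 * Complex.I) else 1) =
        if b 0 = true then Complex.exp (-(Real.pi / 4 * Complex.I)) else 1 := by
      split_ifs
      · simp [← Complex.exp_conj, map_ofNat]
      · simp
    simp only [sem, ← h]
    simp only [apply_ite (starRingEnd ℂ), map_zero]
    simp
  | cnot =>
    exact ⟨Unit, inferInstance, fun _ a x => if x = ![a 0, xor (a 0) (a 1)] then 1 else 0,
      fun ρ a b => by simp [sem]⟩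
  | @classical m n s C =>
    refine ⟨Bits m, inferInstance, fun z a x => if a = C.eval z ∧ x = z then 1 else 0,
      fun ρ a b => ?_⟩
    simp only [sem, Matrix.sum_apply, Matrix.smul_apply, ket]
    refine Finset.sum_congr rfl fun z _ => ?_
    by_cases ha : a = C.eval z <;> by_cases hb : b = C.eval z <;> simp [ha, hb]
  | branch P Q hP hQ =>
    obtain ⟨ι, _, K, hK⟩ := hP
    obtain ⟨κ, _, L, hL⟩ := hQ
    refine ⟨ι ⊕ κ, inferInstance, Sum.elim
      (fun i a x => if x.left = ![false] then K i a x.right else 0)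
      (fun i a x => if x.left = ![true] then L i a x.right else 0), fun ρ a b => ?_⟩
    refine (congrArg₂ (· + ·) (hK _ a b) (hL _ a b)).trans ?_
    simp only [Fintype.sum_sum_type, Sum.elim_inl, Sum.elim_inr]
    congr 1 <;> simp only [sum_bits_add, Bits.append_left, Bits.append_right] <;>
      refine Finset.sum_congr rfl fun i _ => ?_
    · rw [Fintype.sum_eq_single ![false] (by intro x hx; simp [hx])]
      refine Finset.sum_congr rfl fun x _ => ?_
      rw [Fintype.sum_eq_single ![false] (by intro x hx; simp [hx])]
      simp
    · rw [Fintype.sum_eq_single ![true] (by intro x hx; simp [hx])]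
      refine Finset.sum_congr rfl fun x _ => ?_
      rw [Fintype.sum_eq_single ![true] (by intro x hx; simp [hx])]
      simp

/-- The channel as a linear map. -/
def semL {m n : ℕ} (Q : QCirc m n) : Op m →ₗ[ℂ] Op n where
  toFun := Q.sem
  map_add' ρ σ := by
    obtain ⟨ι, _, K, hK⟩ := Q.exists_kraus
    ext a b
    simp only [hK, Matrix.add_apply, mul_add, add_mul, Finset.sum_add_distrib]
  map_smul' c ρ := by
    obtain ⟨ι, _, K, hK⟩ := Q.exists_kraus
    ext a b
    simp only [hK, Matrix.smul_apply, smul_eq_mul, RingHom.id_apply, Finset.mul_sum]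
    refine Finset.sum_congr rfl fun i _ => Finset.sum_congr rfl fun x _ =>
      Finset.sum_congr rfl fun y _ => ?_
    ring

variable {m n k : ℕ} (Q : QCirc m n)

theorem sem_add (ρ σ : Op m) : Q.sem (ρ + σ) = Q.sem ρ + Q.sem σ := Q.semL.map_add ρ σ

theorem sem_smul (c : ℂ) (ρ : Op m) : Q.sem (c • ρ) = c • Q.sem ρ := Q.semL.map_smul c ρ

theorem sem_zero : Q.sem 0 = 0 := Q.semL.map_zero

theorem sem_sum {ι : Type*} (s : Finset ι) (ρ : ι → Op m) :
    Q.sem (∑ i ∈ s, ρ i) = ∑ i ∈ s, Q.sem (ρ i) := map_sum Q.semL ρ s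

/-- In the Kraus form each summand is a congruence of `ρ`, which preserves positivity. -/
theorem sem_posSemidef {ρ : Op m} (h : ρ.PosSemidef) : (Q.sem ρ).PosSemidef := by
  obtain ⟨ι, _, K, hK⟩ := Q.exists_kraus
  have e : Q.sem ρ = ∑ i, Matrix.of (K i) * ρ * (Matrix.of (K i)).conjTranspose := by
    ext a b
    rw [hK, Matrix.sum_apply]
    refine Finset.sum_congr rfl fun i _ => ?_
    rw [Finset.sum_comm]
    simp only [Matrix.mul_apply, Matrix.of_apply, Matrix.conjTranspose_apply, Finset.sum_mul]
    rfl
  rw [e]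
  exact Matrix.posSemidef_sum _ fun i _ => h.mul_mul_conjTranspose_same _

theorem sum_bits_one {M : Type*} [AddCommMonoid M] (f : Bits 1 → M) :
    ∑ x, f x = f ![false] + f ![true] := by
  rw [← (Equiv.funUnique (Fin 1) Bool).symm.sum_comp f, Fintype.sum_bool, add_comm]
  congr 2 <;> funext i <;> fin_cases i <;> rfl

theorem sum_bits_two {M : Type*} [AddCommMonoid M] (f : Bits 2 → M) :
    ∑ x, f x = f ![false, false] + f ![false, true] + (f ![true, false] + f ![true, true]) := by
  have e : ∀ a b, (finTwoArrowEquiv Bool).symm (a, b) = ![a, b] := fun _ _ => rfl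
  rw [← (finTwoArrowEquiv Bool).symm.sum_comp f, Fintype.sum_prod_type]
  simp only [Fintype.sum_bool, e]
  abel

/-- The Kraus decomposition above records no completeness relation, so trace preservation is checked
gate by gate. -/
theorem trace_sem (ρ : Op m) : (Q.sem ρ).trace = ρ.trace := by
  induction Q with
  | wire e =>
    exact Fintype.sum_equiv (Equiv.arrowCongr e (Equiv.refl _)) _ _ fun a => rfl
  | comp P Q hP hQ => rw [sem, hQ, hP]
  | @extend m n P k hP =>
    refine (sum_bits_add _).trans (Eq.trans ?_ (sum_bits_add _).symm)
    rw [Finset.sum_comm, Finset.sum_comm (s := (Finset.univ : Finset (Bits m)))]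
    refine Finset.sum_congr rfl fun c _ => Eq.trans ?_
      (hP fun x y => ρ (Fin.append x c) (Fin.append y c))
    refine Finset.sum_congr rfl fun a _ => ?_
    simp only [Matrix.diag, sem, Bits.append_left, Bits.append_right]
  | fresh =>
    refine (sum_bits_one _).trans ?_
    refine Eq.trans ?_ (Fintype.sum_unique _).symm
    simp only [sem, Matrix.diag]
    simp
    exact congrArg₂ ρ (Subsingleton.elim _ _) (Subsingleton.elim _ _)
  | discard => exact Fintype.sum_unique _
  | hadamard =>
    refine (sum_bits_one _).trans (Eq.trans ?_ (sum_bits_one _).symm)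
    simp only [sem, sum_bits_one, Matrix.diag]
    simp
    ring
  | tGate =>
    refine Finset.sum_congr rfl fun a _ => ?_
    simp only [Matrix.diag, sem]
    cases a 0
    · simp
    · simp only [if_true]
      rw [mul_right_comm, ← Complex.exp_add]
      simp
  | cnot =>
    refine (sum_bits_two _).trans (Eq.trans ?_ (sum_bits_two _).symm)
    simp only [sem, Matrix.diag]
    simp
    ring
  | @classical m n s C =>
    simp only [sem, Matrix.trace_sum, Matrix.trace_smul]
    refine Finset.sum_congr rfl fun x _ => ?_
    simp [Matrix.trace, ket]
  | branch P Q hP hQ =>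
    refine (Matrix.trace_add _ _).trans ((congrArg₂ (· + ·) (hP _) (hQ _)).trans ?_)
    refine Eq.trans ?_ ((sum_bits_add _).trans (sum_bits_one _)).symm
    rfl

end QCirc

/-! ### States -/

section States

variable {m n k : ℕ}

theorem tensor_apply (ρ : Op m) (σ : Op n) (a b : Bits (m + n)) :
    tensor ρ σ a b = ρ a.left b.left * σ a.right b.right := rfl

theorem tensor_append (ρ : Op m) (σ : Op n) (a b : Bits m) (c d : Bits n) :
    tensor ρ σ (Fin.append a c) (Fin.append b d) = ρ a b * σ c d := by
  simp only [tensor_apply, Bits.append_left, Bits.append_right]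

theorem tensor_add_left (ρ ρ' : Op m) (σ : Op n) :
    tensor (ρ + ρ') σ = tensor ρ σ + tensor ρ' σ := by
  ext a b; simp only [tensor_apply, Matrix.add_apply, add_mul]

theorem tensor_smul_left (c : ℂ) (ρ : Op m) (σ : Op n) : tensor (c • ρ) σ = c • tensor ρ σ := by
  ext a b; simp only [tensor_apply, Matrix.smul_apply, smul_eq_mul, mul_assoc]

theorem tensor_smul_right (c : ℂ) (ρ : Op m) (σ : Op n) : tensor ρ (c • σ) = c • tensor ρ σ := by
  ext a b; simp only [tensor_apply, Matrix.smul_apply, smul_eq_mul, mul_left_comm]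

theorem tensor_zero_left (σ : Op n) : tensor (0 : Op m) σ = 0 := by
  ext a b; simp only [tensor_apply, Matrix.zero_apply, zero_mul]

theorem tensor_sum_left {ι : Type*} (s : Finset ι) (ρ : ι → Op m) (σ : Op n) :
    tensor (∑ i ∈ s, ρ i) σ = ∑ i ∈ s, tensor (ρ i) σ := by
  ext a b; simp only [tensor_apply, Matrix.sum_apply, Finset.sum_mul]

theorem tensor_sum_right {ι : Type*} (s : Finset ι) (ρ : Op m) (σ : ι → Op n) :
    tensor ρ (∑ i ∈ s, σ i) = ∑ i ∈ s, tensor ρ (σ i) := by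
  ext a b; simp only [tensor_apply, Matrix.sum_apply, Finset.mul_sum]

theorem ket_apply (x a b : Bits n) : ket x a b = if a = x ∧ b = x then 1 else 0 := rfl

theorem ket_append (x : Bits m) (y : Bits n) :
    ket (Fin.append x y : Bits (m + n)) = tensor (ket x) (ket y) := by
  ext a b
  simp only [tensor_apply, ket_apply, eq_comm (b := (Fin.append x y : Bits (m + n))),
    append_eq_iff, eq_comm (a := x), eq_comm (a := y)]
  by_cases h1 : a.left = x <;> by_cases h2 : a.right = y <;> by_cases h3 : b.left = x <;>
    by_cases h4 : b.right = y <;> simp [h1, h2, h3, h4]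

theorem posSemidef_ket (x : Bits n) : (ket x).PosSemidef := by
  have h := Matrix.posSemidef_vecMulVec_self_star (fun a : Bits n => if a = x then (1 : ℂ) else 0)
  convert h using 1
  ext a b
  by_cases ha : a = x <;> by_cases hb : b = x <;> simp [ket_apply, Matrix.vecMulVec_apply, ha, hb]

theorem trace_ket (x : Bits n) : (ket x).trace = 1 := by
  simp [Matrix.trace, ket]

theorem isState_ket (x : Bits n) : IsState (ket x) := ⟨posSemidef_ket x, trace_ket x⟩

theorem posSemidef_tensor {ρ : Op m} {σ : Op n} (hρ : ρ.PosSemidef) (hσ : σ.PosSemidef) :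
    (tensor ρ σ).PosSemidef :=
  (hρ.kronecker hσ).submatrix fun a : Bits (m + n) => (a.left, a.right)

theorem trace_tensor (ρ : Op m) (σ : Op n) : (tensor ρ σ).trace = ρ.trace * σ.trace := by
  refine (sum_bits_add _).trans ?_
  simp only [Matrix.diag, tensor_append, Matrix.trace, Finset.sum_mul_sum]

theorem IsState.tensor {ρ : Op m} {σ : Op n} (hρ : IsState ρ) (hσ : IsState σ) :
    IsState (tensor ρ σ) :=
  ⟨posSemidef_tensor hρ.1 hσ.1, by rw [trace_tensor, hρ.2, hσ.2, one_mul]⟩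

theorem IsState.sem {ρ : Op m} (hρ : IsState ρ) (Q : QCirc m n) : IsState (Q.sem ρ) :=
  ⟨Q.sem_posSemidef hρ.1, by rw [Q.trace_sem, hρ.2]⟩

theorem posSemidef_outcome {ρ : Op (m + k)} (h : ρ.PosSemidef) (y : Bits k) :
    (outcome ρ y).PosSemidef :=
  h.submatrix fun a => (Fin.append a y : Bits (m + k))

theorem outcome_apply (ρ : Op (m + k)) (y : Bits k) (a b : Bits m) :
    outcome ρ y a b = ρ (Fin.append a y) (Fin.append b y) := rfl

theorem sum_trace_outcome (ρ : Op (m + k)) : ∑ y, (outcome ρ y).trace = ρ.trace := by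
  refine Eq.trans ?_ (sum_bits_add _).symm
  exact Finset.sum_comm

theorem outcome_add (ρ σ : Op (m + k)) (y : Bits k) :
    outcome (ρ + σ) y = outcome ρ y + outcome σ y := rfl

theorem outcome_smul (c : ℂ) (ρ : Op (m + k)) (y : Bits k) :
    outcome (c • ρ) y = c • outcome ρ y := rfl

theorem outcome_sum {ι : Type*} (s : Finset ι) (ρ : ι → Op (m + k)) (y : Bits k) :
    outcome (∑ i ∈ s, ρ i) y = ∑ i ∈ s, outcome (ρ i) y := by
  ext a b; simp only [outcome_apply, Matrix.sum_apply]

theorem outcome_tensor_ket (ρ : Op m) (x y : Bits k) :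
    outcome (tensor ρ (ket x)) y = if y = x then ρ else 0 := by
  ext a b
  rw [outcome_apply, tensor_append, ket_apply]
  split_ifs <;> simp_all

theorem accept_add (ρ σ : Op 1) : accept (ρ + σ) = accept ρ + accept σ := rfl

theorem accept_smul (c : ℝ) (ρ : Op 1) : accept ((c : ℂ) • ρ) = c * accept ρ := by
  simp [accept]

theorem accept_nonneg {ρ : Op 1} (h : ρ.PosSemidef) : 0 ≤ accept ρ :=
  (Complex.le_def.1 (h.diag_nonneg (i := fun _ => true))).1

theorem accept_le {ρ : Op 1} (h : ρ.PosSemidef) : accept ρ ≤ ρ.trace.re := by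
  have e : ρ.trace = _ := QCirc.sum_bits_one fun x => ρ x x
  have h0 := (Complex.le_def.1 (h.diag_nonneg (i := ![false]))).1
  have e1 : (fun _ => true : Bits 1) = ![true] := by funext i; fin_cases i; rfl
  rw [e, Complex.add_re, accept, e1]
  simpa using h0

end States

/-! ### Circuit gadgets -/

namespace QCirc

variable {m n k w c s : ℕ}

theorem sem_extend_tensor (P : QCirc m n) (ρ : Op m) (σ : Op k) :
    (P.extend k).sem (tensor ρ σ) = tensor (P.sem ρ) σ := by
  ext a b
  have h : (fun x y => tensor ρ σ (Fin.append x a.right) (Fin.append y b.right)) =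
      (σ a.right b.right • ρ : Op m) := by
    ext x y
    rw [tensor_append, Matrix.smul_apply, smul_eq_mul, mul_comm]
  refine (congrFun₂ ((congrArg P.sem h).trans (P.sem_smul _ ρ)) a.left b.left).trans ?_
  rw [Matrix.smul_apply, smul_eq_mul, mul_comm, tensor_apply]

theorem sem_classical_ket (C : Circuit m n s) (x : Bits m) :
    (classical C).sem (ket x) = ket (C.eval x) := by
  simp only [sem, ket_apply, and_self]
  simp

theorem sem_comp (P : QCirc m k) (Q : QCirc k n) (ρ : Op m) :
    (P.comp Q).sem ρ = Q.sem (P.sem ρ) := rfl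

/-- Exchange of two registers. -/
def swap (m n : ℕ) : QCirc (m + n) (n + m) := wire finAddFlip

theorem sem_swap (ρ : Op (m + n)) (a b : Bits (n + m)) :
    (swap m n).sem ρ a b = ρ (Fin.append a.right a.left) (Fin.append b.right b.left) := by
  have h : ∀ a : Bits (n + m), a ∘ (finAddFlip (m := n) (n := m)).symm =
      (Fin.append a.right a.left : Bits (m + n)) := by
    intro a
    funext i
    refine Fin.addCases (fun j => ?_) (fun j => ?_) i <;>
      simp [Bits.left, Bits.right, finAddFlip]
  simp only [swap, sem, h]

theorem sem_swap_tensor (ρ : Op m) (σ : Op n) : (swap m n).sem (tensor ρ σ) = tensor σ ρ := by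
  ext a b
  rw [sem_swap, tensor_append, tensor_apply, mul_comm]

/-- Regrouping of registers. -/
def assoc (m n k : ℕ) : QCirc (m + n + k) (m + (n + k)) := wire (finCongr (add_assoc m n k).symm)

/-- Regrouping of registers. -/
def assoc' (m n k : ℕ) : QCirc (m + (n + k)) (m + n + k) := wire (finCongr (add_assoc m n k))

theorem append_assoc_bits (a : Bits m) (b : Bits n) (d : Bits k) :
    (Fin.append (Fin.append a b) d : Bits (m + n + k)) =
      (Fin.append a (Fin.append b d) : Bits (m + (n + k))) ∘ finCongr (add_assoc m n k) := by
  rw [Fin.append_assoc]; rfl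

theorem sem_assoc (ρ : Op (m + n + k)) (a b : Bits m) (x x' : Bits n) (y y' : Bits k) :
    (assoc m n k).sem ρ (Fin.append a (Fin.append x y)) (Fin.append b (Fin.append x' y')) =
      ρ (Fin.append (Fin.append a x) y) (Fin.append (Fin.append b x') y') := by
  rw [append_assoc_bits, append_assoc_bits]; rfl

theorem sem_assoc' (ρ : Op (m + (n + k))) (a b : Bits m) (x x' : Bits n) (y y' : Bits k) :
    (assoc' m n k).sem ρ (Fin.append (Fin.append a x) y) (Fin.append (Fin.append b x') y') =
      ρ (Fin.append a (Fin.append x y)) (Fin.append b (Fin.append x' y')) := by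
  rw [append_assoc_bits, append_assoc_bits]; rfl

theorem sem_assoc_tensor (ρ : Op m) (σ : Op n) (τ : Op k) :
    (assoc m n k).sem (tensor (tensor ρ σ) τ) = tensor ρ (tensor σ τ) := by
  ext a b
  rw [← a.append_eta, ← b.append_eta, ← a.right.append_eta, ← b.right.append_eta, sem_assoc]
  simp only [tensor_append, mul_assoc]

theorem sem_assoc'_tensor (ρ : Op m) (σ : Op n) (τ : Op k) :
    (assoc' m n k).sem (tensor ρ (tensor σ τ)) = tensor (tensor ρ σ) τ := by
  ext a b
  rw [← a.append_eta, ← b.append_eta, ← a.left.append_eta, ← b.left.append_eta, sem_assoc']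
  simp only [tensor_append, mul_assoc]

/-- Measure the last register and run a classical circuit on the result. -/
def onLast (w : ℕ) (C : Circuit k m s) : QCirc (w + k) (w + m) :=
  (swap w k).comp (((classical C).extend w).comp (swap m w))

theorem size_onLast (C : Circuit k m s) : (onLast w C).size = Circuit.cost k m s := by
  simp [onLast, size, swap]

theorem sem_onLast (C : Circuit k m s) (ρ : Op (w + k)) :
    (onLast w C).sem ρ = ∑ y, tensor (outcome ρ y) (ket (C.eval y)) := by
  ext a b
  simp only [onLast, sem_comp, sem_swap, Matrix.sum_apply, tensor_apply, outcome_apply]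
  simp only [sem, sem_swap, Bits.append_left, Bits.append_right, Matrix.sum_apply,
    Matrix.smul_apply, smul_eq_mul]

theorem sem_onLast_tensor_ket (C : Circuit k m s) (ρ : Op w) (x : Bits k) :
    (onLast w C).sem (tensor ρ (ket x)) = tensor ρ (ket (C.eval x)) := by
  rw [sem_onLast, Fintype.sum_eq_single x]
  · rw [outcome_tensor_ket, if_pos rfl]
  · intro y hy
    rw [outcome_tensor_ket, if_neg hy, tensor_zero_left]

/-- Measure a register, and run a classical circuit on the result and a classical register. -/
def measure (w k c : ℕ) (C : Circuit (k + c) m s) : QCirc (w + k + c) (w + m) :=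
  (assoc w k c).comp (onLast w C)

theorem size_measure (C : Circuit (k + c) m s) :
    (measure w k c C).size = Circuit.cost (k + c) m s := by
  simp [measure, size, size_onLast, assoc]

theorem sem_measure (C : Circuit (k + c) m s) (ρ : Op (w + k)) (x : Bits c) :
    (measure w k c C).sem (tensor ρ (ket x)) =
      ∑ y, tensor (outcome ρ y) (ket (C.eval (Fin.append y x))) := by
  rw [measure, sem, sem_onLast, sum_bits_add]
  refine Finset.sum_congr rfl fun y _ => ?_
  have h : ∀ z, outcome ((assoc w k c).sem (tensor ρ (ket x))) (Fin.append y z) =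
      if z = x then outcome ρ y else 0 := by
    intro z
    rw [← outcome_tensor_ket]
    ext a b
    rw [outcome_apply, sem_assoc, outcome_apply, tensor_append, tensor_append, outcome_apply]
  simp only [h]
  rw [Fintype.sum_eq_single x]
  · rw [if_pos rfl]
  · intro z hz
    rw [if_neg hz, tensor_zero_left]

/-- Run one of two circuits, depending on a classical bit. -/
def cond (P₀ P₁ : QCirc (w + k) n) : QCirc (w + (1 + k)) n :=
  (swap w (1 + k)).comp ((assoc 1 k w).comp
    (branch ((swap k w).comp P₀) ((swap k w).comp P₁)))

theorem size_cond (P₀ P₁ : QCirc (w + k) n) : (cond P₀ P₁).size = P₀.size + P₁.size + 1 := by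
  simp [cond, size, swap, assoc]

/-- The control register is in a basis state, so one of the two branches receives the zero operator.
-/
theorem sem_cond (P₀ P₁ : QCirc (w + k) n) (ρ : Op w) (b : Bool) (v : Bits k) :
    (cond P₀ P₁).sem (tensor ρ (ket (Fin.append (fun _ => b) v : Bits (1 + k)))) =
      if b then P₁.sem (tensor ρ (ket v)) else P₀.sem (tensor ρ (ket v)) := by
  have h : ∀ b' : Bool, (fun x y => tensor (ket fun _ : Fin 1 => b) (tensor (ket v) ρ)
      (Fin.append ![b'] x) (Fin.append ![b'] y)) =
      (if b' = b then tensor (ket v) ρ else 0 : Op (k + w)) := by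
    intro b'
    ext x y
    have e : (![b'] : Bits 1) = (fun _ => b) ↔ b' = b := by simp [funext_iff]
    refine (tensor_append _ _ _ _ _ _).trans ?_
    by_cases hb : b' = b
    · rw [if_pos hb, ket_apply, if_pos ⟨e.2 hb, e.2 hb⟩, one_mul]
    · rw [if_neg hb, ket_apply, if_neg fun h => hb (e.1 h.1), zero_mul]; rfl
  simp only [cond, sem_comp, sem_swap_tensor, ket_append, sem_assoc_tensor]
  refine (congrArg₂ (· + ·) (congrArg _ (h false)) (congrArg _ (h true))).trans ?_
  cases b <;> simp [sem_swap_tensor, sem_zero, sem_comp]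

end QCirc

/-! ### Expectations -/

section Expectations

variable {m n t : ℕ}

/-- Expectation as a linear functional. -/
def expectL (n : ℕ) : (Bits n → ℝ) →ₗ[ℝ] ℝ where
  toFun := expect
  map_add' f g := by simp [expect, Finset.sum_add_distrib, add_div]
  map_smul' c f := by
    simp only [expect, Pi.smul_apply, smul_eq_mul, ← Finset.mul_sum, mul_div_assoc, RingHom.id_apply]

theorem expectL_apply (f : Bits n → ℝ) : expectL n f = expect f := rfl

theorem expect_const (c : ℝ) : (expect fun _ : Bits n => c) = c := by
  simp [expect]

theorem expect_sub (f g : Bits n → ℝ) : (expect fun x => f x - g x) = expect f - expect g :=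
  (expectL n).map_sub f g

theorem expect_mono {f g : Bits n → ℝ} (h : ∀ x, f x ≤ g x) : expect f ≤ expect g := by
  unfold expect
  gcongr
  exact h _

theorem abs_expect_le {f : Bits n → ℝ} {c : ℝ} (h : ∀ x, |f x| ≤ c) : |expect f| ≤ c := by
  rw [abs_le]
  exact ⟨(expect_const (n := n) (-c)).symm.le.trans (expect_mono fun x => (abs_le.1 (h x)).1),
    (expect_mono fun x => (abs_le.1 (h x)).2).trans (expect_const c).le⟩

theorem abs_expect_sub_le {f g : Bits n → ℝ} {c : ℝ} (h : ∀ x, |f x - g x| ≤ c) :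
    |expect f - expect g| ≤ c := by
  rw [← expect_sub]
  exact abs_expect_le h

/-- An expectation is a finite linear combination, hence commutes with every linear functional.
Averages over coins and tags are exchanged through this. -/
theorem map_expect {X : Type*} (Φ : (X → ℝ) →ₗ[ℝ] ℝ) (f : X → Bits n → ℝ) :
    Φ (fun x => expect (f x)) = expect fun e => Φ fun x => f x e := by
  have h : (fun x => expect (f x)) = ((2 : ℝ) ^ n)⁻¹ • ∑ e, fun x => f x e := by
    funext x
    simp [expect, div_eq_inv_mul]
  rw [h, map_smul, map_sum, expect, smul_eq_mul, div_eq_inv_mul]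

theorem expect_comm (f : Bits m → Bits n → ℝ) :
    (expect fun x => expect fun y => f x y) = expect fun y => expect fun x => f x y :=
  map_expect (expectL m) f

theorem expect_append (f : Bits (m + n) → ℝ) :
    expect f = expect fun x : Bits m => expect fun y : Bits n => f (Fin.append x y) := by
  simp only [expect, sum_bits_add, ← Finset.sum_div, div_div, pow_add, mul_comm]

theorem expect_equiv (e : Bits m ≃ Bits n) (h : m = n) (f : Bits n → ℝ) :
    expect f = expect fun x => f (e x) := by
  subst h
  simp only [expect, e.sum_comp]

/-- Average over lists of `k` strings. -/
def avgL (t : ℕ) : ℕ → (List (Bits t) → ℝ) →ₗ[ℝ] ℝ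
  | 0 => LinearMap.proj []
  | k + 1 => (expectL t).comp (LinearMap.pi fun τ =>
      (avgL t k).comp (LinearMap.funLeft ℝ ℝ fun l => τ :: l))

theorem avgL_zero (f : List (Bits t) → ℝ) : avgL t 0 f = f [] := rfl

theorem avgL_succ (k : ℕ) (f : List (Bits t) → ℝ) :
    avgL t (k + 1) f = expect fun τ => avgL t k fun l => f (τ :: l) := rfl

theorem avgL_mono (k : ℕ) {f g : List (Bits t) → ℝ} (h : ∀ l, l.length = k → f l ≤ g l) :
    avgL t k f ≤ avgL t k g := by
  induction k generalizing f g with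
  | zero => exact h [] rfl
  | succ k ih => exact expect_mono fun τ => ih fun l hl => h _ (by simp [hl])

theorem avgL_const (k : ℕ) (c : ℝ) : avgL t k (fun _ => c) = c := by
  induction k with
  | zero => rfl
  | succ k ih => rw [avgL_succ]; simp only [ih, expect_const]

theorem avgL_add (j k : ℕ) (f : List (Bits t) → ℝ) :
    avgL t (j + k) f = avgL t j fun l => avgL t k fun l' => f (l ++ l') := by
  induction j generalizing f with
  | zero => rw [Nat.zero_add]; rfl
  | succ j ih =>
    rw [Nat.add_right_comm, avgL_succ, avgL_succ]
    simp only [ih, List.cons_append]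

open Classical in
-- The birthday bound. `U` holds the strings drawn before: the next one falls into `U` with
-- probability at most `U.length / 2 ^ t`, and otherwise the induction continues with `U` enlarged
-- by it.
theorem avgL_not_nodup_le (k : ℕ) (U : List (Bits t)) (hU : U.Nodup) :
    avgL t k (fun l => if (U ++ l).Nodup then 0 else 1) ≤ k * (U.length + k) / 2 ^ t := by
  induction k generalizing U with
  | zero => simp [avgL_zero, hU]
  | succ k ih =>
    rw [avgL_succ]
    have h : ∀ τ, avgL t k (fun l => if (U ++ τ :: l).Nodup then 0 else 1) ≤
        (if τ ∈ U then 1 else 0) + (k * (U.length + 1 + k) / 2 ^ t : ℝ) := by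
      intro τ
      by_cases hτ : τ ∈ U
      · rw [if_pos hτ]
        refine (avgL_mono k (g := fun _ => 1) fun l _ => ?_).trans ?_
        · split_ifs <;> norm_num
        · rw [avgL_const]
          linarith [show (0 : ℝ) ≤ k * (U.length + 1 + k) / 2 ^ t by positivity]
      · rw [if_neg hτ, zero_add]
        have := ih (U ++ [τ]) (by
          rw [List.nodup_append]
          exact ⟨hU, by simp, by rintro a ha b hb rfl; simp_all⟩)
        simpa [List.append_assoc] using this
    refine (expect_mono h).trans ?_
    have e : (expect fun τ : Bits t => (if τ ∈ U then (1 : ℝ) else 0) +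
        (k * (U.length + 1 + k) / 2 ^ t : ℝ)) =
        (expect fun τ : Bits t => if τ ∈ U then (1 : ℝ) else 0) + k * (U.length + 1 + k) / 2 ^ t := by
      refine ((expectL t).map_add (fun τ => if τ ∈ U then 1 else 0) _).trans ?_
      rw [expectL_apply, expectL_apply, expect_const]
    have e2 : (expect fun τ : Bits t => if τ ∈ U then (1 : ℝ) else 0) = U.length / 2 ^ t := by
      rw [expect, ← Finset.sum_filter, Finset.sum_const, ← List.toFinset_card_of_nodup hU]
      congr 1
      simp only [nsmul_eq_mul, mul_one, Nat.cast_inj]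
      congr 1
      ext; simp
    rw [e, e2, ← add_div]
    refine div_le_div_of_nonneg_right ?_ (by positivity)
    push_cast
    nlinarith [Nat.cast_nonneg (α := ℝ) k, Nat.cast_nonneg (α := ℝ) U.length]

end Expectations

/-! ### Linear functionals of states -/

/-- Real linear functionals of the state. -/
structure IsLin {w : ℕ} (V : Op w → ℝ) : Prop where
  add : ∀ ρ σ, V (ρ + σ) = V ρ + V σ
  smul : ∀ (c : ℝ) ρ, V ((c : ℂ) • ρ) = c * V ρ

namespace IsLin

variable {w v : ℕ} {V : Op w → ℝ}

theorem map_zero (h : IsLin V) : V 0 = 0 := by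
  have := h.smul 0 0
  simpa using this

theorem map_sum (h : IsLin V) {ι : Type*} (s : Finset ι) (ρ : ι → Op w) :
    V (∑ i ∈ s, ρ i) = ∑ i ∈ s, V (ρ i) := by
  classical
  induction s using Finset.induction_on with
  | empty => simp [h.map_zero]
  | insert a s ha ih => rw [Finset.sum_insert ha, h.add, ih, Finset.sum_insert ha]

theorem zero : IsLin fun _ : Op w => 0 := ⟨fun _ _ => by simp, fun _ _ => by simp⟩

theorem sum {ι : Type*} {s : Finset ι} {V : ι → Op w → ℝ} (h : ∀ i, IsLin (V i)) :
    IsLin fun ρ => ∑ i ∈ s, V i ρ :=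
  ⟨fun ρ σ => by simp only [(h _).add, Finset.sum_add_distrib],
    fun c ρ => by simp only [(h _).smul, Finset.mul_sum]⟩

theorem expect {n : ℕ} {V : Bits n → Op w → ℝ} (h : ∀ i, IsLin (V i)) :
    IsLin fun ρ => expect fun e => V e ρ :=
  ⟨fun ρ σ => by simp only [KeyBundling.expect, (h _).add, Finset.sum_add_distrib, add_div],
    fun c ρ => by simp only [KeyBundling.expect, (h _).smul, ← Finset.mul_sum, mul_div_assoc]⟩

theorem ite {p : Prop} [Decidable p] {V' : Op w → ℝ} (h : IsLin V) (h' : IsLin V') :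
    IsLin fun ρ => if p then V ρ else V' ρ := by
  split_ifs <;> assumption

theorem sem (h : IsLin V) (Q : QCirc v w) : IsLin fun ρ => V (Q.sem ρ) :=
  ⟨fun ρ σ => by rw [Q.sem_add, h.add], fun c ρ => by rw [Q.sem_smul, h.smul]⟩

theorem tensor {k : ℕ} {V : Op (w + k) → ℝ} (h : IsLin V) (σ : Op k) :
    IsLin fun ρ => V (tensor ρ σ) :=
  ⟨fun ρ σ => by rw [tensor_add_left, h.add], fun c ρ => by rw [tensor_smul_left, h.smul]⟩

theorem outcome {k : ℕ} (h : IsLin V) (y : Bits k) :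
    IsLin fun ρ : Op (w + k) => V (outcome ρ y) :=
  ⟨fun ρ σ => by rw [outcome_add, h.add], fun c ρ => by rw [outcome_smul, h.smul]⟩

theorem accept : IsLin accept := ⟨accept_add, accept_smul⟩

end IsLin

/-! ### Rounds of key queries with given tags -/

section Tagged

variable {w fn sk tg inp out pk ct : ℕ}

/-- The memory after a round with message `y`. -/
def answer (key : Bits tg → Bits fn → Op sk) (R : Round w fn (sk + tg) × Bits tg) (ρ : Op w)
    (y : Bits (1 + fn)) : Op w :=
  if y.left 0 = false then outcome (R.1.ask.sem ρ) y
  else R.1.receive.sem (tensor (outcome (R.1.ask.sem ρ) y) (tensor (key R.2 y.right) (ket R.2)))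

/-- The list of queries after a round with message `y`. -/
def record (y : Bits (1 + fn)) (Q : List (Bits fn)) : List (Bits fn) :=
  if y.left 0 = false then Q else y.right :: Q

open Classical in
/-- The probability to win of an adversary whose rounds of queries use the given tags. -/
def tagged (key : Bits tg → Bits fn → Op sk) (al : List (Bits fn) → Prop)
    (k : List (Bits fn) → Op w → ℝ) :
    List (Round w fn (sk + tg) × Bits tg) → List (Bits fn) → Op w → ℝ
  | [], Q, ρ => k Q ρ
  | R :: L, Q, ρ => ∑ y, if y.left 0 = false ∨ al (y.right :: Q) then
      tagged key al k L (record y Q) (answer key R ρ y) else 0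

variable {key : Bits tg → Bits fn → Op sk} {al : List (Bits fn) → Prop}
  {k : List (Bits fn) → Op w → ℝ}

theorem isLin_answer {V : Op w → ℝ} (hV : IsLin V) (R : Round w fn (sk + tg) × Bits tg)
    (y : Bits (1 + fn)) : IsLin fun ρ => V (answer key R ρ y) := by
  unfold answer
  split_ifs
  · exact (hV.outcome y).sem R.1.ask
  · exact (((hV.sem R.1.receive).tensor _).outcome y).sem R.1.ask

open Classical in
theorem isLin_tagged (hk : ∀ Q, IsLin (k Q)) (L : List (Round w fn (sk + tg) × Bits tg))
    (Q : List (Bits fn)) : IsLin (tagged key al k L Q) := by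
  induction L generalizing Q with
  | nil => exact hk Q
  | cons R L ih => exact .sum fun y => .ite (isLin_answer (ih _) R y) .zero

open Classical in
-- The rounds do not depend on the parameter of `Φ`, so an average over coins that are used only
-- after them may be taken before or after them.
theorem map_tagged {X : Type*} (Φ : (X → ℝ) →ₗ[ℝ] ℝ) (k : X → List (Bits fn) → Op w → ℝ)
    (L : List (Round w fn (sk + tg) × Bits tg)) (Q : List (Bits fn)) (ρ : Op w) :
    tagged key al (fun Q ρ => Φ fun e => k e Q ρ) L Q ρ = Φ fun e => tagged key al (k e) L Q ρ := by
  induction L generalizing Q ρ with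
  | nil => rfl
  | cons R L ih =>
    simp only [tagged, ih]
    have h : (fun e => ∑ y, if y.left 0 = false ∨ al (y.right :: Q) then
        tagged key al (k e) L (record y Q) (answer key R ρ y) else 0) =
        ∑ y, fun e => if y.left 0 = false ∨ al (y.right :: Q) then
        tagged key al (k e) L (record y Q) (answer key R ρ y) else 0 := by
      funext e; simp
    rw [h, map_sum]
    refine Finset.sum_congr rfl fun y _ => ?_
    split_ifs
    · rfl
    · exact Φ.map_zero.symm

theorem posSemidef_answer (hkey : ∀ τ f, IsState (key τ f)) (R : Round w fn (sk + tg) × Bits tg)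
    {ρ : Op w} (hρ : ρ.PosSemidef) (y : Bits (1 + fn)) : (answer key R ρ y).PosSemidef := by
  have h := posSemidef_outcome (R.1.ask.sem_posSemidef hρ) y
  unfold answer
  split_ifs
  · exact h
  · exact R.1.receive.sem_posSemidef
      (posSemidef_tensor h (posSemidef_tensor (hkey _ _).1 (posSemidef_ket _)))

theorem sum_trace_answer (hkey : ∀ τ f, IsState (key τ f)) (R : Round w fn (sk + tg) × Bits tg)
    (ρ : Op w) : ∑ y, (answer key R ρ y).trace = ρ.trace := by
  rw [← R.1.ask.trace_sem, ← sum_trace_outcome]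
  refine Finset.sum_congr rfl fun y _ => ?_
  unfold answer
  split_ifs
  · rfl
  · rw [QCirc.trace_sem, trace_tensor, trace_tensor, (hkey _ _).2, trace_ket, mul_one, mul_one]

theorem trace_re_nonneg {n : ℕ} {ρ : Op n} (h : ρ.PosSemidef) : 0 ≤ ρ.trace.re :=
  (Complex.le_def.1 h.trace_nonneg).1

/-- Unnormalized states carry probabilities as their traces: the traces after a round, summed over
all messages, give the trace before it, and a stopped experiment only loses weight. A bound relative
to the trace therefore survives any number of rounds. -/
theorem abs_tagged_le (hkey : ∀ τ f, IsState (key τ f)) {ε : ℝ} (hε : 0 ≤ ε)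
    (hk : ∀ Q ρ, ρ.PosSemidef → |k Q ρ| ≤ ε * ρ.trace.re)
    (L : List (Round w fn (sk + tg) × Bits tg)) (Q : List (Bits fn)) {ρ : Op w}
    (hρ : ρ.PosSemidef) : |tagged key al k L Q ρ| ≤ ε * ρ.trace.re := by
  induction L generalizing Q ρ with
  | nil => exact hk Q ρ hρ
  | cons R L ih =>
    rw [← sum_trace_answer hkey R ρ, Complex.re_sum, Finset.mul_sum]
    refine (Finset.abs_sum_le_sum_abs _ _).trans (Finset.sum_le_sum fun y _ => ?_)
    have h := posSemidef_answer hkey R hρ y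
    split_ifs
    · exact ih _ h
    · rw [abs_zero]
      exact mul_nonneg hε (trace_re_nonneg h)

/-- None of the functions separates the plaintexts. -/
def Admissible (app : Bits fn → Bits inp → Bits out) (x : Bits (inp + inp))
    (Q : List (Bits fn)) : Prop :=
  ∀ f ∈ Q, app f x.left = app f x.right

/-- The probability to win from the challenge plaintexts `x` and the ciphertext `c` on. -/
def postValue (key : Bits tg → Bits fn → Op sk) (app : Bits fn → Bits inp → Bits out)
    (A : Adversary pk fn inp (sk + tg) ct) (L : List (Round A.w fn (sk + tg) × Bits tg))
    (x : Bits (inp + inp)) (c : Bits ct) (Q : List (Bits fn)) (ρ : Op A.w) : ℝ :=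
  tagged key (Admissible app x) (fun _ ρ' => accept (A.guess.sem ρ')) L Q
    (A.receive.sem (tensor ρ (ket c)))

open Classical in
/-- The probability to win from the challenge on, with the ciphertext `c x` for the challenge
plaintexts `x`. -/
def challengeValue (key : Bits tg → Bits fn → Op sk) (app : Bits fn → Bits inp → Bits out)
    (A : Adversary pk fn inp (sk + tg) ct) (L : List (Round A.w fn (sk + tg) × Bits tg))
    (c : Bits (inp + inp) → Bits ct) (Q : List (Bits fn)) (ρ : Op A.w) : ℝ :=
  ∑ x, if Admissible app x Q then
    postValue key app A L x (c x) Q (outcome (A.challenge.sem ρ) x) else 0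

/-- The probability to win with the given tags, public key, secret keys and ciphertexts. -/
def game (key : Bits tg → Bits fn → Op sk) (app : Bits fn → Bits inp → Bits out)
    (A : Adversary pk fn inp (sk + tg) ct) (Lp Lq : List (Round A.w fn (sk + tg) × Bits tg))
    (P : Bits pk) (c : Bits (inp + inp) → Bits ct) : ℝ :=
  tagged key (fun _ => True) (challengeValue key app A Lq c) Lp []
    (A.start.sem (tensor (ket P) A.advice))

variable {app : Bits fn → Bits inp → Bits out} {A : Adversary pk fn inp (sk + tg) ct}
  {Lp Lq : List (Round A.w fn (sk + tg) × Bits tg)}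

theorem abs_postValue_le (hkey : ∀ τ f, IsState (key τ f)) (x : Bits (inp + inp)) (c : Bits ct)
    (Q : List (Bits fn)) {ρ : Op A.w} (hρ : ρ.PosSemidef) :
    |postValue key app A Lq x c Q ρ| ≤ ρ.trace.re := by
  have h := abs_tagged_le (al := Admissible app x) hkey zero_le_one
    (k := fun _ ρ' => accept (A.guess.sem ρ'))
    (fun _ ρ hρ => by
      have h := A.guess.sem_posSemidef hρ
      rw [abs_of_nonneg (accept_nonneg h), one_mul, ← A.guess.trace_sem]
      exact accept_le h) Lq Q (A.receive.sem_posSemidef (posSemidef_tensor hρ (posSemidef_ket c)))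
  rwa [one_mul, QCirc.trace_sem, trace_tensor, trace_ket, mul_one] at h

theorem isLin_postValue (x : Bits (inp + inp)) (c : Bits ct) (Q : List (Bits fn)) :
    IsLin (postValue key app A Lq x c Q) :=
  ((isLin_tagged (fun _ => IsLin.accept.sem A.guess) Lq Q).sem A.receive).tensor _

open Classical in
theorem isLin_challengeValue (c : Bits (inp + inp) → Bits ct) (Q : List (Bits fn)) :
    IsLin (challengeValue key app A Lq c Q) :=
  .sum fun _ => .ite (((isLin_postValue _ _ _).outcome _).sem A.challenge) .zero

/-- A bound for averages of the game follows from a bound for the second phase. -/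
theorem abs_game_le (hkey : ∀ τ f, IsState (key τ f)) {X : Type*} (Φ : (X → ℝ) →ₗ[ℝ] ℝ)
    (P : Bits pk) (c : X → Bits (inp + inp) → Bits ct) {ε : ℝ} (hε : 0 ≤ ε)
    (h : ∀ x Q ρ, Admissible app x Q → ρ.PosSemidef →
      |Φ fun e => postValue key app A Lq x (c e x) Q ρ| ≤ ε * ρ.trace.re) :
    |Φ fun e => game key app A Lp Lq P (c e)| ≤ ε := by
  unfold game
  rw [← map_tagged]
  have hs : IsState (A.start.sem (tensor (ket P) A.advice)) :=
    ((isState_ket P).tensor A.advice_isState).sem _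
  have := abs_tagged_le (al := fun _ => True) hkey hε
    (k := fun Q ρ => Φ fun e => challengeValue key app A Lq (c e) Q ρ) (fun Q ρ hρ => ?_) Lp [] hs.1
  · simpa [hs.2] using this
  · classical
    have e : (fun e => challengeValue key app A Lq (c e) Q ρ) =
        ∑ x, fun e => if Admissible app x Q then
          postValue key app A Lq x (c e x) Q (outcome (A.challenge.sem ρ) x) else 0 := by
      funext e
      simp [challengeValue]
    -- The weight of `ρ` is distributed over the possible challenge plaintexts, so the bounds for
    -- the single plaintexts add up to the bound for `ρ`.
    rw [e, map_sum, ← A.challenge.trace_sem ρ, ← sum_trace_outcome, Complex.re_sum, Finset.mul_sum]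
    refine (Finset.abs_sum_le_sum_abs _ _).trans (Finset.sum_le_sum fun x _ => ?_)
    have hp := posSemidef_outcome (A.challenge.sem_posSemidef hρ) x
    by_cases ha : Admissible app x Q
    · simp only [if_pos ha]
      exact h x Q _ ha hp
    · simp only [if_neg ha]
      refine (abs_eq_zero.2 Φ.map_zero).le.trans (mul_nonneg hε (trace_re_nonneg hp))

/-- The previous bound, for the average over a one-point space. -/
theorem abs_game_le_one (hkey : ∀ τ f, IsState (key τ f)) (P : Bits pk)
    (c : Bits (inp + inp) → Bits ct) : |game key app A Lp Lq P c| ≤ 1 :=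
  abs_game_le hkey (LinearMap.proj () : (Unit → ℝ) →ₗ[ℝ] ℝ) P (fun _ => c) zero_le_one
    fun x Q ρ _ hρ => by simpa using abs_postValue_le hkey x (c x) Q hρ

end Tagged

/-! ### Key queries with random tags -/

section Untagged

variable {w fn sk tg : ℕ}

open Classical in
/-- A sequence of rounds of key queries, answered by `qkg`. -/
def untagged (qkg : Bits fn → Op sk) (al : List (Bits fn) → Prop)
    (k : List (Bits fn) → Op w → ℝ) : List (Round w fn sk) → List (Bits fn) → Op w → ℝ
  | [], Q, ρ => k Q ρ
  | R :: L, Q, ρ => ∑ y : Bits (1 + fn),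
      if y.left 0 = false then untagged qkg al k L Q (outcome (R.ask.sem ρ) y)
      else if al (y.right :: Q) then
        untagged qkg al k L (y.right :: Q)
          (R.receive.sem (tensor (outcome (R.ask.sem ρ) y) (qkg y.right)))
      else 0

theorem queries_eq_untagged (S : SDFE) (msk : Bits S.msk) (al : List (Bits S.fn) → Prop)
    (k : List (Bits S.fn) → Op w → ℝ) (L : List (Round w S.fn S.sk)) :
    S.queries msk al k L = untagged (S.qkg msk) al k L := by
  induction L with
  | nil => rfl
  | cons R L ih =>
    funext Q ρ
    simp only [SDFE.queries, untagged, ih]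

open Classical in
-- Linearity in the state turns an answer that is a mixture over tags into an average over tags. A
-- tag is assigned to every round, even to one without a query; there the average is over a
-- constant, so the tags can be drawn independently of the run.
theorem untagged_eq_avg (key : Bits tg → Bits fn → Op sk) (al : List (Bits fn) → Prop)
    (k : List (Bits fn) → Op w → ℝ) (hk : ∀ Q, IsLin (k Q))
    (L : List (Round w fn (sk + tg))) (Q : List (Bits fn)) (ρ : Op w) :
    untagged (fun f => ((2 : ℂ) ^ tg)⁻¹ • ∑ τ : Bits tg, tensor (key τ f) (ket τ)) al k L Q ρ =
      avgL tg L.length fun ts => tagged key al k (L.zip ts) Q ρ := by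
  induction L generalizing Q ρ with
  | nil => rfl
  | cons R L ih =>
    rw [List.length_cons, avgL_succ]
    simp only [List.zip_cons_cons, tagged]
    have h1 : ∀ τ : Bits tg, (fun ts => ∑ y : Bits (1 + fn),
        if y.left 0 = false ∨ al (y.right :: Q) then
          tagged key al k (L.zip ts) (record y Q) (answer key (R, τ) ρ y) else 0) =
        ∑ y : Bits (1 + fn), fun ts => if y.left 0 = false ∨ al (y.right :: Q) then
          tagged key al k (L.zip ts) (record y Q) (answer key (R, τ) ρ y) else 0 := by
      intro τ; funext ts; simp
    simp only [h1, map_sum]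
    have h2 : ∀ f : Bits tg → Bits (1 + fn) → ℝ,
        (expect fun τ => ∑ y, f τ y) = ∑ y, expect fun τ => f τ y := by
      intro f
      have : (fun τ => ∑ y, f τ y) = ∑ y, fun τ => f τ y := by funext τ; simp
      rw [this]
      exact map_sum (expectL _) _ _
    rw [h2]
    refine Finset.sum_congr rfl fun y _ => ?_
    -- Three cases: no query, where the tag is not used; an allowed query, where linearity applies;
    -- a forbidden query, which contributes zero for every tag.
    by_cases hy : y.left 0 = false
    · rw [if_pos hy]
      simp only [if_pos (Or.inl hy : y.left 0 = false ∨ al (y.right :: Q)), record, answer,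
        if_pos hy, expect_const]
      exact ih _ _
    · rw [if_neg hy]
      by_cases ha : al (y.right :: Q)
      · rw [if_pos ha]
        simp only [if_pos (Or.inr ha : y.left 0 = false ∨ al (y.right :: Q)), record, answer,
          if_neg hy]
        have hV : IsLin fun σ => avgL tg L.length fun ts =>
            tagged key al k (L.zip ts) (y.right :: Q) σ := by
          refine ⟨fun ρ σ => ?_, fun c ρ => ?_⟩
          · simp only [(isLin_tagged hk _ _).add]
            exact map_add (avgL tg L.length) _ _
          · simp only [(isLin_tagged hk _ _).smul]
            exact map_smul (avgL tg L.length) _ _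
        have e' : R.receive.sem (tensor (outcome (R.ask.sem ρ) y)
            (((2 : ℂ) ^ tg)⁻¹ • ∑ τ : Bits tg, tensor (key τ y.right) (ket τ))) =
            ((((2 : ℝ) ^ tg)⁻¹ : ℝ) : ℂ) •
            ∑ τ : Bits tg, R.receive.sem (tensor (outcome (R.ask.sem ρ) y)
              (tensor (key τ y.right) (ket τ))) := by
          rw [← QCirc.sem_sum, ← tensor_sum_right, ← QCirc.sem_smul, ← tensor_smul_right]
          norm_num
        rw [ih, e', hV.smul, hV.map_sum, expect, div_eq_inv_mul]
      · rw [if_neg ha]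
        simp only [if_neg (not_or.2 ⟨hy, ha⟩)]
        have h0 : (avgL tg L.length) (fun _ => 0) = 0 := avgL_const _ _
        rw [h0, expect_const]

end Untagged

/-! ### The experiment of the key-bundled scheme -/

section Experiment

variable {tag : ℕ → ℕ} {E : SDFEAlgs} {F : PPRF tag E.setupCoins} {G : PPRF tag E.encCoins}
  {O : Obfuscator} {padS padE : ℕ → ℕ} {l : ℕ}

/-- The quantum keys for the master secret keys `m`. -/
def keyState (E : SDFEAlgs) (l : ℕ) {tg : ℕ} (m : Bits tg → Bits (E.msk l)) (τ : Bits tg)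
    (f : Bits (E.fn l)) : Op (E.sk l) :=
  (E.qkg l).sem (ket (Fin.append (m τ) f))

theorem isState_keyState {tg : ℕ} (m : Bits tg → Bits (E.msk l)) (τ : Bits tg)
    (f : Bits (E.fn l)) : IsState (keyState E l m τ f) :=
  (isState_ket _).sem _

/-- One of the two challenge plaintexts. -/
def choose {n : ℕ} (b : Bool) (x : Bits (n + n)) : Bits n := if b then x.right else x.left

/-- The master secret keys of the tags. -/
def tagMsk (E : SDFEAlgs) (F : PPRF tag E.setupCoins) (l : ℕ) (K : Bits (F.key l))
    (τ : Bits (tag l)) : Bits (E.msk l) :=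
  ((E.setup l).eval (F.value l K τ)).right

open Classical in
theorem experiment_eq_untagged (S : SDFE) (bound : ℕ∞) (A : Adversary S.pk S.fn S.inp S.sk S.ct)
    (coin : Bool) : S.experiment bound A coin = expect fun r =>
      untagged (S.qkg (S.setup r).2) (fun Q => (Q.length : ℕ∞) ≤ bound)
        (fun Q ρ => ∑ x : Bits (S.inp + S.inp), if Admissible S.app x Q then expect fun e =>
          untagged (S.qkg (S.setup r).2)
            (fun Q' => (Q'.length : ℕ∞) ≤ bound ∧ Admissible S.app x Q')
            (fun _ ρ' => accept (A.guess.sem ρ')) A.post Q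
            (A.receive.sem (tensor (outcome (A.challenge.sem ρ) x)
              (ket (S.enc (S.setup r).1 (choose coin x) e))))
        else 0) A.pre [] (A.start.sem (tensor (ket (S.setup r).1) A.advice)) := by
  simp only [SDFE.experiment, queries_eq_untagged]
  refine congrArg expect (funext fun r => ?_)
  congr 1
  funext Q ρ
  refine Finset.sum_congr rfl fun x _ => ?_
  by_cases h : Admissible S.app x Q
  · rw [if_pos h]
    exact if_pos h
  · rw [if_neg h]
    exact if_neg h

/-- The adaptive experiment of a scheme whose keys come with random tags. -/
theorem experiment_eq_avg {pk fn inp sk tg ct nr ne msk out : ℕ}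
    (setup : Bits nr → Bits pk × Bits msk) (key : Bits msk → Bits tg → Bits fn → Op sk)
    (enc : Bits pk → Bits inp → Bits ne → Bits ct) (app : Bits fn → Bits inp → Bits out)
    (dec : Op (sk + tg) → Bits ct → Op (1 + out)) (A : Adversary pk fn inp (sk + tg) ct)
    (coin : Bool) :
    (SDFE.mk pk msk fn inp out (sk + tg) ct nr ne app setup (fun K f =>
      ((2 : ℂ) ^ tg)⁻¹ • ∑ τ : Bits tg, tensor (key K τ f) (ket τ)) enc dec).experiment ⊤ A coin =
      avgL tg A.pre.length fun t₁ => avgL tg A.post.length fun t₂ =>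
        expect fun r => expect fun e =>
          game (key (setup r).2) app A (A.pre.zip t₁) (A.post.zip t₂) (setup r).1
            fun x => enc (setup r).1 (choose coin x) e := by
  classical
  have h1 : ∀ r, (fun (Q : List (Bits fn)) (ρ : Op A.w) => ∑ x : Bits (inp + inp),
      if Admissible app x Q then expect fun e =>
        untagged (fun f => ((2 : ℂ) ^ tg)⁻¹ • ∑ τ : Bits tg, tensor (key (setup r).2 τ f) (ket τ))
          (Admissible app x) (fun _ ρ' => accept (A.guess.sem ρ')) A.post Q
          (A.receive.sem (tensor (outcome (A.challenge.sem ρ) x)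
            (ket (enc (setup r).1 (choose coin x) e))))
      else 0) = fun Q ρ => avgL tg A.post.length fun t₂ => expect fun e =>
        challengeValue (key (setup r).2) app A (A.post.zip t₂)
          (fun x => enc (setup r).1 (choose coin x) e) Q ρ := by
    intro r
    funext Q ρ
    simp only [untagged_eq_avg (key (setup r).2) (Admissible app _)
      (fun _ ρ' => accept (A.guess.sem ρ')) (fun _ => IsLin.accept.sem A.guess)]
    have e1 : ∀ t₂, (fun e => challengeValue (key (setup r).2) app A (A.post.zip t₂)
        (fun x => enc (setup r).1 (choose coin x) e) Q ρ) = ∑ x : Bits (inp + inp), fun e =>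
        if Admissible app x Q then postValue (key (setup r).2) app A (A.post.zip t₂) x
          (enc (setup r).1 (choose coin x) e) Q (outcome (A.challenge.sem ρ) x) else 0 := by
      intro t₂; funext e; simp [challengeValue]
    have e2 : (fun t₂ => expect fun e => challengeValue (key (setup r).2) app A (A.post.zip t₂)
        (fun x => enc (setup r).1 (choose coin x) e) Q ρ) = ∑ x : Bits (inp + inp), fun t₂ =>
        expect fun e => if Admissible app x Q then
          postValue (key (setup r).2) app A (A.post.zip t₂) x
          (enc (setup r).1 (choose coin x) e) Q (outcome (A.challenge.sem ρ) x) else 0 := by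
      funext t₂
      rw [← expectL_apply, e1, map_sum, Finset.sum_apply]
      rfl
    rw [e2, map_sum]
    refine Finset.sum_congr rfl fun x _ => ?_
    by_cases hx : Admissible app x Q
    · simp only [if_pos hx]
      exact (map_expect (avgL tg A.post.length) _).symm
    · simp only [if_neg hx, expect_const]
      exact (avgL_const _ _).symm
  have h2 : ∀ n : ℕ, ((n : ℕ∞) ≤ ⊤) = True := fun n => eq_true le_top
  -- The tags of the second phase and the encryption coins do not enter the rounds of the first
  -- phase, so their averages can be pulled out of these rounds.
  have h3 : ∀ t₁ r, (avgL tg A.post.length fun t₂ => expect fun e =>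
      game (key (setup r).2) app A (A.pre.zip t₁) (A.post.zip t₂) (setup r).1
        fun x => enc (setup r).1 (choose coin x) e) =
      tagged (key (setup r).2) (fun _ => True) (fun Q ρ => avgL tg A.post.length fun t₂ =>
        expect fun e => challengeValue (key (setup r).2) app A (A.post.zip t₂)
          (fun x => enc (setup r).1 (choose coin x) e) Q ρ) (A.pre.zip t₁) []
        (A.start.sem (tensor (ket (setup r).1) A.advice)) := by
    intro t₁ r
    rw [map_tagged]
    congr 1
    funext t₂
    exact (map_tagged (expectL ne) _ _ _ _).symm
  have h4 : ∀ t₁, (avgL tg A.post.length fun t₂ => expect fun r => expect fun e =>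
      game (key (setup r).2) app A (A.pre.zip t₁) (A.post.zip t₂) (setup r).1
        fun x => enc (setup r).1 (choose coin x) e) = expect fun r =>
      tagged (key (setup r).2) (fun _ => True) (fun Q ρ => avgL tg A.post.length fun t₂ =>
        expect fun e => challengeValue (key (setup r).2) app A (A.post.zip t₂)
          (fun x => enc (setup r).1 (choose coin x) e) Q ρ) (A.pre.zip t₁) []
        (A.start.sem (tensor (ket (setup r).1) A.advice)) := by
    intro t₁
    rw [map_expect]
    simp only [h3]
  simp only [h4]
  rw [map_expect, experiment_eq_untagged]
  refine congrArg expect (funext fun r => ?_)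
  simp only [h2, true_and]
  rw [← untagged_eq_avg, ← h1]
  · intro Q
    refine ⟨fun ρ σ => ?_, fun c ρ => ?_⟩
    · simp only [(isLin_challengeValue _ _).add]
      rw [← map_add]
      congr 1
      funext t₂
      exact map_add (expectL ne) _ _
    · simp only [(isLin_challengeValue _ _).smul]
      rw [← smul_eq_mul, ← map_smul]
      congr 1
      funext t₂
      exact map_smul (expectL ne) _ _

/-- The tags are averaged outermost, which lets everything below work with fixed tags. The coins of
setup and of encryption are split into those of the PRF key and those of the obfuscator, since the
hybrids treat the two differently. -/
theorem experiment_bundled (A : Adversary (bundled E F G O padS padE l).pk (E.fn l) (E.inp l)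
    (E.sk l + tag l) (bundled E F G O padS padE l).ct) (coin : Bool) :
    (bundled E F G O padS padE l).experiment ⊤ A coin =
      avgL (tag l) A.pre.length fun t₁ => avgL (tag l) A.post.length fun t₂ =>
        expect fun r : Bits (F.genCoins l) =>
        expect fun c : Bits (O.coins l (tag l) (E.pk l) (setupGates E F padS l)) =>
        expect fun r' : Bits (G.genCoins l) =>
        expect fun c' : Bits (O.coins l (tag l) (E.ct l) (encGates E F G O padS padE l)) =>
          game (keyState E l (tagMsk E F l (F.genKey l r))) (E.scheme l).app A (A.pre.zip t₁)
            (A.post.zip t₂) (O.obf l (setupCircuit E F padS l (F.genKey l r)) c)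
            fun x => O.obf l (encCircuit E F G O padS padE l
              (O.obf l (setupCircuit E F padS l (F.genKey l r)) c) (G.genKey l r')
              (choose coin x)) c' := by
  refine (experiment_eq_avg (bundled E F G O padS padE l).setup
    (fun K => keyState E l (tagMsk E F l K)) (bundled E F G O padS padE l).enc
    (E.scheme l).app (bundled E F G O padS padE l).dec A coin).trans ?_
  refine congrArg _ (funext fun t₁ => congrArg _ (funext fun t₂ => ?_))
  refine (expect_append (m := F.genCoins l)
    (n := O.coins l (tag l) (E.pk l) (setupGates E F padS l)) _).trans ?_
  refine congrArg expect (funext fun r => congrArg expect (funext fun c => ?_))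
  refine (expect_append (m := G.genCoins l)
    (n := O.coins l (tag l) (E.ct l) (encGates E F G O padS padE l)) _).trans ?_
  refine congrArg expect (funext fun r' => congrArg expect (funext fun c' => ?_))
  simp only [bundled, Bits.append_left, Bits.append_right]
  rfl

end Experiment

open Enc

/-! ### The history of key queries -/

section History

variable {N fn inp out : ℕ}

/-- Entry `s` of a table. -/
def slot {m : ℕ} (h : Bits (N * m)) (s : Fin N) : Bits m := fun b => h (finProdFinEquiv (s, b))

/-- Replacement of entry `j` of a table. -/
def setSlot {m : ℕ} (h : Bits (N * m)) (j : ℕ) (y : Bits m) : Bits (N * m) := fun i =>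
  if ((finProdFinEquiv.symm i).1 : ℕ) = j then y (finProdFinEquiv.symm i).2 else h i

theorem slot_setSlot {m : ℕ} (h : Bits (N * m)) (j : ℕ) (y : Bits m) (s : Fin N) :
    slot (setSlot h j y) s = if (s : ℕ) = j then y else slot h s := by
  funext b
  unfold slot setSlot
  rw [Equiv.symm_apply_apply]
  split_ifs <;> rfl

/-- The first `j` entries of `h` are the messages of rounds with the queries `Q`; the other entries
are unused. -/
structure Records (j : ℕ) (h : Bits (N * (1 + fn))) (Q : List (Bits fn)) : Prop where
  unused : ∀ s : Fin N, j ≤ s → (slot h s).left 0 = false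
  mem_iff : ∀ f, f ∈ Q ↔ ∃ s, (slot h s).left 0 = true ∧ (slot h s).right = f

theorem Records.init : Records (N := N) (fn := fn) 0 (fun _ => false) [] :=
  ⟨fun _ _ => rfl, fun f => by simp [slot, Bits.left]⟩

theorem Records.set {j : ℕ} {h : Bits (N * (1 + fn))} {Q : List (Bits fn)} (H : Records j h Q)
    (hj : j < N) (y : Bits (1 + fn)) : Records (j + 1) (setSlot h j y) (record y Q) := by
  refine ⟨fun s hs => ?_, fun f => ?_⟩
  · rw [slot_setSlot, if_neg (by omega)]
    exact H.unused s (by omega)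
  · have h1 : (∃ s, (slot (setSlot h j y) s).left 0 = true ∧ (slot (setSlot h j y) s).right = f) ↔
        (y.left 0 = true ∧ y.right = f) ∨
          ∃ s, (slot h s).left 0 = true ∧ (slot h s).right = f := by
      constructor
      · rintro ⟨s, hs⟩
        rw [slot_setSlot] at hs
        split_ifs at hs
        · exact .inl hs
        · exact .inr ⟨s, hs⟩
      · rintro (hy | ⟨s, hs⟩)
        · exact ⟨⟨j, hj⟩, by rw [slot_setSlot, if_pos rfl]; exact hy⟩
        · refine ⟨s, ?_⟩
          -- Slot `j` was unused before, so overwriting it loses no recorded query.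
          have : (s : ℕ) ≠ j := fun e => by simp [H.unused s e.ge] at hs
          rwa [slot_setSlot, if_neg this]
    rw [h1, ← H.mem_iff, record]
    cases hy : y.left 0 <;> simp [eq_comm]

/-- None of the recorded queries separates the plaintexts. -/
def admissible (app : Bits fn → Bits inp → Bits out) (h : Bits (N * (1 + fn)))
    (x : Bits (inp + inp)) : Bool :=
  decide (∀ s, (!(slot h s).left 0 ||
    decide (app (slot h s).right x.left = app (slot h s).right x.right)) = true)

theorem Records.admissible_iff {j : ℕ} {h : Bits (N * (1 + fn))} {Q : List (Bits fn)}
    (H : Records j h Q) (app : Bits fn → Bits inp → Bits out) (x : Bits (inp + inp)) :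
    admissible app h x = true ↔ Admissible app x Q := by
  simp only [admissible, Admissible, H.mem_iff, decide_eq_true_eq, Bool.or_eq_true,
    Bool.not_eq_true']
  constructor
  · rintro h f ⟨s, hs, rfl⟩
    exact (h s).resolve_left (by simp [hs])
  · intro h' s
    cases hs : (slot h s).left 0
    · exact .inl rfl
    · exact .inr (h' _ ⟨s, hs, rfl⟩)

end History

/-! ### Simulation of the game -/

/-- The classical memory of a simulation: the input, the messages of the rounds, and the challenge
plaintexts. -/
abbrev Mem (nz N fn inp : ℕ) : Type := Bits nz × Bits (N * (1 + fn)) × Bits (inp + inp)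

/-- Number of bits of the classical memory. -/
abbrev memLen (nz N fn inp : ℕ) : ℕ := nz + (N * (1 + fn) + (inp + inp))

/-- Classical circuits with `s` gates that a simulation uses to prepare, from its input `z`, the
public key, the master secret keys, and the ciphertext (which may depend on further bits). -/
structure SimCircuits {nz fn inp pk ct msk tg ny out : ℕ} (N s : ℕ) (Pf : Bits nz → Bits pk)
    (mf : Bits tg → Bits nz → Bits msk)
    (cf : Bits nz × Bits (inp + inp) × Bits ny → Bits ct)
    (app : Bits fn → Bits inp → Bits out) where
  start : Circuit nz (memLen nz N fn inp + pk) s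
  start_eval : ∀ z, start.eval z =
    Fin.append (enc ((z, fun _ => false, fun _ => false) : Mem nz N fn inp)) (Pf z)
  push : ℕ → Bits tg → Circuit ((1 + fn) + memLen nz N fn inp)
    (1 + ((msk + fn) + (tg + memLen nz N fn inp))) s
  push_eval : ∀ j τ (y : Bits (1 + fn)) (z : Bits nz) (h : Bits (N * (1 + fn))) x,
    (push j τ).eval (Fin.append y (enc ((z, h, x) : Mem nz N fn inp))) =
      Fin.append (fun _ => y.left 0) (Fin.append (Fin.append (mf τ z) y.right)
        (Fin.append τ (enc ((z, setSlot h j y, x) : Mem nz N fn inp))))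
  drop : Circuit ((msk + fn) + (tg + memLen nz N fn inp)) (memLen nz N fn inp) s
  drop_eval : ∀ (a : Bits (msk + fn)) (τ : Bits tg) c,
    drop.eval (Fin.append a (Fin.append τ c)) = c
  chal : Circuit ((inp + inp) + memLen nz N fn inp) (memLen nz N fn inp + (inp + inp)) s
  chal_eval : ∀ (z : Bits nz) (h : Bits (N * (1 + fn))) (x' x : Bits (inp + inp)),
    chal.eval (Fin.append x (enc ((z, h, x') : Mem nz N fn inp))) =
      Fin.append (enc ((z, h, x) : Mem nz N fn inp)) x
  recv : Circuit (memLen nz N fn inp + ny) (ct + memLen nz N fn inp) s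
  recv_eval : ∀ (z : Bits nz) (h : Bits (N * (1 + fn))) (x : Bits (inp + inp)) (y : Bits ny),
    recv.eval (Fin.append (enc ((z, h, x) : Mem nz N fn inp)) y) =
      Fin.append (cf (z, x, y)) (enc ((z, h, x) : Mem nz N fn inp))
  guess : Circuit (1 + memLen nz N fn inp) 1 s
  guess_eval : ∀ (b : Bits 1) (z : Bits nz) (h : Bits (N * (1 + fn))) (x : Bits (inp + inp)),
    guess.eval (Fin.append b (enc ((z, h, x) : Mem nz N fn inp))) =
      fun _ => b 0 && admissible app h x
  ext : ℕ → Circuit ((1 + fn) + memLen nz N fn inp) (memLen nz N fn inp + (1 + fn)) s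
  ext_eval : ∀ j (y : Bits (1 + fn)) (z : Bits nz) (h : Bits (N * (1 + fn))) x,
    (ext j).eval (Fin.append y (enc ((z, h, x) : Mem nz N fn inp))) =
      Fin.append (enc ((z, setSlot h j y, x) : Mem nz N fn inp)) y
  zero : Circuit (memLen nz N fn inp) (memLen nz N fn inp + (1 + fn)) s
  zero_eval : ∀ c, zero.eval c = Fin.append c fun _ => false
  addTag : Bits tg → Circuit (memLen nz N fn inp) (tg + memLen nz N fn inp) s
  addTag_eval : ∀ τ c, (addTag τ).eval c = Fin.append τ c

namespace SimCircuits

variable {nz fn inp pk ct msk tg ny out N s w sk anc : ℕ} {Pf : Bits nz → Bits pk}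
  {mf : Bits tg → Bits nz → Bits msk} {cf : Bits nz × Bits (inp + inp) × Bits ny → Bits ct}
  {app : Bits fn → Bits inp → Bits out} (S : SimCircuits N s Pf mf cf app)

/-- A state with the given classical memory. -/
def state (ρ : Op w) (z : Bits nz) (h : Bits (N * (1 + fn))) (x : Bits (inp + inp)) :
    Op (w + memLen nz N fn inp) :=
  tensor ρ (ket (enc ((z, h, x) : Mem nz N fn inp)))

open QCirc

/-- Preparation of the memory. -/
def startQ (A : QCirc (pk + anc) w) : QCirc (nz + anc) (w + memLen nz N fn inp) :=
  ((classical S.start).extend anc).comp ((assoc _ pk anc).comp ((swap _ (pk + anc)).comp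
    (A.extend _)))

theorem sem_startQ (A : QCirc (pk + anc) w) (z : Bits nz) (σ : Op anc) :
    (S.startQ A).sem (tensor (ket z) σ) =
      state (A.sem (tensor (ket (Pf z)) σ)) z (fun _ => false) fun _ => false := by
  rw [startQ, sem_comp, sem_comp, sem_comp, sem_extend_tensor, sem_classical_ket, S.start_eval,
    ket_append, sem_assoc_tensor, sem_swap_tensor, sem_extend_tensor]
  rfl

/-- Use of a key for the tag in the classical register. -/
def useKey (R : Round w fn (sk + tg)) (c : ℕ) : QCirc (w + sk + (tg + c)) (w + c) :=
  (assoc' (w + sk) tg c).comp (((assoc w sk tg).comp R.receive).extend c)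

theorem sem_useKey (R : Round w fn (sk + tg)) {c : ℕ} (ρ : Op w) (σ : Op sk) (τ : Bits tg)
    (v : Bits c) : (useKey R c).sem (tensor (tensor ρ σ) (ket (Fin.append τ v))) =
      tensor (R.receive.sem (tensor ρ (tensor σ (ket τ)))) (ket v) := by
  rw [useKey, ket_append, sem_comp, sem_assoc'_tensor, sem_extend_tensor, sem_comp,
    sem_assoc_tensor]

/-- A round in which the simulation makes the key. -/
def round (q : QCirc (msk + fn) sk) (R : Round w fn (sk + tg)) (j : ℕ) (τ : Bits tg) :
    QCirc (w + memLen nz N fn inp) (w + memLen nz N fn inp) :=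
  (R.ask.extend _).comp ((measure w (1 + fn) _ (S.push j τ)).comp
    (cond (onLast w S.drop)
      ((assoc' w (msk + fn) _).comp ((((swap w (msk + fn)).comp ((q.extend w).comp
        (swap sk w))).extend _).comp (useKey R _)))))

theorem size_round (q : QCirc (msk + fn) sk) (R : Round w fn (sk + tg)) (j : ℕ) (τ : Bits tg) :
    (S.round q R j τ).size = R.ask.size +
      (Circuit.cost ((1 + fn) + memLen nz N fn inp)
        (1 + ((msk + fn) + (tg + memLen nz N fn inp))) s +
      (Circuit.cost ((msk + fn) + (tg + memLen nz N fn inp)) (memLen nz N fn inp) s +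
        (q.size + R.receive.size) + 1)) := by
  simp [round, size, size_measure, size_cond, size_onLast, useKey, swap, assoc, assoc']

/-- The message is measured, written into slot `j`, and its first bit decides whether a key is
produced. The result is a mixture over messages of product states of quantum memory and record. -/
theorem sem_round (q : QCirc (msk + fn) sk) (R : Round w fn (sk + tg)) (j : ℕ) (τ : Bits tg)
    (key : Bits tg → Bits fn → Op sk) (ρ : Op w) (z : Bits nz) (h : Bits (N * (1 + fn)))
    (x : Bits (inp + inp)) (hkey : ∀ f, key τ f = q.sem (ket (Fin.append (mf τ z) f))) :
    (S.round q R j τ).sem (state ρ z h x) =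
      ∑ y, state (answer key (R, τ) ρ y) z (setSlot h j y) x := by
  rw [round, sem_comp, state, sem_extend_tensor, sem_comp, sem_measure, sem_sum]
  refine Finset.sum_congr rfl fun y _ => ?_
  rw [S.push_eval, sem_cond, answer]
  by_cases hy : y.left 0 = false
  · rw [if_neg (by rw [hy]; decide), sem_onLast_tensor_ket, S.drop_eval, if_pos hy]
    rfl
  · rw [if_pos (Bool.eq_true_of_not_eq_false hy), if_neg hy, sem_comp, ket_append,
      sem_assoc'_tensor, sem_comp, sem_extend_tensor, sem_comp, sem_swap_tensor, sem_comp,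
      sem_extend_tensor, sem_swap_tensor, sem_useKey, hkey]
    rfl

/-- The rounds of a list, the first of which has the number `j`. -/
def rounds (q : QCirc (msk + fn) sk) : List (Round w fn (sk + tg) × Bits tg) → ℕ →
    QCirc (w + memLen nz N fn inp) (w + memLen nz N fn inp)
  | [], _ => wire (Equiv.refl _)
  | R :: L, j => (S.round q R.1 j R.2).comp (rounds q L (j + 1))

open Classical in
-- The simulation never stops early: a forbidden query is answered and recorded like any other, and
-- the verdict comes at the end through `V`. This agrees with an experiment that stops at once,
-- because a list with a forbidden part stays forbidden (`hal`).
theorem value_rounds (q : QCirc (msk + fn) sk) (key : Bits tg → Bits fn → Op sk)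
    (z : Bits nz) (x : Bits (inp + inp)) (al : List (Bits fn) → Prop)
    (hal : ∀ f Q, al (f :: Q) → al Q) (k : List (Bits fn) → Op w → ℝ)
    (V : Op (w + memLen nz N fn inp) → ℝ) (hVlin : IsLin V)
    (L : List (Round w fn (sk + tg) × Bits tg)) (j : ℕ) (hN : j + L.length ≤ N)
    (hkey : ∀ τ ∈ L.map Prod.snd, ∀ f, key τ f = q.sem (ket (Fin.append (mf τ z) f)))
    (hV : ∀ h Q ρ, Records (j + L.length) h Q → V (state ρ z h x) = if al Q then k Q ρ else 0)
    (h : Bits (N * (1 + fn))) (Q : List (Bits fn)) (ρ : Op w) (H : Records j h Q) :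
    V ((S.rounds q L j).sem (state ρ z h x)) = if al Q then tagged key al k L Q ρ else 0 := by
  induction L generalizing j h Q ρ with
  | nil =>
    refine Eq.trans ?_ (hV h Q ρ H)
    rfl
  | cons R L ih =>
    rw [List.length_cons] at hN hV
    rw [rounds, sem_comp, S.sem_round q R.1 j R.2 key ρ z h x (hkey R.2 (by simp)), sem_sum,
      hVlin.map_sum]
    have h1 : ∀ y, V ((S.rounds q L (j + 1)).sem (state (answer key R ρ y) z (setSlot h j y) x)) =
        if al (record y Q) then tagged key al k L (record y Q) (answer key R ρ y) else 0 :=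
      fun y => ih (j + 1) (by omega) (fun τ hτ => hkey τ (by simp_all))
        (by rwa [show j + 1 + L.length = j + (L.length + 1) by omega]) _ _ _ (H.set (by omega) y)
    simp only [Prod.mk.eta, h1, tagged]
    by_cases ha : al Q
    · rw [if_pos ha]
      refine Finset.sum_congr rfl fun y _ => if_congr ?_ rfl rfl
      unfold record
      split_ifs with hy <;> simp [hy, ha]
    · rw [if_neg ha]
      refine Finset.sum_eq_zero fun y _ => if_neg ?_
      unfold record
      split_ifs with hy
      · exact ha
      · exact fun h => ha (hal _ _ h)

/-- The challenge. -/
def challengeQ (A : QCirc w (w + (inp + inp))) :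
    QCirc (w + memLen nz N fn inp) (w + memLen nz N fn inp + (inp + inp)) :=
  (A.extend _).comp ((measure w (inp + inp) _ S.chal).comp (assoc' w _ _))

theorem sem_challengeQ (A : QCirc w (w + (inp + inp))) (ρ : Op w) (z : Bits nz)
    (h : Bits (N * (1 + fn))) (x' : Bits (inp + inp)) :
    (S.challengeQ A).sem (state ρ z h x') =
      ∑ x, tensor (state (outcome (A.sem ρ) x) z h x) (ket x) := by
  rw [challengeQ, sem_comp, state, sem_extend_tensor, sem_comp, sem_measure, sem_sum]
  refine Finset.sum_congr rfl fun x _ => ?_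
  rw [S.chal_eval, ket_append, sem_assoc'_tensor]
  rfl

/-- The receipt of the ciphertext. -/
def receiveQ (A : QCirc (w + ct) w) :
    QCirc (w + memLen nz N fn inp + ny) (w + memLen nz N fn inp) :=
  (assoc w _ ny).comp ((onLast w S.recv).comp ((assoc' w ct _).comp (A.extend _)))

theorem sem_receiveQ (A : QCirc (w + ct) w) (ρ : Op w) (z : Bits nz)
    (h : Bits (N * (1 + fn))) (x : Bits (inp + inp)) (y : Bits ny) :
    (S.receiveQ A).sem (tensor (state ρ z h x) (ket y)) =
      state (A.sem (tensor ρ (ket (cf (z, x, y))))) z h x := by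
  rw [receiveQ, sem_comp, state, sem_assoc_tensor, ← ket_append, sem_comp, sem_onLast_tensor_ket,
    S.recv_eval, ket_append, sem_comp, sem_assoc'_tensor, sem_extend_tensor]
  rfl

/-- The final guess. -/
def guessQ (A : QCirc w 1) : QCirc (w + memLen nz N fn inp) 1 :=
  (A.extend _).comp (classical S.guess)

/-- The guess circuit measures everything, but the classical memory has a certain outcome; only the
adversary's own bit is random, and it is overruled if the record is not admissible. -/
theorem accept_guessQ (A : QCirc w 1) (ρ : Op w) (z : Bits nz) (h : Bits (N * (1 + fn)))
    (x : Bits (inp + inp)) : accept ((S.guessQ A).sem (state ρ z h x)) =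
      if admissible app h x then accept (A.sem ρ) else 0 := by
  rw [guessQ, sem_comp, state, sem_extend_tensor]
  generalize A.sem ρ = σ
  have h1 : (classical S.guess).sem (tensor σ (ket (enc ((z, h, x) : Mem nz N fn inp)))) =
      ∑ b : Bits 1, σ b b • ket (fun _ : Fin 1 => b 0 && admissible app h x) := by
    simp only [sem]
    rw [sum_bits_add]
    refine Finset.sum_congr rfl fun b _ => ?_
    have h2 : ∀ c, tensor σ (ket (enc ((z, h, x) : Mem nz N fn inp))) (Fin.append b c)
        (Fin.append b c) = σ b b * if c = enc ((z, h, x) : Mem nz N fn inp) then 1 else 0 := by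
      intro c
      refine (tensor_append _ _ _ _ _ _).trans ?_
      simp only [ket_apply, and_self]
    refine (Finset.sum_congr rfl fun c _ => congrArg (· • ket _) (h2 c)).trans ?_
    refine (Fintype.sum_eq_single (enc ((z, h, x) : Mem nz N fn inp)) fun c hc => ?_).trans ?_
    · simp only [if_neg hc, mul_zero, zero_smul]
    · simp only [if_true, mul_one, S.guess_eval]
  rw [h1, sum_bits_one]
  have e1 : (fun _ => true : Bits 1) = ![true] := by funext i; fin_cases i; rfl
  cases admissible app h x <;> simp [accept, ket_apply, e1, funext_iff]

end SimCircuits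

open Enc

/-- Number of gates and rounds of a list of rounds. -/
def roundsCost {w fn sk : ℕ} (L : List (Round w fn sk)) : ℕ :=
  (L.map fun R => R.ask.size + R.receive.size + 1).sum

theorem length_le_roundsCost {w fn sk : ℕ} (L : List (Round w fn sk)) :
    L.length ≤ roundsCost L := by
  induction L with
  | nil => simp [roundsCost]
  | cons R L ih => simp only [roundsCost, List.map_cons, List.sum_cons, List.length_cons] at ih ⊢
                   omega

/-- Bound for the number of gates that a simulation adds to those of the adversary, where `q` is
the number of gates of the key generation. -/
def simCost (nz fn inp pk ct msk tg ny N s q : ℕ) : ℕ :=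
  Circuit.cost nz (memLen nz N fn inp + pk) s +
  Circuit.cost ((inp + inp) + memLen nz N fn inp) (memLen nz N fn inp + (inp + inp)) s +
  Circuit.cost (memLen nz N fn inp + ny) (ct + memLen nz N fn inp) s +
  Circuit.cost (1 + memLen nz N fn inp) 1 s +
  N * (q + Circuit.cost ((1 + fn) + memLen nz N fn inp)
      (1 + ((msk + fn) + (tg + memLen nz N fn inp))) s +
    Circuit.cost ((msk + fn) + (tg + memLen nz N fn inp)) (memLen nz N fn inp) s +
    Circuit.cost (memLen nz N fn inp) (memLen nz N fn inp + (1 + fn)) s +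
    Circuit.cost ((1 + fn) + memLen nz N fn inp) (memLen nz N fn inp + (1 + fn)) s +
    Circuit.cost (memLen nz N fn inp) (tg + memLen nz N fn inp) s)

namespace SimCircuits

variable {nz fn inp pk ct msk tg ny out N s w sk anc : ℕ} {Pf : Bits nz → Bits pk}
  {mf : Bits tg → Bits nz → Bits msk}
  {app : Bits fn → Bits inp → Bits out}

open QCirc

section

variable {cf : Bits nz × Bits (inp + inp) × Bits ny → Bits ct} (S : SimCircuits N s Pf mf cf app)

theorem size_rounds_le (q : QCirc (msk + fn) sk) (L : List (Round w fn (sk + tg) × Bits tg))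
    (j : ℕ) : (S.rounds q L j).size ≤ roundsCost (L.map Prod.fst) + L.length *
      (q.size + Circuit.cost ((1 + fn) + memLen nz N fn inp)
        (1 + ((msk + fn) + (tg + memLen nz N fn inp))) s +
      Circuit.cost ((msk + fn) + (tg + memLen nz N fn inp)) (memLen nz N fn inp) s) := by
  induction L generalizing j with
  | nil => simp [rounds, size]
  | cons R L ih =>
    have h := ih (j + 1)
    simp only [rounds, size, size_round, roundsCost, List.map_cons, List.sum_cons,
      List.length_cons, add_mul, one_mul] at h ⊢
    omega

open Classical in
/-- The second phase of the simulation. -/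
theorem accept_post (q : QCirc (msk + fn) sk) (key : Bits tg → Bits fn → Op sk)
    (A : Adversary pk fn inp (sk + tg) ct) (Lq : List (Round A.w fn (sk + tg) × Bits tg)) (j : ℕ)
    (hN : j + Lq.length ≤ N) (z : Bits nz) (x : Bits (inp + inp))
    (hkey : ∀ τ ∈ Lq.map Prod.snd, ∀ f, key τ f = q.sem (ket (Fin.append (mf τ z) f)))
    (h : Bits (N * (1 + fn))) (Q : List (Bits fn)) (ρ : Op A.w) (y : Bits ny) (H : Records j h Q) :
    accept ((S.guessQ A.guess).sem ((S.rounds q Lq j).sem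
      ((S.receiveQ A.receive).sem (tensor (state ρ z h x) (ket y))))) =
      if Admissible app x Q then postValue key app A Lq x (cf (z, x, y)) Q ρ else 0 := by
  rw [sem_receiveQ]
  refine S.value_rounds q key z x (Admissible app x)
    (fun f Q h g hg => h g (List.mem_cons_of_mem _ hg)) (fun _ ρ => accept (A.guess.sem ρ))
    (fun ρ => accept ((S.guessQ A.guess).sem ρ)) (IsLin.accept.sem _) Lq j hN hkey
    (fun h Q ρ H => ?_) h Q _ H
  rw [accept_guessQ]
  exact if_congr (H.admissible_iff app x) rfl rfl

end

section

variable {cf : Bits nz × Bits (inp + inp) × Bits 0 → Bits ct} (S : SimCircuits N s Pf mf cf app)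

/-- The circuit that forgets a string. -/
def erase (n : ℕ) : Circuit n 0 0 := fun _ => false

/-- A simulation of the game. -/
def gameQ (q : QCirc (msk + fn) sk) (A : Adversary pk fn inp (sk + tg) ct)
    (Lp Lq : List (Round A.w fn (sk + tg) × Bits tg)) : QCirc (nz + A.anc) 1 :=
  (S.startQ A.start).comp ((S.rounds q Lp 0).comp ((S.challengeQ A.challenge).comp
    ((onLast _ (erase (inp + inp))).comp ((S.receiveQ A.receive).comp
      ((S.rounds q Lq Lp.length).comp (S.guessQ A.guess))))))

theorem size_gameQ_le (q : QCirc (msk + fn) sk) (A : Adversary pk fn inp (sk + tg) ct)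
    (Lp Lq : List (Round A.w fn (sk + tg) × Bits tg)) (hp : Lp.map Prod.fst = A.pre)
    (hq : Lq.map Prod.fst = A.post) (hN : A.cost ≤ N) :
    (S.gameQ q A Lp Lq).size ≤ A.cost + simCost nz fn inp pk ct msk tg 0 N s q.size := by
  have h1 := S.size_rounds_le q Lp 0
  have h2 := S.size_rounds_le q Lq Lp.length
  have h3 : Lp.length + Lq.length ≤ N := by
    have h3 := length_le_roundsCost A.pre
    have h4 := length_le_roundsCost A.post
    rw [← hp, List.length_map] at h3
    rw [← hq, List.length_map] at h4
    refine le_trans ?_ hN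
    unfold Adversary.cost
    rw [← hp, ← hq]
    unfold roundsCost at h3 h4
    omega
  have h4 := Nat.mul_le_mul_right (q.size + Circuit.cost ((1 + fn) + memLen nz N fn inp)
        (1 + ((msk + fn) + (tg + memLen nz N fn inp))) s +
      Circuit.cost ((msk + fn) + (tg + memLen nz N fn inp)) (memLen nz N fn inp) s) h3
  rw [hp] at h1
  rw [hq] at h2
  unfold roundsCost at h1 h2
  have h5 : Circuit.cost (inp + inp) 0 0 = 0 := by simp [Circuit.cost]
  simp only [gameQ, size, startQ, challengeQ, receiveQ, guessQ, size_measure, size_onLast, swap,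
    assoc, assoc', simCost, Adversary.cost, mul_add, add_mul, h5] at *
  omega

/-- Both phases are instances of `value_rounds`: before the challenge every list of queries is
allowed, afterwards the admissible ones. The ciphertext needs no external bits, so the register with
the challenge plaintexts is erased after they have been copied to the classical memory. -/
theorem accept_gameQ (q : QCirc (msk + fn) sk) (key : Bits tg → Bits fn → Op sk)
    (A : Adversary pk fn inp (sk + tg) ct) (Lp Lq : List (Round A.w fn (sk + tg) × Bits tg))
    (hN : Lp.length + Lq.length ≤ N) (z : Bits nz)
    (hkey : ∀ τ ∈ (Lp ++ Lq).map Prod.snd, ∀ f,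
      key τ f = q.sem (ket (Fin.append (mf τ z) f))) :
    accept ((S.gameQ q A Lp Lq).sem (tensor (ket z) A.advice)) =
      game key app A Lp Lq (Pf z) fun x => cf (z, x, ![]) := by
  classical
  rw [gameQ, sem_comp, sem_startQ, sem_comp]
  have hV : IsLin fun ρ => accept (((S.challengeQ A.challenge).comp
    ((onLast _ (erase (inp + inp))).comp ((S.receiveQ A.receive).comp
      ((S.rounds q Lq Lp.length).comp (S.guessQ A.guess))))).sem ρ) := IsLin.accept.sem _
  refine (S.value_rounds q key z (fun _ => false) (fun _ => True) (fun _ _ h => h)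
    (challengeValue key app A Lq fun x => cf (z, x, ![])) _ hV Lp 0 (by omega)
    (fun τ hτ => hkey τ (by simp_all)) (fun h Q ρ H => ?_) _ [] _ .init).trans (if_pos trivial)
  rw [if_pos trivial, sem_comp, sem_challengeQ, (IsLin.accept.sem _).map_sum, challengeValue]
  refine Finset.sum_congr rfl fun x _ => ?_
  rw [Nat.zero_add] at H
  rw [sem_comp, sem_onLast_tensor_ket, sem_comp, sem_comp]
  have e : (erase (inp + inp)).eval x = ![] := Subsingleton.elim _ _
  rw [e]
  exact S.accept_post q key A Lq Lp.length hN z x (fun τ hτ => hkey τ (by simp_all)) h Q _ ![] H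

end

end SimCircuits

/-! ### Adversaries that start with the challenge -/

section FromChallenge

variable {pk fn inp sk tg ct out : ℕ}

/-- The circuit without inputs that returns `x`. -/
def constCircuit {n : ℕ} (x : Bits n) : Circuit 0 n 1 :=
  Circuit.ofCells fun i _ => Sum.elim (fun _ => false) x i

theorem eval_constCircuit {n : ℕ} (x : Bits n) (e : Bits 0) : (constCircuit x).eval e = x := by
  funext o
  simp only [constCircuit, Circuit.eval, Circuit.nand, Circuit.cell_ofCells, Circuit.wires]
  -- The only inner gate reads nothing and is `false`; an output that reads it is true, an output
  -- that reads nothing is false.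
  cases h : x o <;> simp [h]

/-- The adversary in the state `ρ` with the challenge plaintexts `x`. -/
def fromChallenge (A : Adversary pk fn inp sk ct) (x : Bits (inp + inp)) (ρ : Op A.w)
    (hρ : IsState ρ) : Adversary pk fn inp sk ct where
  w := A.w
  anc := A.w
  advice := ρ
  advice_isState := hρ
  start := (QCirc.swap pk A.w).comp (QCirc.onLast A.w (SimCircuits.erase pk))
  pre := []
  challenge := QCirc.onLast A.w (constCircuit x)
  receive := A.receive
  post := A.post
  guess := A.guess

theorem cost_fromChallenge_le (A : Adversary pk fn inp sk ct) (x : Bits (inp + inp)) (ρ : Op A.w)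
    (hρ : IsState ρ) :
    (fromChallenge A x ρ hρ).cost ≤ 2 * A.cost + Circuit.cost 0 (inp + inp) 1 := by
  have h : Circuit.cost pk 0 0 = 0 := by simp [Circuit.cost]
  simp only [fromChallenge, Adversary.cost, QCirc.size, QCirc.size_onLast, QCirc.swap, h,
    List.map_nil, List.sum_nil]
  omega

open Classical in
-- As long as the past queries are admissible, the admissibility of a further query depends on that
-- query alone, so the past may be forgotten. This is why an adversary that starts at the challenge
-- can begin with an empty list.
theorem tagged_admissible {w : ℕ} (key : Bits tg → Bits fn → Op sk)
    (app : Bits fn → Bits inp → Bits out) (x : Bits (inp + inp)) (k : Op w → ℝ)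
    (L : List (Round w fn (sk + tg) × Bits tg)) (Q Q' : List (Bits fn)) (ρ : Op w)
    (hQ : Admissible app x Q) (hQ' : Admissible app x Q') :
    tagged key (Admissible app x) (fun _ => k) L Q ρ =
      tagged key (Admissible app x) (fun _ => k) L Q' ρ := by
  induction L generalizing Q Q' ρ with
  | nil => rfl
  | cons R L ih =>
    refine Finset.sum_congr rfl fun y _ => ?_
    have h : ∀ Q, Admissible app x Q → (Admissible app x (y.right :: Q) ↔
        app y.right x.left = app y.right x.right) := fun Q hQ => by
      simp only [Admissible, List.forall_mem_cons]
      exact and_iff_left hQ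
    by_cases hy : y.left 0 = false
    · rw [if_pos (.inl hy), if_pos (.inl hy)]
      exact ih _ _ _ (by rwa [record, if_pos hy]) (by rwa [record, if_pos hy])
    · by_cases ha : app y.right x.left = app y.right x.right
      · rw [if_pos (.inr ((h Q hQ).2 ha)), if_pos (.inr ((h Q' hQ').2 ha))]
        refine ih _ _ _ ?_ ?_
        · rw [record, if_neg hy]; exact (h Q hQ).2 ha
        · rw [record, if_neg hy]; exact (h Q' hQ').2 ha
      · rw [if_neg (not_or.2 ⟨hy, fun h' => ha ((h Q hQ).1 h')⟩),
          if_neg (not_or.2 ⟨hy, fun h' => ha ((h Q' hQ').1 h')⟩)]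

open QCirc in
-- The start erases the public key and keeps the advice, and the challenge message is the constant
-- `x`; hence a single term of the sum over challenges survives.
theorem game_fromChallenge (key : Bits tg → Bits fn → Op sk)
    (app : Bits fn → Bits inp → Bits out) (A : Adversary pk fn inp (sk + tg) ct)
    (x : Bits (inp + inp)) (ρ : Op A.w) (hρ : IsState ρ)
    (Lq : List (Round A.w fn (sk + tg) × Bits tg)) (P : Bits pk) (c : Bits (inp + inp) → Bits ct)
    (Q : List (Bits fn)) (hQ : Admissible app x Q) :
    game key app (fromChallenge A x ρ hρ) [] Lq P c = postValue key app A Lq x (c x) Q ρ := by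
  have hz : ∀ {n : ℕ} (σ : Op n) (v : Bits 0), tensor σ (ket v) = σ := by
    intro n σ v
    ext a b
    refine (tensor_apply _ _ _ _).trans ?_
    rw [ket_apply, if_pos ⟨Subsingleton.elim _ _, Subsingleton.elim _ _⟩, mul_one]
    rfl
  have h1 : (fromChallenge A x ρ hρ).start.sem (tensor (ket P) ρ) = ρ := by
    have := sem_onLast_tensor_ket (SimCircuits.erase pk) ρ P
    rw [← sem_swap_tensor, hz] at this
    exact this
  have h2 : (onLast A.w (constCircuit x)).sem ρ = tensor ρ (ket x) := by
    have := sem_onLast_tensor_ket (constCircuit x) ρ ![]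
    rwa [eval_constCircuit, hz] at this
  have h3 : challengeValue key app (fromChallenge A x ρ hρ) Lq c [] ρ =
      postValue key app A Lq x (c x) Q ρ := by
    classical
    refine (Fintype.sum_eq_single x fun y hy => ?_).trans ?_
    · split_ifs
      · have h4 : outcome ((fromChallenge A x ρ hρ).challenge.sem ρ) y = 0 :=
          (congrArg (fun σ => outcome σ y) h2).trans
            ((outcome_tensor_ket ρ x y).trans (if_neg hy))
        rw [h4]
        exact (isLin_postValue _ _ _).map_zero
      · rfl
    · rw [if_pos (by simp [Admissible])]
      have h4 : outcome ((fromChallenge A x ρ hρ).challenge.sem ρ) x = ρ :=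
        (congrArg (fun σ => outcome σ x) h2).trans
          ((outcome_tensor_ket ρ x x).trans (if_pos rfl))
      rw [h4]
      exact tagged_admissible key app x (fun ρ' => accept (A.guess.sem ρ')) Lq [] Q _
        (by simp [Admissible]) hQ
  refine Eq.trans ?_ h3
  exact congrArg (challengeValue key app (fromChallenge A x ρ hρ) Lq c []) h1

/-- It suffices to bound averages of the game for adversaries that start with the challenge. -/
theorem abs_game_le_of_fromChallenge {key : Bits tg → Bits fn → Op sk}
    {app : Bits fn → Bits inp → Bits out} {A : Adversary pk fn inp (sk + tg) ct}
    {Lp Lq : List (Round A.w fn (sk + tg) × Bits tg)} (hkey : ∀ τ f, IsState (key τ f))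
    {X : Type*} (Φ : (X → ℝ) →ₗ[ℝ] ℝ) (P : Bits pk) (c : X → Bits (inp + inp) → Bits ct) {ε : ℝ}
    (hε : 0 ≤ ε) (h : ∀ x ρ (hρ : IsState ρ),
      |Φ fun e => game key app (fromChallenge A x ρ hρ) [] Lq P (c e)| ≤ ε) :
    |Φ fun e => game key app A Lp Lq P (c e)| ≤ ε := by
  refine abs_game_le hkey Φ P c hε fun x Q ρ hQ hρ => ?_
  have ht := trace_re_nonneg hρ
  have htr : ρ.trace = (ρ.trace.re : ℂ) := by
    apply Complex.ext
    · simp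
    · simpa using ((Complex.le_def.1 hρ.trace_nonneg).2).symm
  -- Advice must be a normalized state. At trace zero all values vanish; otherwise `ρ` is divided by
  -- its trace, and homogeneity puts the factor back.
  rcases ht.eq_or_lt with h0 | h0
  · have : (fun e => postValue key app A Lq x (c e x) Q ρ) = 0 := by
      funext e
      have := abs_postValue_le hkey (A := A) (app := app) (Lq := Lq) x (c e x) Q hρ
      rw [← h0] at this
      exact abs_nonpos_iff.1 this
    rw [this, map_zero, abs_zero, ← h0, mul_zero]
  · set t := ρ.trace.re
    have hσ : IsState (((t⁻¹ : ℝ) : ℂ) • ρ) := by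
      refine ⟨hρ.smul (Complex.le_def.2 ⟨by simpa using ht, by simp⟩), ?_⟩
      rw [Matrix.trace_smul, htr, smul_eq_mul, ← Complex.ofReal_mul, inv_mul_cancel₀ h0.ne',
        Complex.ofReal_one]
    have e : (fun e => postValue key app A Lq x (c e x) Q ρ) =
        t • fun e => game key app (fromChallenge A x _ hσ) [] Lq P (c e) := by
      funext e
      rw [Pi.smul_apply, game_fromChallenge _ _ _ _ _ _ _ _ _ Q hQ, smul_eq_mul,
        ← (isLin_postValue _ _ _).smul, smul_smul, ← Complex.ofReal_mul, mul_inv_cancel₀ h0.ne',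
        Complex.ofReal_one, one_smul]
    rw [e, map_smul, smul_eq_mul, abs_mul, abs_of_pos h0, mul_comm]
    exact mul_le_mul_of_nonneg_right (h x _ hσ) h0.le

end FromChallenge

open Enc

/-! ### The reduction that forwards the queries for a single tag -/

open Classical in
theorem isLin_untagged {w fn sk : ℕ} {qkg : Bits fn → Op sk} {al : List (Bits fn) → Prop}
    {k : List (Bits fn) → Op w → ℝ} (hk : ∀ Q, IsLin (k Q)) (L : List (Round w fn sk))
    (Q : List (Bits fn)) : IsLin (untagged qkg al k L Q) := by
  induction L generalizing Q with
  | nil => exact hk Q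
  | cons R L ih =>
    exact .sum fun y => .ite (((ih _).outcome y).sem R.ask)
      (.ite (((((ih _).sem R.receive).tensor _).outcome y).sem R.ask) .zero)

open Classical in
-- Moves the test of the list from before each query to after it, as in `value_rounds`: from a
-- forbidden list only forbidden lists arise.
theorem sum_record {w fn sk tg : ℕ} (key : Bits tg → Bits fn → Op sk) (al : List (Bits fn) → Prop)
    (hal : ∀ f Q, al (f :: Q) → al Q) (k : List (Bits fn) → Op w → ℝ)
    (R : Round w fn (sk + tg) × Bits tg) (L : List (Round w fn (sk + tg) × Bits tg))
    (Q : List (Bits fn)) (ρ : Op w) :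
    (∑ y, if al (record y Q) then tagged key al k L (record y Q) (answer key R ρ y) else 0) =
      if al Q then tagged key al k (R :: L) Q ρ else 0 := by
  by_cases ha : al Q
  · rw [if_pos ha]
    refine Finset.sum_congr rfl fun y _ => if_congr ?_ rfl rfl
    unfold record
    split_ifs with hy <;> simp [hy, ha]
  · rw [if_neg ha]
    refine Finset.sum_eq_zero fun y _ => if_neg ?_
    unfold record
    split_ifs with hy
    · exact ha
    · exact fun h => ha (hal _ _ h)

namespace SimCircuits

variable {nz fn inp pk ct msk tg ny out N s w sk anc : ℕ} {Pf : Bits nz → Bits pk}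
  {mf : Bits tg → Bits nz → Bits msk}
  {app : Bits fn → Bits inp → Bits out} {cf : Bits nz × Bits (inp + inp) × Bits ny → Bits ct}
  (S : SimCircuits N s Pf mf cf app)

open QCirc

/-- A round in which the key is queried. -/
def externalRound (R : Round w fn (sk + tg)) (j : ℕ) (τ : Bits tg) :
    Round (w + memLen nz N fn inp) fn sk where
  ask := (R.ask.extend _).comp ((measure w (1 + fn) _ (S.ext j)).comp (assoc' w _ (1 + fn)))
  receive := (swap _ sk).comp ((assoc' sk w _).comp (((swap sk w).extend _).comp
    ((onLast (w + sk) (S.addTag τ)).comp (useKey R _))))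

/-- A round without query. -/
def internalRound (q : QCirc (msk + fn) sk) (R : Round w fn (sk + tg)) (j : ℕ) (τ : Bits tg) :
    Round (w + memLen nz N fn inp) fn sk where
  ask := (S.round q R j τ).comp ((onLast w S.zero).comp (assoc' w _ (1 + fn)))
  receive := onLast _ (erase sk)

/-- The rounds of an adversary that queries the keys for the tag `i` only; the first round has the
number `j`. -/
def outerRounds (q : QCirc (msk + fn) sk) (i : Bits tg) :
    List (Round w fn (sk + tg) × Bits tg) → ℕ → List (Round (w + memLen nz N fn inp) fn sk)
  | [], _ => []
  | R :: L, j => (if R.2 = i then S.externalRound R.1 j i else S.internalRound q R.1 j R.2) ::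
      outerRounds q i L (j + 1)

theorem sem_externalRound_ask (R : Round w fn (sk + tg)) (j : ℕ) (τ : Bits tg) (ρ : Op w)
    (z : Bits nz) (h : Bits (N * (1 + fn))) (x : Bits (inp + inp)) (y : Bits (1 + fn)) :
    outcome ((S.externalRound R j τ).ask.sem (state ρ z h x)) y =
      state (outcome (R.ask.sem ρ) y) z (setSlot h j y) x := by
  have h1 : (S.externalRound R j τ).ask.sem (state ρ z h x) =
      ∑ y, tensor (state (outcome (R.ask.sem ρ) y) z (setSlot h j y) x) (ket y) := by
    rw [externalRound, sem_comp, state, sem_extend_tensor, sem_comp, sem_measure, sem_sum]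
    refine Finset.sum_congr rfl fun y _ => ?_
    rw [S.ext_eval, ket_append, sem_assoc'_tensor]
    rfl
  rw [h1, outcome_sum]
  refine (Fintype.sum_eq_single y fun y' hy => ?_).trans ?_
  · rw [outcome_tensor_ket, if_neg hy.symm]
  · rw [outcome_tensor_ket, if_pos rfl]

theorem sem_externalRound_receive (R : Round w fn (sk + tg)) (j : ℕ) (τ : Bits tg) (ρ : Op w)
    (z : Bits nz) (h : Bits (N * (1 + fn))) (x : Bits (inp + inp)) (σ : Op sk) :
    (S.externalRound R j τ).receive.sem (tensor (state ρ z h x) σ) =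
      state (R.receive.sem (tensor ρ (tensor σ (ket τ)))) z h x := by
  simp only [externalRound, sem_comp, state, sem_swap_tensor, sem_assoc'_tensor, sem_extend_tensor,
    sem_onLast_tensor_ket, S.addTag_eval, sem_useKey]

theorem sem_internalRound_ask (q : QCirc (msk + fn) sk) (R : Round w fn (sk + tg)) (j : ℕ)
    (τ : Bits tg) (key : Bits tg → Bits fn → Op sk) (ρ : Op w) (z : Bits nz)
    (h : Bits (N * (1 + fn))) (x : Bits (inp + inp)) (y : Bits (1 + fn))
    (hkey : ∀ f, key τ f = q.sem (ket (Fin.append (mf τ z) f))) :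
    outcome ((S.internalRound q R j τ).ask.sem (state ρ z h x)) y =
      if y = fun _ => false then ∑ y, state (answer key (R, τ) ρ y) z (setSlot h j y) x else 0 := by
  have h1 : (S.internalRound q R j τ).ask.sem (state ρ z h x) =
      tensor (∑ y, state (answer key (R, τ) ρ y) z (setSlot h j y) x) (ket fun _ => false) := by
    rw [internalRound, sem_comp, S.sem_round q R j τ key ρ z h x hkey, sem_sum, tensor_sum_left]
    refine Finset.sum_congr rfl fun y _ => ?_
    rw [sem_comp, state, sem_onLast_tensor_ket, S.zero_eval, ket_append, sem_assoc'_tensor]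
  rw [h1, outcome_tensor_ket]

open Classical in
-- `Q` lists all queries of the simulated adversary, `Q'` those passed on to the external oracle.
-- The quantity in `hc` is a budget: queries already forwarded, occurrences of `i` still to come in
-- this phase, and `c` occurrences reserved for a later phase. It stays at most one, so the outer
-- experiment never stops unless the simulated one does (`hal'`).
theorem untagged_outerRounds (q : QCirc (msk + fn) sk) (key : Bits tg → Bits fn → Op sk)
    (i : Bits tg) (z : Bits nz) (x : Bits (inp + inp)) (al al' : List (Bits fn) → Prop)
    (hal : ∀ f Q, al (f :: Q) → al Q)
    (hal' : ∀ Q Q', al Q → Q' ⊆ Q → Q'.length ≤ 1 → al' Q') (k : List (Bits fn) → Op w → ℝ)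
    (V : List (Bits fn) → Op (w + memLen nz N fn inp) → ℝ) (hVlin : ∀ Q, IsLin (V Q)) (c : ℕ)
    (L : List (Round w fn (sk + tg) × Bits tg)) (j : ℕ) (hN : j + L.length ≤ N)
    (hkey : ∀ τ ∈ L.map Prod.snd, τ ≠ i → ∀ f, key τ f = q.sem (ket (Fin.append (mf τ z) f)))
    (hV : ∀ h Q Q' ρ, Records (j + L.length) h Q → Q' ⊆ Q → Q'.length + c ≤ 1 →
      V Q' (state ρ z h x) = if al Q then k Q ρ else 0)
    (h : Bits (N * (1 + fn))) (Q Q' : List (Bits fn)) (ρ : Op w) (H : Records j h Q) (hQ : Q' ⊆ Q)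
    (hc : Q'.length + (L.map Prod.snd).count i + c ≤ 1) :
    untagged (key i) al' V (S.outerRounds q i L j) Q' (state ρ z h x) =
      if al Q then tagged key al k L Q ρ else 0 := by
  induction L generalizing j h Q Q' ρ with
  | nil => exact hV h Q Q' ρ H hQ (by simpa using hc)
  | cons R L ih =>
    rw [List.length_cons] at hN hV
    rw [List.map_cons, List.count_cons] at hc
    have h1 : ∀ Q' y, Q' ⊆ record y Q → Q'.length + (L.map Prod.snd).count i + c ≤ 1 →
        untagged (key i) al' V (S.outerRounds q i L (j + 1)) Q'
          (state (answer key R ρ y) z (setSlot h j y) x) =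
        if al (record y Q) then tagged key al k L (record y Q) (answer key R ρ y) else 0 :=
      fun Q' y hQ hc => ih (j + 1) (by omega) (fun τ hτ => hkey τ (by simp_all))
        (by rwa [show j + 1 + L.length = j + (L.length + 1) by omega]) _ _ _ _
        (H.set (by omega) y) hQ hc
    have hlin := fun Q => isLin_untagged (qkg := key i) (al := al') hVlin
      (S.outerRounds q i L (j + 1)) Q
    rw [← sum_record key al hal]
    by_cases hi : R.2 = i
    · rw [if_pos (by simp [hi])] at hc
      rw [outerRounds, if_pos hi, untagged]
      refine Finset.sum_congr rfl fun y _ => ?_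
      rw [sem_externalRound_ask]
      by_cases hy : y.left 0 = false
      · have h2 := h1 Q' y (by rwa [record, if_pos hy]) (by omega)
        rw [answer, if_pos hy] at h2 ⊢
        rw [if_pos hy, h2]
      · have h2 := h1 (y.right :: Q') y
          (by rw [record, if_neg hy]; exact List.cons_subset_cons _ hQ)
          (by rw [List.length_cons]; omega)
        rw [if_neg hy, sem_externalRound_receive]
        rw [answer, if_neg hy, hi] at h2 ⊢
        -- If the outer list is forbidden but the inner one allowed, `hal'` is contradicted; if only
        -- the inner one is forbidden, the final verdict of the simulation gives zero.
        split_ifs with ha ha'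
        · rw [h2, if_pos ‹_›]
        · rw [h2, if_neg ‹_›]
        · refine absurd (hal' _ (y.right :: Q') ‹_› ?_ ?_) ha
          · rw [record, if_neg hy]; exact List.cons_subset_cons _ hQ
          · rw [List.length_cons]; omega
        · rfl
    · rw [if_neg (by simpa using hi)] at hc
      rw [outerRounds, if_neg hi, untagged]
      -- In a round with another tag the outward message is the all-false string, which signals that
      -- there is no query; the real message stays inside the simulation.
      refine (Fintype.sum_eq_single (fun _ => false) fun y hy => ?_).trans ?_
      · rw [S.sem_internalRound_ask q R.1 j R.2 key ρ z h x y (hkey _ (by simp) hi), if_neg hy,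
          tensor_zero_left, sem_zero, (hlin _).map_zero, (hlin _).map_zero, ite_self, ite_self]
      · refine (if_pos rfl).trans ?_
        rw [S.sem_internalRound_ask q R.1 j R.2 key ρ z h x _ (hkey _ (by simp) hi),
          if_pos rfl, (hlin _).map_sum]
        refine Finset.sum_congr rfl fun y _ => h1 Q' y ?_ (by omega)
        unfold record
        split_ifs
        · exact hQ
        · exact List.subset_cons_of_subset _ hQ

/-- The adversary that plays the game, queries the keys for the tag `i` only, and sends the
challenge plaintexts of the game. -/
def outer (q : QCirc (msk + fn) sk) (i : Bits tg) (A : Adversary pk fn inp (sk + tg) ct)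
    (Lp Lq : List (Round A.w fn (sk + tg) × Bits tg)) : Adversary nz fn inp sk ny where
  w := A.w + memLen nz N fn inp
  anc := A.anc
  advice := A.advice
  advice_isState := A.advice_isState
  start := S.startQ A.start
  pre := S.outerRounds q i Lp 0
  challenge := S.challengeQ A.challenge
  receive := S.receiveQ A.receive
  post := S.outerRounds q i Lq Lp.length
  guess := S.guessQ A.guess

open Classical in
-- The left side has the form of the single-key experiment after its setup, with the key for `i`
-- supplied from outside and the external ciphertext `y x e` as part of what `cf` uses. Only the
-- keys at the other tags have to be computable from `z`.
theorem untagged_outer (q : QCirc (msk + fn) sk) (i : Bits tg)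
    (A : Adversary pk fn inp (sk + tg) ct) (Lp Lq : List (Round A.w fn (sk + tg) × Bits tg))
    (hN : Lp.length + Lq.length ≤ N) (key : Bits tg → Bits fn → Op sk) (z : Bits nz)
    (hkey : ∀ τ ∈ (Lp ++ Lq).map Prod.snd, τ ≠ i → ∀ f,
      key τ f = q.sem (ket (Fin.append (mf τ z) f)))
    (hi : ((Lp ++ Lq).map Prod.snd).count i ≤ 1) {ne : ℕ}
    (y : Bits (inp + inp) → Bits ne → Bits ny) :
    untagged (key i) (fun Q => (Q.length : ℕ∞) ≤ 1) (fun Q ρ => ∑ x : Bits (inp + inp),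
      if Admissible app x Q then expect fun e =>
        untagged (key i) (fun Q' => (Q'.length : ℕ∞) ≤ 1 ∧ Admissible app x Q')
          (fun _ ρ' => accept ((S.outer q i A Lp Lq).guess.sem ρ')) (S.outer q i A Lp Lq).post Q
          ((S.outer q i A Lp Lq).receive.sem (tensor
            (outcome ((S.outer q i A Lp Lq).challenge.sem ρ) x) (ket (y x e)))) else 0)
      (S.outer q i A Lp Lq).pre []
      ((S.outer q i A Lp Lq).start.sem (tensor (ket z) (S.outer q i A Lp Lq).advice)) =
    expect fun e => game key app A Lp Lq (Pf z) fun x => cf (z, x, y x e) := by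
  simp only [outer]
  rw [sem_startQ]
  rw [List.map_append, List.count_append] at hi
  have hlin : ∀ Q, IsLin fun ρ => ∑ x : Bits (inp + inp), if Admissible app x Q then
      expect fun e => untagged (key i) (fun Q' => (Q'.length : ℕ∞) ≤ 1 ∧ Admissible app x Q')
        (fun _ ρ' => accept ((S.guessQ A.guess).sem ρ')) (S.outerRounds q i Lq Lp.length) Q
        ((S.receiveQ A.receive).sem (tensor (outcome ((S.challengeQ A.challenge).sem ρ) x)
          (ket (y x e)))) else 0 := fun Q =>
    .sum fun x => .ite (.expect fun e => .sem (.outcome (.tensor (.sem (isLin_untagged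
      (fun _ => IsLin.accept.sem _) _ _) _) _) _) _) .zero
  have h1 := S.untagged_outerRounds q key i z (fun _ => false) (fun _ => True)
    (fun Q => (Q.length : ℕ∞) ≤ 1) (fun _ _ h => h) (fun _ _ _ _ h => by exact_mod_cast h)
    (fun Q ρ => expect fun e => challengeValue key app A Lq (fun x => cf (z, x, y x e)) Q ρ) _ hlin
    -- The occurrences of `i` in the second phase are reserved in the budget of the first one, so
    -- that `hi` bounds the forwarded queries of both phases together.
    ((Lq.map Prod.snd).count i) Lp 0 (by omega) (fun τ hτ => hkey τ (by simp_all)) ?_ _ [] [] 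
    (A.start.sem (tensor (ket (Pf z)) A.advice)) .init (by simp) (by simpa using hi)
  · rw [h1, if_pos trivial]
    exact map_tagged (expectL ne) _ _ _ _
  · intro h Q Q' ρ H hQ hc
    rw [Nat.zero_add] at H
    rw [if_pos trivial]
    have e1 : (fun e => challengeValue key app A Lq (fun x => cf (z, x, y x e)) Q ρ) =
        ∑ x : Bits (inp + inp), fun e => if Admissible app x Q then
          postValue key app A Lq x (cf (z, x, y x e)) Q (outcome (A.challenge.sem ρ) x) else 0 := by
      funext e; simp [challengeValue]
    rw [e1, ← expectL_apply, map_sum]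
    refine Finset.sum_congr rfl fun x _ => ?_
    have e2 : outcome ((S.challengeQ A.challenge).sem (state ρ z h fun _ => false)) x =
        state (outcome (A.challenge.sem ρ) x) z h x := by
      rw [sem_challengeQ, outcome_sum]
      refine (Fintype.sum_eq_single x fun y' hy => ?_).trans ?_
      · rw [outcome_tensor_ket, if_neg hy.symm]
      · rw [outcome_tensor_ket, if_pos rfl]
    have e3 : ∀ e, untagged (key i) (fun Q' => (Q'.length : ℕ∞) ≤ 1 ∧ Admissible app x Q')
        (fun _ ρ' => accept ((S.guessQ A.guess).sem ρ')) (S.outerRounds q i Lq Lp.length) Q'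
        ((S.receiveQ A.receive).sem (tensor (state (outcome (A.challenge.sem ρ) x) z h x)
          (ket (y x e)))) = if Admissible app x Q then
          postValue key app A Lq x (cf (z, x, y x e)) Q (outcome (A.challenge.sem ρ) x) else 0 := by
      intro e
      rw [sem_receiveQ]
      refine S.untagged_outerRounds q key i z x (Admissible app x) _
        (fun f Q h g hg => h g (List.mem_cons_of_mem _ hg))
        (fun Q Q' h hs hl => ⟨by exact_mod_cast hl, fun f hf => h f (hs hf)⟩)
        (fun _ ρ => accept (A.guess.sem ρ)) _ (fun _ => IsLin.accept.sem _) 0 Lq Lp.length hN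
        (fun τ hτ => hkey τ (by simp_all)) (fun h Q Q' ρ H _ _ => ?_) h Q Q' _ H hQ (by omega)
      rw [accept_guessQ]
      exact if_congr (H.admissible_iff app x) rfl rfl
    rw [e2]
    simp only [e3]
    by_cases ha : Admissible app x Q
    · rw [if_pos (show Admissible app x Q' from fun f hf => ha f (hQ hf))]
      rfl
    · simp only [if_neg ha, expect_const, ite_self]
      exact (expect_const 0).symm

theorem roundsCost_outerRounds_le (q : QCirc (msk + fn) sk) (i : Bits tg)
    (L : List (Round w fn (sk + tg) × Bits tg)) (j : ℕ) :
    roundsCost (S.outerRounds q i L j) ≤ roundsCost (L.map Prod.fst) + L.length *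
      (q.size + Circuit.cost ((1 + fn) + memLen nz N fn inp)
        (1 + ((msk + fn) + (tg + memLen nz N fn inp))) s +
      Circuit.cost ((msk + fn) + (tg + memLen nz N fn inp)) (memLen nz N fn inp) s +
      Circuit.cost (memLen nz N fn inp) (memLen nz N fn inp + (1 + fn)) s +
      Circuit.cost ((1 + fn) + memLen nz N fn inp) (memLen nz N fn inp + (1 + fn)) s +
      Circuit.cost (memLen nz N fn inp) (tg + memLen nz N fn inp) s + 1) := by
  have h5 : Circuit.cost sk 0 0 = 0 := by simp [Circuit.cost]
  induction L generalizing j with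
  | nil => simp [outerRounds, roundsCost]
  | cons R L ih =>
    have h := ih (j + 1)
    rw [outerRounds]
    simp only [roundsCost, List.map_cons, List.sum_cons, List.length_cons, add_mul, one_mul] at h ⊢
    split_ifs
    · simp only [externalRound, size, size_measure, size_onLast, swap, assoc, assoc', useKey] at h ⊢
      omega
    · simp only [internalRound, size, size_round, size_onLast, assoc', h5] at h ⊢
      omega

theorem cost_outer_le (q : QCirc (msk + fn) sk) (i : Bits tg) (A : Adversary pk fn inp (sk + tg) ct)
    (Lp Lq : List (Round A.w fn (sk + tg) × Bits tg)) (hp : Lp.map Prod.fst = A.pre)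
    (hq : Lq.map Prod.fst = A.post) (hN : A.cost ≤ N) :
    (S.outer q i A Lp Lq).cost ≤ A.cost + memLen nz N fn inp + N +
      simCost nz fn inp pk ct msk tg ny N s q.size := by
  have h1 := S.roundsCost_outerRounds_le q i Lp 0
  have h2 := S.roundsCost_outerRounds_le q i Lq Lp.length
  have h3 : Lp.length + Lq.length ≤ N := by
    have h3 := length_le_roundsCost A.pre
    have h4 := length_le_roundsCost A.post
    rw [← hp, List.length_map] at h3
    rw [← hq, List.length_map] at h4
    refine le_trans ?_ hN
    unfold Adversary.cost
    rw [← hp, ← hq]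
    unfold roundsCost at h3 h4
    omega
  have h4 := Nat.mul_le_mul_right (q.size + Circuit.cost ((1 + fn) + memLen nz N fn inp)
        (1 + ((msk + fn) + (tg + memLen nz N fn inp))) s +
      Circuit.cost ((msk + fn) + (tg + memLen nz N fn inp)) (memLen nz N fn inp) s +
      Circuit.cost (memLen nz N fn inp) (memLen nz N fn inp + (1 + fn)) s +
      Circuit.cost ((1 + fn) + memLen nz N fn inp) (memLen nz N fn inp + (1 + fn)) s +
      Circuit.cost (memLen nz N fn inp) (tg + memLen nz N fn inp) s + 1) h3
  rw [hp] at h1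
  rw [hq] at h2
  unfold roundsCost at h1 h2
  simp only [outer, size, startQ, challengeQ, receiveQ, guessQ, size_measure, size_onLast, swap,
    assoc, assoc', simCost, Adversary.cost, mul_add, add_mul, mul_one] at *
  omega

end SimCircuits

open Enc

/-! ### Polynomial-size circuits for the simulations -/

section Families

variable {I : Type} {B : I → ℕ} {X : I → Type} [∀ i, Enc (X i)] {N fn inp out : I → ℕ}

theorem PolyC.exists_circuit_le {Y : I → Type} [∀ i, Enc (Y i)] {f : ∀ i, X i → Y i}
    (hf : PolyC B f) : ∃ p : Polynomial ℕ, ∀ i s, p.eval (B i) ≤ s →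
      ∃ C : Circuit (len (X i)) (len (Y i)) s, ∀ x, C.eval (enc x) = enc (f i x) := by
  obtain ⟨p, hp⟩ := hf.circ
  refine ⟨p, fun i s hs => ?_⟩
  obtain ⟨C, hC⟩ := hp i
  obtain ⟨C', hC'⟩ := C.exists_gates_of_le hs
  exact ⟨C', fun x => (hC' _).trans (hC x)⟩

/-- The slot number belongs to the index, so each bit of the result is a fixed bit of the old table
or of the new entry: a rewiring. -/
theorem PolyC.setSlot {m : I → ℕ} {h : ∀ i, X i → Bits (N i * m i)} {y : ∀ i, X i → Bits (m i)}
    (hh : PolyC B h) (hy : PolyC B y) (j : I → ℕ) :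
    PolyC B fun i x => setSlot (h i x) (j i) (y i x) := by
  have h1 := (hh.append hy).mapBits (n := fun i => N i * m i) hh.cod fun i k =>
    if ((finProdFinEquiv.symm k).1 : ℕ) = j i then Fin.natAdd _ (finProdFinEquiv.symm k).2
    else Fin.castAdd _ k
  convert h1 using 3 with i x
  funext k
  unfold KeyBundling.setSlot
  split_ifs
  · rw [Fin.append_right]
  · rw [Fin.append_left]

theorem PolyC.admissible {h : ∀ i, X i → Bits (N i * (1 + fn i))}
    {x : ∀ i, X i → Bits (inp i + inp i)} {app : ∀ i, Bits (fn i) → Bits (inp i) → Bits (out i)}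
    (happ : PolyC (X := fun i => Bits (fn i) × Bits (inp i)) (Y := fun i => Bits (out i)) B
      fun i p => app i p.1 p.2)
    (hh : PolyC B h) (hx : PolyC B x) (hN : PolyIn B N) :
    PolyC B fun i y => admissible (app i) (h i y) (x i y) := by
  have hfn : PolyIn B fn := happ.dom.mono fun i => Nat.le_add_right _ _
  have h1 : PolyC (fun j : Σ i, Fin (N i) => B j.1) (X := fun j => X j.1)
      (Y := fun j => Bits (1 + fn j.1)) fun j y => slot (h j.1 y) j.2 :=
    PolyC.mapBits (m := fun j : Σ i, Fin (N i) => N j.1 * (1 + fn j.1))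
      (n := fun j : Σ i, Fin (N i) => 1 + fn j.1) (f := fun j x => h j.1 x)
      (hh.reindex Sigma.fst) (((PolyIn.const 1).add hfn).reindex Sigma.fst)
      fun j b => finProdFinEquiv (j.2, b)
  have ha := fun g : ∀ j : Σ i, Fin (N i), X j.1 → Bits (inp j.1) =>
    fun hg : PolyC (fun j : Σ i, Fin (N i) => B j.1) g =>
      PolyC.comp (happ.reindex Sigma.fst) (h1.right.pair hg)
  have h2 := (h1.left.bit fun _ => (0 : Fin 1)).not.or
    ((ha _ (hx.reindex Sigma.fst).left).decEq (ha _ (hx.reindex Sigma.fst).right))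
  exact PolyC.all hh.dom hN h2

end Families

/-- Each component is a rearrangement of data around `Pf`, `mf`, `cf` or the admissibility test.
Padding makes one gate number serve all nine, namely the sum of their polynomial bounds. -/
theorem exists_simCircuits {I : Type} {B nz fn inp pk ct msk tg ny out N : I → ℕ}
    (hfn : PolyIn B fn) (htg : PolyIn B tg) (hN : PolyIn B N)
    {Pf : ∀ i, Bits (nz i) → Bits (pk i)} (hP : PolyC B Pf)
    {mf : ∀ j : Σ i, Bits (tg i), Bits (nz j.1) → Bits (msk j.1)}
    (hm : PolyC (fun j : Σ i, Bits (tg i) => B j.1) mf)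
    {cf : ∀ i, Bits (nz i) × Bits (inp i + inp i) × Bits (ny i) → Bits (ct i)} (hc : PolyC B cf)
    {app : ∀ i, Bits (fn i) → Bits (inp i) → Bits (out i)}
    (happ : PolyC (X := fun i => Bits (fn i) × Bits (inp i)) (Y := fun i => Bits (out i)) B
      fun i p => app i p.1 p.2) (hmsk : PolyIn B msk) :
    ∃ s : I → ℕ, PolyIn B s ∧ ∀ i, Nonempty
      (SimCircuits (N i) (s i) (Pf i) (fun τ => mf ⟨i, τ⟩) (cf i) (app i)) := by
  have hnz : PolyIn B nz := hP.dom
  have hinp : PolyIn B inp := happ.dom.mono fun i => Nat.le_add_left _ _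
  have hny : PolyIn B ny := hc.dom.mono fun i => by
    show _ ≤ nz i + ((inp i + inp i) + ny i); omega
  have hy : PolyIn B fun i => 1 + fn i := (PolyIn.const 1).add hfn
  have hh : PolyIn B fun i => N i * (1 + fn i) := hN.mul hy
  have hx : PolyIn B fun i => inp i + inp i := hinp.add hinp
  have hM : PolyT B fun i => Mem (nz i) (N i) (fn i) (inp i) :=
    (PolyT.bits hnz).prod ((PolyT.bits hh).prod (PolyT.bits hx))
  have hMid := PolyC.id hM
  have hHX := (PolyT.bits hh).prod (PolyT.bits hx)
  -- the preparation of the memory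
  obtain ⟨p1, h1⟩ := (((PolyC.id (PolyT.bits hnz)).pair
    ((PolyC.const (Y := fun i => Bits (N i * (1 + fn i))) (PolyT.bits hnz) hh
      fun i _ => false).pair
      (PolyC.const (Y := fun i => Bits (inp i + inp i)) (PolyT.bits hnz) hx
        fun i _ => false))).pair hP).exists_circuit_le
  -- the rounds
  have hJ : PolyT (fun j : Σ i, ℕ × Bits (tg i) => B j.1)
      fun j => Bits (1 + fn j.1) × Mem (nz j.1) (N j.1) (fn j.1) (inp j.1) :=
    ((PolyT.bits hy).prod hM).reindex Sigma.fst
  have hyJ := (PolyT.bits hy).reindex (Sigma.fst : (Σ i, ℕ × Bits (tg i)) → I)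
  have hMJ := hM.reindex (Sigma.fst : (Σ i, ℕ × Bits (tg i)) → I)
  have hzJ := (PolyT.bits hnz).reindex (Sigma.fst : (Σ i, ℕ × Bits (tg i)) → I)
  have hHXJ := hHX.reindex (Sigma.fst : (Σ i, ℕ × Bits (tg i)) → I)
  have hhJ := (PolyT.bits hh).reindex (Sigma.fst : (Σ i, ℕ × Bits (tg i)) → I)
  have hxJ := (PolyT.bits hx).reindex (Sigma.fst : (Σ i, ℕ × Bits (tg i)) → I)
  have aid := PolyC.id hJ
  have ay := PolyC.fst (Y := fun j : Σ i, ℕ × Bits (tg i) => Bits (1 + fn j.1)) hyJ hMJ aid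
  have am := PolyC.snd (Y := fun j : Σ i, ℕ × Bits (tg i) => Bits (1 + fn j.1)) hyJ hMJ aid
  have az := PolyC.fst (Y := fun j : Σ i, ℕ × Bits (tg i) => Bits (nz j.1)) hzJ hHXJ am
  have ahx := PolyC.snd (Y := fun j : Σ i, ℕ × Bits (tg i) => Bits (nz j.1)) hzJ hHXJ am
  have ah := PolyC.fst (Y := fun j : Σ i, ℕ × Bits (tg i) => Bits (N j.1 * (1 + fn j.1))) hhJ hxJ ahx
  have ax := PolyC.snd (Y := fun j : Σ i, ℕ × Bits (tg i) => Bits (N j.1 * (1 + fn j.1))) hhJ hxJ ahx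
  have aset := az.pair ((ah.setSlot (N := fun j => N j.1) (m := fun j => 1 + fn j.1) ay
    fun j => j.2.1).pair ax)
  have amsk := PolyC.comp (hm.reindex fun j : Σ i, ℕ × Bits (tg i) => ⟨j.1, j.2.2⟩) az
  have atag := PolyC.const (Y := fun j : Σ i, ℕ × Bits (tg i) => Bits (tg j.1)) hJ
    (htg.reindex Sigma.fst) fun j => j.2.2
  obtain ⟨p2, h2⟩ := ((ay.left.bit fun _ => (0 : Fin 1)).pair ((amsk.append ay.right).pair
    (atag.pair aset))).exists_circuit_le
  obtain ⟨p7, h7⟩ := (aset.pair ay).exists_circuit_le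
  have hMb : PolyIn B fun i => memLen (nz i) (N i) (fn i) (inp i) := hM
  -- the other parts
  have bid := PolyC.id (PolyT.prod (X := fun i => Bits (msk i + fn i)) (hmsk.add hfn)
    (PolyT.prod (X := fun i => Bits (tg i)) htg (PolyT.bits hMb)))
  obtain ⟨p3, h3⟩ := ((bid.snd (Y := fun i => Bits (msk i + fn i)) (hmsk.add hfn)
    (PolyT.prod (X := fun i => Bits (tg i)) htg (PolyT.bits hMb))).snd
      (Y := fun i => Bits (tg i)) htg (PolyT.bits hMb)).exists_circuit_le
  have cid := PolyC.id (PolyT.prod (PolyT.bits hx) hM)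
  have cx := cid.fst (PolyT.bits hx) hM
  have cm := cid.snd (PolyT.bits hx) hM
  have cz := cm.fst (PolyT.bits hnz) hHX
  have ch := (cm.snd (PolyT.bits hnz) hHX).fst (PolyT.bits hh) (PolyT.bits hx)
  obtain ⟨p4, h4⟩ := ((cz.pair (ch.pair cx)).pair cx).exists_circuit_le
  have did := PolyC.id (PolyT.prod hM (PolyT.bits hny))
  have dm := did.fst hM (PolyT.bits hny)
  have dy := did.snd hM (PolyT.bits hny)
  have dz := dm.fst (PolyT.bits hnz) hHX
  have dx := (dm.snd (PolyT.bits hnz) hHX).snd (PolyT.bits hh) (PolyT.bits hx)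
  obtain ⟨p5, h5⟩ := ((PolyC.comp hc (dz.pair (dx.pair dy))).pair dm).exists_circuit_le
  have eid := PolyC.id (PolyT.prod (X := fun _ => Bits 1) (.const 1) hM)
  have eb := eid.fst (Y := fun _ => Bits 1) (.const 1) hM
  have em := eid.snd (Y := fun _ => Bits 1) (.const 1) hM
  have eh := (em.snd (PolyT.bits hnz) hHX).fst (PolyT.bits hh) (PolyT.bits hx)
  have ex := (em.snd (PolyT.bits hnz) hHX).snd (PolyT.bits hh) (PolyT.bits hx)
  obtain ⟨p6, h6⟩ := ((eb.bit fun _ => (0 : Fin 1)).and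
    (PolyC.admissible happ eh ex hN)).exists_circuit_le
  have fid := PolyC.id (PolyT.bits hMb)
  obtain ⟨p8, h8⟩ := (fid.pair (PolyC.const (Y := fun i => Bits (1 + fn i)) (PolyT.bits hMb) hy
    fun i _ => false)).exists_circuit_le
  have gid := PolyC.id (PolyT.bits (hMb.reindex (Sigma.fst : (Σ i, Bits (tg i)) → I)))
  obtain ⟨p9, h9⟩ := ((PolyC.const (Y := fun j : Σ i, Bits (tg i) => Bits (tg j.1))
    (PolyT.bits (hMb.reindex (Sigma.fst : (Σ i, Bits (tg i)) → I))) (htg.reindex Sigma.fst)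
    fun j => j.2).pair gid).exists_circuit_le
  refine ⟨fun i => (p1 + p2 + p3 + p4 + p5 + p6 + p7 + p8 + p9).eval (B i), ⟨_, fun i => le_rfl⟩,
    fun i => ?_⟩
  simp only [Polynomial.eval_add]
  set s := p1.eval (B i) + p2.eval (B i) + p3.eval (B i) + p4.eval (B i) + p5.eval (B i) +
    p6.eval (B i) + p7.eval (B i) + p8.eval (B i) + p9.eval (B i) with hs
  obtain ⟨C1, e1⟩ := h1 i s (by omega)
  choose C2 e2 using fun j τ => h2 ⟨i, j, τ⟩ s (by simp only; omega)
  obtain ⟨C3, e3⟩ := h3 i s (by omega)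
  obtain ⟨C4, e4⟩ := h4 i s (by omega)
  obtain ⟨C5, e5⟩ := h5 i s (by omega)
  obtain ⟨C6, e6⟩ := h6 i s (by omega)
  choose C7 e7 using fun j τ => h7 ⟨i, j, τ⟩ s (by simp only; omega)
  obtain ⟨C8, e8⟩ := h8 i s (by omega)
  choose C9 e9 using fun τ => h9 ⟨i, τ⟩ s (by simp only; omega)
  exact ⟨{
    start := C1
    start_eval := e1
    push := C2
    push_eval := fun j τ y z h x => e2 j τ (y, z, h, x)
    drop := C3
    drop_eval := fun a τ c => e3 (a, τ, c)
    chal := C4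
    chal_eval := fun z h x' x => e4 (x, z, h, x')
    recv := C5
    recv_eval := fun z h x y => e5 ((z, h, x), y)
    guess := C6
    guess_eval := fun b z h x => e6 (b, z, h, x)
    -- Recording a message does not involve the tag, so an arbitrary tag fills the index.
    ext := fun j => C7 j fun _ => false
    ext_eval := fun j y z h x => e7 j _ (y, z, h, x)
    zero := C8
    zero_eval := e8
    addTag := C9
    addTag_eval := e9 }⟩

open Enc

/-! ### Simulations of polynomial size -/

section Families

variable {I : Type} {B nz fn inp pk ct msk tg ny out sk : I → ℕ}

theorem PolyIn.memLen {N : I → ℕ} (hnz : PolyIn B nz) (hN : PolyIn B N) (hfn : PolyIn B fn)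
    (hinp : PolyIn B inp) : PolyIn B fun i => memLen (nz i) (N i) (fn i) (inp i) :=
  hnz.add ((hN.mul ((PolyIn.const 1).add hfn)).add (hinp.add hinp))

theorem PolyIn.simCost {N s q : I → ℕ} (hnz : PolyIn B nz) (hfn : PolyIn B fn)
    (hinp : PolyIn B inp) (hpk : PolyIn B pk) (hct : PolyIn B ct) (hmsk : PolyIn B msk)
    (htg : PolyIn B tg) (hny : PolyIn B ny) (hN : PolyIn B N) (hs : PolyIn B s) (hq : PolyIn B q) :
    PolyIn B fun i => simCost (nz i) (fn i) (inp i) (pk i) (ct i) (msk i) (tg i) (ny i) (N i) (s i)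
      (q i) := by
  have hM := PolyIn.memLen hnz hN hfn hinp
  have hy : PolyIn B fun i => 1 + fn i := (PolyIn.const 1).add hfn
  exact ((((PolyIn.cost hnz (hM.add hpk) hs).add
    (PolyIn.cost ((hinp.add hinp).add hM) (hM.add (hinp.add hinp)) hs)).add
    (PolyIn.cost (hM.add hny) (hct.add hM) hs)).add
    (PolyIn.cost ((PolyIn.const 1).add hM) (.const 1) hs)).add (hN.mul
    (((((hq.add (PolyIn.cost (hy.add hM)
      ((PolyIn.const 1).add ((hmsk.add hfn).add (htg.add hM))) hs)).add
    (PolyIn.cost ((hmsk.add hfn).add (htg.add hM)) hM hs)).add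
    (PolyIn.cost hM (hM.add hy) hs)).add (PolyIn.cost (hy.add hM) (hM.add hy) hs)).add
    (PolyIn.cost hM (htg.add hM) hs)))

variable (hfn : PolyIn B fn) (htg : PolyIn B tg) (hmsk : PolyIn B msk)
  {Pf : ∀ i, Bits (nz i) → Bits (pk i)} (hP : PolyC B Pf)
  {mf : ∀ j : Σ i, Bits (tg i), Bits (nz j.1) → Bits (msk j.1)}
  (hm : PolyC (fun j : Σ i, Bits (tg i) => B j.1) mf)
  {app : ∀ i, Bits (fn i) → Bits (inp i) → Bits (out i)}
  (happ : PolyC (X := fun i => Bits (fn i) × Bits (inp i)) (Y := fun i => Bits (out i)) B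
    fun i p => app i p.1 p.2)
  {A : ∀ i, Adversary (pk i) (fn i) (inp i) (sk i + tg i) (ct i)}
  (hA : PolyIn B fun i => (A i).cost)
  {q : ∀ i, QCirc (msk i + fn i) (sk i)} (hq : PolyIn B fun i => (q i).size)
  (Lp Lq : ∀ i, List (Round (A i).w (fn i) (sk i + tg i) × Bits (tg i)))
  (hLp : ∀ i, (Lp i).map Prod.fst = (A i).pre) (hLq : ∀ i, (Lq i).map Prod.fst = (A i).post)

theorem length_add_length_le_cost {pk fn inp sk tg ct : ℕ} (A : Adversary pk fn inp sk ct)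
    {Lp Lq : List (Round A.w fn sk × Bits tg)} (hLp : Lp.map Prod.fst = A.pre)
    (hLq : Lq.map Prod.fst = A.post) : Lp.length + Lq.length ≤ A.cost := by
  have h3 := length_le_roundsCost A.pre
  have h4 := length_le_roundsCost A.post
  rw [← hLp, List.length_map] at h3
  rw [← hLq, List.length_map] at h4
  unfold Adversary.cost
  rw [← hLp, ← hLq]
  unfold roundsCost at h3 h4
  omega

include hfn htg hmsk hP hm happ hA hq hLp hLq

/-- The cost of the adversary serves as the number of slots of the record, since it bounds the
number of rounds. No external bits enter the ciphertext: everything is made from the input `z`. -/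
theorem exists_distinguishers {cf : ∀ i, Bits (nz i) × Bits (inp i + inp i) → Bits (ct i)}
    (hc : PolyC B cf) :
    ∃ D : ∀ i, Distinguisher (nz i), PolyIn B (fun i => (D i).cost) ∧ ∀ i z, (D i).prob z =
      game (fun τ f => (q i).sem (ket (Fin.append (mf ⟨i, τ⟩ z) f))) (app i) (A i) (Lp i) (Lq i)
        (Pf i z) fun x => cf i (z, x) := by
  have hinp : PolyIn B inp := happ.dom.mono fun i => Nat.le_add_left _ _
  have hT := PolyT.prod (PolyT.bits (B := B) hP.dom) (PolyT.prod (PolyT.bits (hinp.add hinp))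
    (PolyT.bits (PolyIn.const 0)))
  have hT' := (PolyT.bits (hinp.add hinp)).prod (PolyT.bits (B := B) (PolyIn.const 0))
  have hid := PolyC.id hT
  have hc' := PolyC.comp hc ((hid.fst (PolyT.bits hP.dom) hT').pair
    ((hid.snd (PolyT.bits hP.dom) hT').fst (PolyT.bits (hinp.add hinp))
      (PolyT.bits (PolyIn.const 0))))
  obtain ⟨s, hs, S⟩ := exists_simCircuits hfn htg hA hP hm hc' happ hmsk
  replace S := fun i => (S i).some
  refine ⟨fun i => ⟨(A i).anc, (A i).advice, (A i).advice_isState,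
    (S i).gameQ (q i) (A i) (Lp i) (Lq i)⟩, ?_, fun i z => ?_⟩
  · refine ((hA.add (PolyIn.simCost hP.dom hfn hinp hP.cod hc.cod hmsk htg (PolyIn.const 0) hA hs
      hq)).add hA).mono fun i => ?_
    refine add_le_add ((S i).size_gameQ_le (q i) (A i) (Lp i) (Lq i) (hLp i) (hLq i) le_rfl) ?_
    show (A i).anc ≤ _
    unfold Adversary.cost
    omega
  · exact (S i).accept_gameQ (q i) _ (A i) (Lp i) (Lq i)
      (length_add_length_le_cost (A i) (hLp i) (hLq i)) z fun _ _ _ => rfl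

/-- Nothing is assumed about the key at the tag `t i`: the reduction obtains it from its oracle.
Distinctness of the tags guarantees that it asks at most once. -/
theorem exists_outer {cf : ∀ i, Bits (nz i) × Bits (inp i + inp i) × Bits (ny i) → Bits (ct i)}
    (hc : PolyC B cf) (t : ∀ i, Bits (tg i)) :
    ∃ A' : ∀ i, Adversary (nz i) (fn i) (inp i) (sk i) (ny i), PolyIn B (fun i => (A' i).cost) ∧
      ∀ i (key : Bits (tg i) → Bits (fn i) → Op (sk i)) (z : Bits (nz i)),
        (∀ τ, τ ≠ t i → ∀ f, key τ f = (q i).sem (ket (Fin.append (mf ⟨i, τ⟩ z) f))) →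
        ((Lp i ++ Lq i).map Prod.snd).Nodup →
        ∀ {ne : ℕ} (y : Bits (inp i + inp i) → Bits ne → Bits (ny i)),
        untagged (key (t i)) (fun Q => (Q.length : ℕ∞) ≤ 1)
          (fun Q ρ => ∑ x : Bits (inp i + inp i),
            open Classical in
            if Admissible (app i) x Q then expect fun e => untagged (key (t i))
              (fun Q' => (Q'.length : ℕ∞) ≤ 1 ∧ Admissible (app i) x Q')
              (fun _ ρ' => accept ((A' i).guess.sem ρ')) (A' i).post Q
              ((A' i).receive.sem (tensor
                (outcome ((A' i).challenge.sem ρ) x) (ket (y x e)))) else 0)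
          (A' i).pre [] ((A' i).start.sem (tensor (ket z) (A' i).advice)) =
        expect fun e => game key (app i) (A i) (Lp i) (Lq i) (Pf i z) fun x => cf i (z, x, y x e) := by
  have hinp : PolyIn B inp := happ.dom.mono fun i => Nat.le_add_left _ _
  have hny : PolyIn B ny := hc.dom.mono fun i => by
    show _ ≤ nz i + ((inp i + inp i) + ny i); omega
  obtain ⟨s, hs, S⟩ := exists_simCircuits hfn htg hA hP hm hc happ hmsk
  replace S := fun i => (S i).some
  refine ⟨fun i => (S i).outer (q i) (t i) (A i) (Lp i) (Lq i), ?_,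
    fun i key z hkey hnd ne y => ?_⟩
  · refine (((hA.add (PolyIn.memLen hP.dom hA hfn hinp)).add hA).add
      (PolyIn.simCost hP.dom hfn hinp hP.cod hc.cod hmsk htg hny hA hs hq)).mono fun i => ?_
    exact (S i).cost_outer_le (q i) (t i) (A i) (Lp i) (Lq i) (hLp i) (hLq i) le_rfl
  · exact (S i).untagged_outer (q i) (t i) (A i) (Lp i) (Lq i)
      (length_add_length_le_cost (A i) (hLp i) (hLq i)) key z (fun τ _ => hkey τ)
      (List.nodup_iff_count_le_one.1 hnd _) y

end Families

/-! ### Uniform bounds -/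

/-- If every choice of one function in each family is `O(h)`, then the families are `O(h)`
uniformly. -/
theorem exists_uniform_bound {T : ℕ → Type} [∀ l, Nonempty (T l)] (f : ∀ l, T l → ℝ) (h : ℕ → ℝ)
    (hh : ∀ l, 0 ≤ h l) (hf : ∀ t : ∀ l, T l, (fun l => f l (t l)) =O[atTop] h) :
    ∃ C : ℝ, 0 ≤ C ∧ ∀ᶠ l in atTop, ∀ t, |f l t| ≤ C * h l := by
  classical
  have hex : ∀ l, ∃ t : T l, ∀ n : ℕ, n ≤ l → (∃ t', (n : ℝ) * h l < |f l t'|) →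
      (n : ℝ) * h l < |f l t| := by
    intro l
    -- A nearly worst `t`: it exceeds `n * h l` for every `n ≤ l` for which some element does. The
    -- cutoff at `l` is needed because `|f l t|` may be unbounded in `t`; the constant for this one
    -- choice then works for all, once `l` is large.
    set n := Nat.findGreatest (fun n : ℕ => ∃ t', (n : ℝ) * h l < |f l t'|) l with hn
    by_cases hp : ∃ m ≤ l, ∃ t', ((m : ℕ) : ℝ) * h l < |f l t'|
    · obtain ⟨m, hm, hm'⟩ := hp
      obtain ⟨t, ht⟩ := Nat.findGreatest_spec (P := fun n : ℕ => ∃ t', (n : ℝ) * h l < |f l t'|)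
        hm hm'
      refine ⟨t, fun k hk hk' => lt_of_le_of_lt ?_ ht⟩
      exact mul_le_mul_of_nonneg_right (Nat.cast_le.2 (Nat.le_findGreatest hk hk')) (hh l)
    · exact ⟨Classical.arbitrary _, fun k hk hk' => absurd ⟨k, hk, hk'⟩ hp⟩
  choose t ht using hex
  obtain ⟨C, hC⟩ := (hf t).bound
  obtain ⟨n, hn⟩ := exists_nat_ge C
  refine ⟨n, Nat.cast_nonneg n, ?_⟩
  filter_upwards [hC, eventually_ge_atTop n] with l hl hnl t'
  by_contra hlt
  have h1 := ht l n hnl ⟨t', not_le.1 hlt⟩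
  rw [Real.norm_eq_abs, Real.norm_of_nonneg (hh l)] at hl
  exact absurd (h1.trans_le hl) (not_lt.2 (mul_le_mul_of_nonneg_right hn (hh l)))

/-- The bound of sub-exponential security. -/
def subExp (α : ℝ) (l : ℕ) : ℝ := (2 : ℝ) ^ (-((l : ℝ) ^ α))

theorem subExp_nonneg (α : ℝ) (l : ℕ) : 0 ≤ subExp α l := by unfold subExp; positivity

theorem PolyIn.polyBounded {T : ℕ → Type} {f : (Σ l, T l) → ℕ}
    (hf : PolyIn (fun i : Σ l, T l => i.1) f) (t : ∀ l, T l) : PolyBounded fun l => f ⟨l, t l⟩ :=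
  hf.reindex fun l => ⟨l, t l⟩

theorem PolyBounded.polyIn {I : Type} {f : ℕ → ℕ} (hf : PolyBounded f) (φ : I → ℕ) :
    PolyIn φ fun i => f (φ i) :=
  PolyIn.reindex (B := fun l => l) hf φ

/-- The sampler that returns two given circuits. -/
def pairSampler {n m s : ℕ} (C₀ C₁ : Circuit n m s) : Sampler where
  n := n
  m := m
  s := s
  aux := 0
  coins := 0
  alg := ⟨1, constCircuit (Fin.append (Fin.append C₀ C₁ : Bits (descLen n m s + descLen n m s))
    (![] : Bits 0))⟩

theorem circuit_pairSampler {n m s : ℕ} (C₀ C₁ : Circuit n m s) (b : Bool) (r : Bits 0) :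
    (pairSampler C₀ C₁).circuit b r = if b then C₁ else C₀ := by
  have h : (pairSampler C₀ C₁).alg.eval r =
      (Fin.append (Fin.append C₀ C₁ : Bits (descLen n m s + descLen n m s)) (![] : Bits 0)) :=
    eval_constCircuit _ _
  unfold Sampler.circuit
  have h1 : ((pairSampler C₀ C₁).alg.eval r).left =
      (Fin.append C₀ C₁ : Bits (descLen n m s + descLen n m s)) :=
    (congrArg Bits.left h).trans (Bits.append_left _ _)
  rw [h1]
  refine if_congr Iff.rfl ?_ ?_
  · exact Bits.append_right _ _
  · exact Bits.append_left _ _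

/-- Obfuscations of given equivalent circuits are indistinguishable, with a uniform bound. -/
def Obfuscator.UniformlySecure (O : Obfuscator) (α : ℝ) : Prop :=
  ∀ (T : ℕ → Type) [∀ l, Nonempty (T l)] (n m s : ℕ → ℕ)
    (C₀ C₁ : ∀ l, T l → Circuit (n l) (m l) (s l))
    (D : ∀ i : Σ l, T l, Distinguisher (descLen (n i.1) (m i.1) (O.outGates i.1 (n i.1) (m i.1)
      (s i.1)) + 0)), PolyBounded n → PolyBounded m → PolyBounded s →
    (∀ l t x, (C₀ l t).eval x = (C₁ l t).eval x) →
    PolyIn (fun i : Σ l, T l => i.1) (fun i => (D i).cost) →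
    ∃ C : ℝ, 0 ≤ C ∧ ∀ᶠ l in atTop, ∀ t,
      |(expect fun c => (D ⟨l, t⟩).prob (Fin.append (O.obf l (C₀ l t) c) (![] : Bits 0))) -
        expect fun c => (D ⟨l, t⟩).prob (Fin.append (O.obf l (C₁ l t) c) (![] : Bits 0))| ≤
      C * subExp α l

/-- Fixed circuits are given by a sampler without coins that has them hardwired. As every choice of
circuits and distinguishers is covered by the hypothesis, `exists_uniform_bound` makes the constant
uniform. -/
theorem Obfuscator.exists_uniformlySecure {O : Obfuscator} (hO : O.SubExpIndistinguishable) :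
    ∃ α : ℝ, 0 < α ∧ α < 1 ∧ O.UniformlySecure α := by
  obtain ⟨α, h0, h1, h⟩ := hO
  refine ⟨α, h0, h1, fun T _ n m s C₀ C₁ D hn hm hs hC hD => ?_⟩
  refine exists_uniform_bound (fun l t =>
    (expect fun c => (D ⟨l, t⟩).prob (Fin.append (O.obf l (C₀ l t) c) (![] : Bits 0))) -
      expect fun c => (D ⟨l, t⟩).prob (Fin.append (O.obf l (C₁ l t) c) (![] : Bits 0)))
    (subExp α) (subExp_nonneg α) fun t => ?_
  have h2 := h (fun l => pairSampler (C₀ l (t l)) (C₁ l (t l))) (fun l => D ⟨l, t l⟩) ?_ ?_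
    (hD.polyBounded t)
  · unfold SubExpSmall at h2
    refine (congrArg (fun f : ℕ → ℝ => f =O[atTop] subExp α) (funext fun l => ?_)).mp h2
    have h3 : ∀ b, O.prob l (pairSampler (C₀ l (t l)) (C₁ l (t l))) (D ⟨l, t l⟩) b =
        expect fun c => (D ⟨l, t l⟩).prob (Fin.append
          (O.obf l (if b then C₁ l (t l) else C₀ l (t l)) c) (![] : Bits 0)) := by
      intro b
      refine Eq.trans ?_ (expect_const (n := 0) _)
      refine congrArg expect (funext fun r => congrArg expect (funext fun c => ?_))
      refine congrArg (D ⟨l, t l⟩).prob (congrArg₂ Fin.append ?_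
        (Subsingleton.elim (α := Bits 0) _ _))
      exact congrArg (fun C => O.obf l C c) (circuit_pairSampler _ _ b r)
    exact congrArg₂ _ (h3 false) (h3 true)
  · have hd := PolyIn.descLen (B := fun l => l) hn hm hs
    refine PolyIn.mono (((PolyIn.add hn hm).add hs).add (PolyIn.cost (B := fun l => l)
      (.const 0) (PolyIn.add (.add hd hd) (.const 0)) (.const 1))) fun l => ?_
    simp only [Sampler.cost, pairSampler, Alg.cost]
    omega
  · intro l r x
    exact (congrArg (fun C => Circuit.eval C x) (circuit_pairSampler _ _ false r)).trans
      ((hC l (t l) x).trans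
        (congrArg (fun C => Circuit.eval C x) (circuit_pairSampler _ _ true r)).symm)

theorem expect_slot {n : ℕ} (f : Bits n → ℝ) :
    (expect fun u : Bits (1 * n) => f (slot u 0)) = expect f := by
  refine (expect_equiv ⟨fun u => slot (N := 1) u 0, fun v => Bits.flatten fun _ => v, fun u => ?_,
    fun v => ?_⟩ (one_mul n) f).symm
  · funext k
    obtain ⟨⟨a, b⟩, rfl⟩ := finProdFinEquiv.surjective k
    simp only [Bits.flatten, Equiv.symm_apply_apply, slot, Subsingleton.elim a 0]
  · funext b
    simp only [slot, Bits.flatten, Equiv.symm_apply_apply]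

/-- The value at a single punctured point is pseudorandom, with a uniform bound. -/
def PPRF.UniformlySecure {inLen outLen : ℕ → ℕ} (F : PPRF inLen outLen) (α : ℝ) : Prop :=
  ∀ (T : ℕ → Type) [∀ l, Nonempty (T l)] (S : ∀ l, T l → Bits (inLen l))
    (D : ∀ i : Σ l, T l, Distinguisher (F.punctKey i.1 1 + 1 * outLen i.1)),
    PolyIn (fun i : Σ l, T l => i.1) (fun i => (D i).cost) →
    ∀ f : ∀ l, T l → Bits (F.punctKey l 1) → Bits (outLen l) → ℝ,
    (∀ l t z, (D ⟨l, t⟩).prob z = f l t z.left (slot z.right 0)) →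
    ∃ C : ℝ, 0 ≤ C ∧ ∀ᶠ l in atTop, ∀ t,
      |(expect fun g => expect fun r => f l t (F.punctured l (F.genKey l g) (fun _ => S l t) r)
          (F.value l (F.genKey l g) (S l t))) -
        expect fun g => expect fun r => expect fun u =>
          f l t (F.punctured l (F.genKey l g) (fun _ => S l t) r) u| ≤ C * subExp α l

/-- Punctured sets with one point suffice, since the hybrids treat one tag at a time; the constant
becomes uniform in that point. -/
theorem PPRF.exists_uniformlySecure {inLen outLen : ℕ → ℕ} {F : PPRF inLen outLen}
    (hF : F.SubExpPseudorandom) : ∃ α : ℝ, 0 < α ∧ α < 1 ∧ F.UniformlySecure α := by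
  obtain ⟨α, h0, h1, h⟩ := hF
  refine ⟨α, h0, h1, fun T _ S D hD f hf => ?_⟩
  refine exists_uniform_bound (fun l t =>
    (expect fun g => expect fun r => f l t (F.punctured l (F.genKey l g) (fun _ => S l t) r)
      (F.value l (F.genKey l g) (S l t))) -
      expect fun g => expect fun r => expect fun u =>
        f l t (F.punctured l (F.genKey l g) (fun _ => S l t) r) u)
    (subExp α) (subExp_nonneg α) fun t => ?_
  have h2 := h (fun _ => 1) (fun l _ => S l (t l)) (fun l => D ⟨l, t l⟩) (PolyIn.const 1)
    (fun l a b _ => Subsingleton.elim a b) (hD.polyBounded t)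
  refine (congrArg (fun f : ℕ → ℝ => f =O[atTop] subExp α) (funext fun l => ?_)).mp h2
  refine congrArg₂ _ ?_ ?_
  · unfold PPRF.realProb
    refine congrArg expect (funext fun g => congrArg expect (funext fun r => ?_))
    rw [hf, Bits.append_left, Bits.append_right]
    congr 1
    funext b
    simp only [slot, Bits.flatten, Equiv.symm_apply_apply]
  · unfold PPRF.idealProb
    refine congrArg expect (funext fun g => congrArg expect (funext fun r => ?_))
    refine (congrArg expect (funext fun u => ?_)).trans (expect_slot _)
    rw [hf, Bits.append_left, Bits.append_right]

/-- Adaptive single-key security with a uniform bound. -/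
def UniformlySingleKeySecure (S : ℕ → SDFE) (α : ℝ) : Prop :=
  ∀ (T : ℕ → Type) [∀ l, Nonempty (T l)]
    (A : ∀ i : Σ l, T l, Adversary (S i.1).pk (S i.1).fn (S i.1).inp (S i.1).sk (S i.1).ct),
    PolyIn (fun i : Σ l, T l => i.1) (fun i => (A i).cost) →
    ∃ C : ℝ, 0 ≤ C ∧ ∀ᶠ l in atTop, ∀ t,
      |(S l).experiment 1 (A ⟨l, t⟩) false - (S l).experiment 1 (A ⟨l, t⟩) true| ≤
        C * subExp α l

theorem exists_uniformlySingleKeySecure {S : ℕ → SDFE}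
    (hS : SubExpAdaptivelySingleKeySecure S) :
    ∃ α : ℝ, 0 < α ∧ α < 1 ∧ UniformlySingleKeySecure S α := by
  obtain ⟨α, h0, h1, h⟩ := hS
  refine ⟨α, h0, h1, fun T _ A hA => ?_⟩
  refine exists_uniform_bound (fun l t =>
    (S l).experiment 1 (A ⟨l, t⟩) false - (S l).experiment 1 (A ⟨l, t⟩) true)
    (subExp α) (subExp_nonneg α) fun t => ?_
  exact isBigO_abs_left.1 (h (fun l => A ⟨l, t l⟩) (hA.polyBounded t))

open Enc

/-! ### Setup and encryption circuits with punctured keys -/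

section Alternatives

variable {tag : ℕ → ℕ}

/-- The sizes of the building blocks are polynomially bounded. -/
structure Efficiency (E : SDFEAlgs) (F : PPRF tag E.setupCoins) (G : PPRF tag E.encCoins)
    (O : Obfuscator) : Prop where
  tag : PolyBounded tag
  pk : PolyBounded E.pk
  msk : PolyBounded E.msk
  fn : PolyBounded E.fn
  inp : PolyBounded E.inp
  ct : PolyBounded E.ct
  setupCoins : PolyBounded E.setupCoins
  encCoins : PolyBounded E.encCoins
  app : PolyBounded fun l => (E.app l).cost
  setup : PolyBounded fun l => (E.setup l).cost
  qkg : PolyBounded fun l => (E.qkg l).size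
  enc : PolyBounded fun l => (E.enc l).cost
  keyF : PolyBounded F.key
  fnF : PolyBounded fun l => (F.fn l).cost
  punctKeyF : PolyBounded fun l => F.punctKey l 1
  fnPunctF : PolyBounded fun l => (F.fnPunct l 1).cost
  keyG : PolyBounded G.key
  fnG : PolyBounded fun l => (G.fn l).cost
  punctKeyG : PolyBounded fun l => G.punctKey l 1
  fnPunctG : PolyBounded fun l => (G.fnPunct l 1).cost
  obf : O.Efficient

theorem PPRF.Efficient.punct {outLen : ℕ → ℕ} {F : PPRF tag outLen} (hF : F.Efficient) :
    PolyBounded fun l => F.punctKey l 1 + F.punctCoins l 1 + (F.puncture l 1).cost +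
      (F.fnPunct l 1).cost := by
  obtain ⟨p, hp⟩ := hF.2
  exact PolyIn.mono (((PolyIn.self (B := fun l : ℕ => l)).add (.const 1)).eval p) fun l => hp l 1

theorem Efficiency.of {E : SDFEAlgs} {F : PPRF tag E.setupCoins} {G : PPRF tag E.encCoins}
    {O : Obfuscator} (hE : E.Efficient) (hF : F.Efficient) (hG : G.Efficient)
    (hO : O.Efficient) : Efficiency E F G O := by
  have e : ∀ {f g : ℕ → ℕ}, PolyBounded g → (∀ l, f l ≤ g l) → PolyBounded f :=
    fun hg h => PolyIn.mono hg h
  constructor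
  · exact e hF.1 fun l => by omega
  · exact e hE fun l => by omega
  · exact e hE fun l => by omega
  · exact e hE fun l => by omega
  · exact e hE fun l => by omega
  · exact e hE fun l => by omega
  · exact e hE fun l => by omega
  · exact e hE fun l => by omega
  · exact e hE fun l => by omega
  · exact e hE fun l => by omega
  · exact e hE fun l => by omega
  · exact e hE fun l => by omega
  · exact e hF.1 fun l => by omega
  · exact e hF.1 fun l => by omega
  · exact e hF.punct fun l => by omega
  · exact e hF.punct fun l => by omega
  · exact e hG.1 fun l => by omega
  · exact e hG.1 fun l => by omega
  · exact e hG.punct fun l => by omega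
  · exact e hG.punct fun l => by omega
  · exact hO

variable {E : SDFEAlgs} {F : PPRF tag E.setupCoins} {G : PPRF tag E.encCoins} {O : Obfuscator}
  {padS padE : ℕ → ℕ}

theorem Alg.gates_le_cost {n m : ℕ} (A : Alg n m) : A.gates ≤ A.cost := by
  unfold Alg.cost Circuit.cost
  nlinarith [Nat.zero_le (A.gates + m), Nat.zero_le (n + A.gates)]

theorem polyBounded_padded {f g : ℕ → ℕ} (hf : PolyBounded f) (hg : PolyBounded g) :
    PolyBounded fun l => Circuit.padded (f l) (g l) :=
  PolyIn.mono (PolyIn.add hf hg) fun l => by unfold Circuit.padded; omega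

theorem Efficiency.setupGates (h : Efficiency E F G O) (hS : PolyBounded padS) :
    PolyBounded (setupGates E F padS) := by
  refine polyBounded_padded (PolyIn.mono (((PolyIn.add (PolyIn.add (.const 1) h.keyF) h.fnF).add
    h.setupCoins).add h.setup) fun l => ?_) hS
  have := (F.fn l).gates_le_cost
  have := (E.setup l).gates_le_cost
  omega

theorem Obfuscator.Efficient.polyIn (hO : O.Efficient) {I : Type} {B n m s : I → ℕ} {φ : I → ℕ}
    (hφ : PolyIn B φ) (hn : PolyIn B n) (hm : PolyIn B m) (hs : PolyIn B s) :
    PolyIn B fun i => O.coins (φ i) (n i) (m i) (s i) + O.outGates (φ i) (n i) (m i) (s i) +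
      (O.alg (φ i) (n i) (m i) (s i)).cost := by
  obtain ⟨p, hp⟩ := hO
  exact ((((hφ.add hn).add hm).add hs).eval p).mono fun i => hp _ _ _ _

theorem Efficiency.pkGates (h : Efficiency E F G O) (hS : PolyBounded padS) :
    PolyBounded (pkGates E F O padS) :=
  PolyIn.mono (h.obf.polyIn (B := fun l => l) .self h.tag h.pk (h.setupGates hS)) fun l => by
    unfold KeyBundling.pkGates; omega

theorem Efficiency.encGates (h : Efficiency E F G O) (hS : PolyBounded padS)
    (hE : PolyBounded padE) : PolyBounded (encGates E F G O padS padE) := by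
  refine polyBounded_padded (PolyIn.mono (((PolyIn.add (h.pkGates hS)
    (((PolyIn.const 1).add h.keyG).add h.fnG)).add (PolyIn.add h.pk h.encCoins)).add
    (((PolyIn.const 1).add h.inp).add h.enc)) fun l => ?_) hE
  have := (G.fn l).gates_le_cost
  have := (E.enc l).gates_le_cost
  omega

theorem Efficiency.ctGates (h : Efficiency E F G O) (hS : PolyBounded padS)
    (hE : PolyBounded padE) : PolyBounded (ctGates E F G O padS padE) :=
  PolyIn.mono (h.obf.polyIn (B := fun l => l) .self h.tag h.ct (h.encGates hS hE)) fun l => by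
    unfold KeyBundling.ctGates; omega

theorem PolyC.obf (hO : O.Efficient) {I : Type} {B : I → ℕ} {X : I → Type} [∀ i, Enc (X i)]
    {n m s φ : I → ℕ} (hφ : PolyIn B φ) (hn : PolyIn B n) (hm : PolyIn B m) (hs : PolyIn B s)
    {C : ∀ i, X i → Circuit (n i) (m i) (s i)} (hC : PolyC B C)
    (c : ∀ i, Bits (O.coins (φ i) (n i) (m i) (s i))) :
    PolyC B fun i x => O.obf (φ i) (C i x) (c i) := by
  have h := hO.polyIn hφ hn hm hs
  exact (hC.append (PolyC.const (Y := fun i => Bits (O.coins (φ i) (n i) (m i) (s i))) hC.dom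
    (h.mono fun i => by simp only [len]; omega) c)).alg (h.mono fun i => by omega)

variable (E F G O padS padE) in
/-- Circuits that agree with the setup circuit except at the tag `i`, made from a punctured key and
a public key for the tag `i`. -/
structure SetupAlt where
  circ : ∀ l, Bits (tag l) → Bits (F.punctKey l 1) × Bits (E.pk l) →
    Circuit (tag l) (E.pk l) (setupGates E F padS l)
  eval_circ : ∀ l i κ v τ, (circ l i (κ, v)).eval τ =
    if τ = i then v else ((E.setup l).eval ((F.fnPunct l 1).eval (Fin.append κ τ))).left
  polyC : PolyC (fun j : Σ l, Bits (tag l) => j.1) fun j => circ j.1 j.2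

variable (E F G O padS padE) in
/-- Circuits that encrypt the second plaintext for tags below `i` and the first one for tags above
`i`, made from a punctured key, two plaintexts, a ciphertext for the tag `i`, and a circuit for the
public keys. -/
structure EncAlt where
  circ : ∀ l, Bits (tag l) →
    (Bits (G.punctKey l 1) × Bits (E.inp l + E.inp l) × Bits (E.ct l)) ×
      Circuit (tag l) (E.pk l) (pkGates E F O padS l) →
    Circuit (tag l) (E.ct l) (encGates E F G O padS padE l)
  eval_circ : ∀ l i κ x y P τ, (circ l i ((κ, x, y), P)).eval τ =
    if τ = i then y else (E.enc l).eval (Fin.append (choose (τ.lt i) x)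
      (Fin.append (P.eval τ) ((G.fnPunct l 1).eval (Fin.append κ τ))))
  polyC : PolyC (fun j : Σ l, Bits (tag l) => j.1) fun j => circ j.1 j.2

/-- `pS` is the size of a circuit that compares its input with `i`, returns the hardwired public key
on equality, and otherwise runs setup on the punctured PRF. It does not depend on the padding, so
every larger padding leaves room for this circuit. -/
theorem exists_setupAlt (h : Efficiency E F G O) : ∃ pS : ℕ → ℕ, PolyBounded pS ∧
    ∀ padS, PolyBounded padS → (∀ l, pS l ≤ padS l) → Nonempty (SetupAlt E F padS) := by
  let I := Σ l, Bits (tag l)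
  let B : I → ℕ := fun j => j.1
  have htag : PolyIn B fun j => tag j.1 := h.tag.polyIn B
  have hpk : PolyIn B fun j => E.pk j.1 := h.pk.polyIn B
  have hκ : PolyIn B fun j => F.punctKey j.1 1 := h.punctKeyF.polyIn B
  have hD := (PolyT.bits hκ).prod (PolyT.bits hpk)
  have hW := (PolyT.bits (PolyIn.const (B := B) 0)).prod (PolyT.bits htag)
  have hid := PolyC.id (hD.prod hW)
  have d := hid.fst hD hW
  have τ := (hid.snd hD hW).snd (PolyT.bits (PolyIn.const 0)) (PolyT.bits htag)
  have κ := d.fst (PolyT.bits hκ) (PolyT.bits hpk)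
  have v := d.snd (PolyT.bits hκ) (PolyT.bits hpk)
  have e := (((κ.append τ).alg (A := fun j => F.fnPunct j.1 1) (h.fnPunctF.polyIn B)).alg
    (A := fun j => E.setup j.1) (h.setup.polyIn B)).left
  have f := (τ.decEq (PolyC.const (Y := fun j : I => Bits (tag j.1)) hid.dom (PolyT.bits htag)
    fun j => j.2)).ite v e
  -- No inner circuit is needed here: the slot for one is filled with the empty circuit without
  -- outputs.
  obtain ⟨q, hq⟩ := f.exists_circuits hD (.const 0) htag (a := fun _ => 0) (.const 0)
  refine ⟨fun l => q.eval l, ⟨q, fun _ => le_rfl⟩, fun padS hS hpad => ?_⟩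
  obtain ⟨alt, h1, h2⟩ := hq (fun j => setupGates E F padS j.1) ((h.setupGates hS).polyIn B)
    fun j => (hpad j.1).trans (by unfold setupGates Circuit.padded; omega)
  refine ⟨⟨fun l i d => alt ⟨l, i⟩ (d, fun _ => false), fun l i κ v τ => ?_, ?_⟩⟩
  · rw [h1]
    simp only [decide_eq_true_eq]
  · exact PolyC.comp h2 ((PolyC.id hD).pair (PolyC.const (Y := fun j : I =>
      Circuit (tag j.1) 0 0) hD (PolyIn.descLen htag (.const 0) (.const 0)) fun _ _ => false))

/-- Here the required size depends on `padS`, because the circuit contains the obfuscated setup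
circuit; hence `pE` is chosen after `padS`. -/
theorem exists_encAlt (h : Efficiency E F G O) (hS : PolyBounded padS) :
    ∃ pE : ℕ → ℕ, PolyBounded pE ∧ ∀ padE, PolyBounded padE → (∀ l, pE l ≤ padE l) →
      Nonempty (EncAlt E F G O padS padE) := by
  let I := Σ l, Bits (tag l)
  let B : I → ℕ := fun j => j.1
  have htag : PolyIn B fun j => tag j.1 := h.tag.polyIn B
  have hpk : PolyIn B fun j => E.pk j.1 := h.pk.polyIn B
  have hκ : PolyIn B fun j => G.punctKey j.1 1 := h.punctKeyG.polyIn B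
  have hx : PolyIn B fun j => E.inp j.1 + E.inp j.1 := (h.inp.polyIn B).add (h.inp.polyIn B)
  have hct : PolyIn B fun j => E.ct j.1 := h.ct.polyIn B
  have hxy := (PolyT.bits hx).prod (PolyT.bits hct)
  have hD := (PolyT.bits hκ).prod hxy
  have hW := (PolyT.bits hpk).prod (PolyT.bits htag)
  have hid := PolyC.id (hD.prod hW)
  have d := hid.fst hD hW
  have p := (hid.snd hD hW).fst (PolyT.bits hpk) (PolyT.bits htag)
  have τ := (hid.snd hD hW).snd (PolyT.bits hpk) (PolyT.bits htag)
  have κ := d.fst (PolyT.bits hκ) hxy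
  have x := (d.snd (PolyT.bits hκ) hxy).fst (PolyT.bits hx) (PolyT.bits hct)
  have y := (d.snd (PolyT.bits hκ) hxy).snd (PolyT.bits hx) (PolyT.bits hct)
  have r := (κ.append τ).alg (A := fun j => G.fnPunct j.1 1) (h.fnPunctG.polyIn B)
  have e := (((τ.lexLt fun j => j.2).ite x.right x.left).append (p.append r)).alg
    (A := fun j => E.enc j.1) (h.enc.polyIn B)
  have f := (τ.decEq (PolyC.const (Y := fun j : I => Bits (tag j.1)) hid.dom (PolyT.bits htag)
    fun j => j.2)).ite y e
  obtain ⟨q, hq⟩ := f.exists_circuits hD hpk htag (a := fun j => pkGates E F O padS j.1)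
    ((h.pkGates hS).polyIn B)
  refine ⟨fun l => q.eval l, ⟨q, fun _ => le_rfl⟩, fun padE hE hpad => ?_⟩
  obtain ⟨alt, h1, h2⟩ := hq (fun j => encGates E F G O padS padE j.1)
    ((h.encGates hS hE).polyIn B)
    fun j => (hpad j.1).trans (by unfold encGates Circuit.padded; omega)
  refine ⟨⟨fun l i d => alt ⟨l, i⟩ d, fun l i κ x y P τ => ?_, h2⟩⟩
  rw [h1]
  simp only [decide_eq_true_eq, choose]

end Alternatives

open Enc

/-- An adversary of cost at most `N`, with a tag for each of its rounds. -/
structure Play (pk fn inp sk tg ct N : ℕ) where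
  A : Adversary pk fn inp (sk + tg) ct
  cost_le : A.cost ≤ N
  Lp : List (Round A.w fn (sk + tg) × Bits tg)
  Lq : List (Round A.w fn (sk + tg) × Bits tg)
  map_Lp : Lp.map Prod.fst = A.pre
  map_Lq : Lq.map Prod.fst = A.post

/-! ### Plays against the key-bundled scheme, and their simulation -/

section Steps

variable {tag : ℕ → ℕ} (E : SDFEAlgs) (F : PPRF tag E.setupCoins) (G : PPRF tag E.encCoins)
  (O : Obfuscator) (padS padE : ℕ → ℕ)

/-- Adversaries against the key-bundled scheme, with tags. -/
abbrev BundledPlay (l N : ℕ) : Type :=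
  Play (descLen (tag l) (E.pk l) (pkGates E F O padS l)) (E.fn l) (E.inp l) (E.sk l) (tag l)
    (descLen (tag l) (E.ct l) (ctGates E F G O padS padE l)) N

variable {E F G O padS padE}

/-- The probability to win. -/
def BundledPlay.value {l N : ℕ} (p : BundledPlay E F G O padS padE l N)
    (m : Bits (tag l) → Bits (E.msk l)) (P : Circuit (tag l) (E.pk l) (pkGates E F O padS l))
    (c : Bits (E.inp l + E.inp l) →
      Circuit (tag l) (E.ct l) (ctGates E F G O padS padE l)) : ℝ :=
  game (keyState E l m) (E.scheme l).app p.A p.Lp p.Lq P c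

/-- The play that starts with the challenge. -/
def BundledPlay.fromChallenge {l N : ℕ} (p : BundledPlay E F G O padS padE l N)
    (x : Bits (E.inp l + E.inp l)) (ρ : Op p.A.w) (hρ : IsState ρ) :
    BundledPlay E F G O padS padE l (2 * N + Circuit.cost 0 (E.inp l + E.inp l) 1) where
  A := KeyBundling.fromChallenge p.A x ρ hρ
  cost_le := (cost_fromChallenge_le p.A x ρ hρ).trans
    (Nat.add_le_add_right (Nat.mul_le_mul_left 2 p.cost_le) _)
  Lp := []
  Lq := p.Lq
  map_Lp := rfl
  map_Lq := p.map_Lq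

theorem BundledPlay.value_fromChallenge {l N : ℕ} (p : BundledPlay E F G O padS padE l N)
    (x : Bits (E.inp l + E.inp l)) (ρ : Op p.A.w) (hρ : IsState ρ)
    (m : Bits (tag l) → Bits (E.msk l)) (P : Circuit (tag l) (E.pk l) (pkGates E F O padS l))
    (c : Bits (E.inp l + E.inp l) → Circuit (tag l) (E.ct l) (ctGates E F G O padS padE l)) :
    (p.fromChallenge x ρ hρ).value m P c =
      postValue (keyState E l m) (E.scheme l).app p.A p.Lq x (c x) [] ρ :=
  game_fromChallenge (keyState E l m) (E.scheme l).app p.A x ρ hρ p.Lq P c []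
    (by simp [Admissible])

/-- Removes the adaptive choice of plaintexts: a fixed `x` leaves only the ciphertext `c e x`. The
price is the larger cost bound, since the memory at the challenge becomes advice and `x` is
hardwired. -/
theorem BundledPlay.abs_le_of_fromChallenge {l N : ℕ} (p : BundledPlay E F G O padS padE l N)
    (m : Bits (tag l) → Bits (E.msk l)) (P : Circuit (tag l) (E.pk l) (pkGates E F O padS l))
    {X : Type*} (Φ : (X → ℝ) →ₗ[ℝ] ℝ) (c : X → Bits (E.inp l + E.inp l) →
      Circuit (tag l) (E.ct l) (ctGates E F G O padS padE l)) {ε : ℝ} (hε : 0 ≤ ε)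
    (h : ∀ x (p' : BundledPlay E F G O padS padE l
      (2 * N + Circuit.cost 0 (E.inp l + E.inp l) 1)),
      |Φ fun e => p'.value m P fun _ => c e x| ≤ ε) :
    |Φ fun e => p.value m P (c e)| ≤ ε := by
  refine abs_game_le_of_fromChallenge (isState_keyState m) Φ P c hε fun x ρ hρ => ?_
  have e : ∀ e, game (keyState E l m) (E.scheme l).app (KeyBundling.fromChallenge p.A x ρ hρ) []
      p.Lq P (c e) = (p.fromChallenge x ρ hρ).value m P fun _ => c e x := fun e => by
    rw [p.value_fromChallenge]
    exact game_fromChallenge (keyState E l m) (E.scheme l).app p.A x ρ hρ p.Lq P (c e) []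
      (by simp [Admissible])
  exact (congrArg (fun f => |Φ f|) (funext e)).trans_le (h x _)

variable (h : Efficiency E F G O) (hS : PolyBounded padS) (hE : PolyBounded padE)
  {N : ℕ → ℕ} (hN : PolyBounded N)

include h in
theorem Efficiency.polyC_app {I : Type} (φ : I → ℕ) :
    PolyC (X := fun i => Bits (E.fn (φ i)) × Bits (E.inp (φ i))) (Y := fun i => Bits (E.out (φ i)))
      φ fun i p => (E.scheme (φ i)).app p.1 p.2 := by
  have hf := PolyT.bits (h.fn.polyIn φ)
  have hi := PolyT.bits (h.inp.polyIn φ)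
  have hid := PolyC.id (hf.prod hi)
  exact ((hid.fst hf hi).append (hid.snd hf hi)).alg (A := fun i => E.app (φ i)) (h.app.polyIn φ)

include h hN

theorem exists_play_distinguishers {I : Type} {φ nz : I → ℕ}
    (p : ∀ i, BundledPlay E F G O padS padE (φ i) (N (φ i)))
    {Pf : ∀ i, Bits (nz i) → Circuit (tag (φ i)) (E.pk (φ i)) (pkGates E F O padS (φ i))}
    (hP : PolyC φ Pf)
    {mf : ∀ j : Σ i, Bits (tag (φ i)), Bits (nz j.1) → Bits (E.msk (φ j.1))}
    (hm : PolyC (fun j : Σ i, Bits (tag (φ i)) => φ j.1) mf)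
    {cf : ∀ i, Bits (nz i) × Bits (E.inp (φ i) + E.inp (φ i)) →
      Circuit (tag (φ i)) (E.ct (φ i)) (ctGates E F G O padS padE (φ i))} (hc : PolyC φ cf) :
    ∃ D : ∀ i, Distinguisher (nz i), PolyIn φ (fun i => (D i).cost) ∧ ∀ i z, (D i).prob z =
      (p i).value (fun τ => mf ⟨i, τ⟩ z) (Pf i z) fun x => cf i (z, x) :=
  exists_distinguishers (h.fn.polyIn φ) (h.tag.polyIn φ) (h.msk.polyIn φ) hP hm (h.polyC_app φ)
    ((hN.polyIn φ).mono fun i => (p i).cost_le) (q := fun i => E.qkg (φ i)) (h.qkg.polyIn φ)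
    (fun i => (p i).Lp) (fun i => (p i).Lq) (fun i => (p i).map_Lp) (fun i => (p i).map_Lq) hc

theorem exists_play_outer {I : Type} {φ nz ny : I → ℕ}
    (p : ∀ i, BundledPlay E F G O padS padE (φ i) (N (φ i)))
    {Pf : ∀ i, Bits (nz i) → Circuit (tag (φ i)) (E.pk (φ i)) (pkGates E F O padS (φ i))}
    (hP : PolyC φ Pf)
    {mf : ∀ j : Σ i, Bits (tag (φ i)), Bits (nz j.1) → Bits (E.msk (φ j.1))}
    (hm : PolyC (fun j : Σ i, Bits (tag (φ i)) => φ j.1) mf)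
    {cf : ∀ i, Bits (nz i) × Bits (E.inp (φ i) + E.inp (φ i)) × Bits (ny i) →
      Circuit (tag (φ i)) (E.ct (φ i)) (ctGates E F G O padS padE (φ i))} (hc : PolyC φ cf)
    (t : ∀ i, Bits (tag (φ i))) :
    ∃ A' : ∀ i, Adversary (nz i) (E.fn (φ i)) (E.inp (φ i)) (E.sk (φ i)) (ny i),
      PolyIn φ (fun i => (A' i).cost) ∧
      ∀ i (m : Bits (tag (φ i)) → Bits (E.msk (φ i))) (z : Bits (nz i)),
        (∀ τ, τ ≠ t i → m τ = mf ⟨i, τ⟩ z) → (((p i).Lp ++ (p i).Lq).map Prod.snd).Nodup →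
        ∀ {ne : ℕ} (y : Bits (E.inp (φ i) + E.inp (φ i)) → Bits ne → Bits (ny i)),
        untagged (keyState E (φ i) m (t i)) (fun Q => (Q.length : ℕ∞) ≤ 1)
          (fun Q ρ => ∑ x : Bits (E.inp (φ i) + E.inp (φ i)),
            open Classical in
            if Admissible (E.scheme (φ i)).app x Q then expect fun e =>
              untagged (keyState E (φ i) m (t i))
              (fun Q' => (Q'.length : ℕ∞) ≤ 1 ∧ Admissible (E.scheme (φ i)).app x Q')
              (fun _ ρ' => accept ((A' i).guess.sem ρ')) (A' i).post Q
              ((A' i).receive.sem (tensor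
                (outcome ((A' i).challenge.sem ρ) x) (ket (y x e)))) else 0)
          (A' i).pre [] ((A' i).start.sem (tensor (ket z) (A' i).advice)) =
        expect fun e => (p i).value m (Pf i z) fun x => cf i (z, x, y x e) := by
  obtain ⟨A', h1, h2⟩ := exists_outer (h.fn.polyIn φ) (h.tag.polyIn φ) (h.msk.polyIn φ) hP hm
    (h.polyC_app φ) ((hN.polyIn φ).mono fun i => (p i).cost_le) (q := fun i => E.qkg (φ i))
    (h.qkg.polyIn φ) (fun i => (p i).Lp) (fun i => (p i).Lq) (fun i => (p i).map_Lp)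
    (fun i => (p i).map_Lq) hc t
  refine ⟨A', h1, fun i m z hm' hnd ne y => h2 i (keyState E (φ i) m) z (fun τ hτ f => ?_) hnd y⟩
  rw [keyState, hm' τ hτ]

/-! ### Steps between hybrid games -/

variable {α : ℝ}

include hS hE

/-- The input of the distinguisher is the obfuscated circuit itself, used as ciphertext in a
simulated game; play, secret keys, public key and the pair of circuits are fixed data and form the
type `T` over which the bound is uniform. -/
theorem exists_bound_obf_challenge (hO : O.UniformlySecure α)
    [∀ l, Nonempty (BundledPlay E F G O padS padE l (N l))] :
    ∃ C : ℝ, 0 ≤ C ∧ ∀ᶠ l in atTop, ∀ (p : BundledPlay E F G O padS padE l (N l))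
      (m : Bits (tag l) → Bits (E.msk l)) (P : Circuit (tag l) (E.pk l) (pkGates E F O padS l))
      (C₀ C₁ : Circuit (tag l) (E.ct l) (encGates E F G O padS padE l)),
      (∀ τ, C₀.eval τ = C₁.eval τ) →
      |(expect fun c => p.value m P fun _ => O.obf l C₀ c) -
        expect fun c => p.value m P fun _ => O.obf l C₁ c| ≤ C * subExp α l := by
  let T : ℕ → Type := fun l => BundledPlay E F G O padS padE l (N l) ×
    (Bits (tag l) → Bits (E.msk l)) × Circuit (tag l) (E.pk l) (pkGates E F O padS l) ×
    {c : Circuit (tag l) (E.ct l) (encGates E F G O padS padE l) ×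
      Circuit (tag l) (E.ct l) (encGates E F G O padS padE l) // ∀ τ, c.1.eval τ = c.2.eval τ}
  have : ∀ l, Nonempty (T l) := fun l =>
    ⟨Classical.arbitrary _, fun _ _ => false, fun _ => false, ⟨(fun _ => false, fun _ => false),
      fun _ => rfl⟩⟩
  let φ : (Σ l, T l) → ℕ := fun i => i.1
  let nz : (Σ l, T l) → ℕ := fun i => descLen (tag i.1) (E.ct i.1) (ctGates E F G O padS padE i.1) + 0
  have htag := h.tag.polyIn φ
  have hnz : PolyIn φ nz := (PolyIn.descLen htag (h.ct.polyIn φ)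
    ((h.ctGates hS hE).polyIn φ)).add (.const 0)
  have hx : PolyIn φ fun i => E.inp i.1 + E.inp i.1 := (h.inp.polyIn φ).add (h.inp.polyIn φ)
  have hid := PolyC.id ((PolyT.bits hnz).prod (PolyT.bits hx))
  obtain ⟨D, hD, hval⟩ := exists_play_distinguishers h hN (φ := φ) (nz := nz)
    (fun i => i.2.1)
    (PolyC.const (Y := fun i : Σ l, T l => Circuit (tag i.1) (E.pk i.1) (pkGates E F O padS i.1))
      (PolyT.bits hnz) (PolyIn.descLen htag (h.pk.polyIn φ) ((h.pkGates hS).polyIn φ))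
      fun i => i.2.2.2.1)
    -- The table of master secret keys has superpolynomially many entries, but a simulation
    -- hardwires only those at the tags of its rounds; so polynomial size is required for each tag
    -- separately.
    (PolyC.const (X := fun j : Σ i, Bits (tag (φ i)) => Bits (nz j.1))
      (Y := fun j : Σ i, Bits (tag (φ i)) => Bits (E.msk (φ j.1)))
      ((PolyT.bits hnz).reindex Sigma.fst) ((h.msk.polyIn φ).reindex Sigma.fst)
      fun j => j.1.2.2.1 j.2)
    (hid.fst (PolyT.bits hnz) (PolyT.bits hx)).left
  obtain ⟨C, hC, hb⟩ := hO T tag E.ct (encGates E F G O padS padE) (fun l t => t.2.2.2.1.1)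
    (fun l t => t.2.2.2.1.2) D h.tag h.ct (h.encGates hS hE) (fun l t => t.2.2.2.2) hD
  refine ⟨C, hC, hb.mono fun l hl p m P C₀ C₁ hC => ?_⟩
  refine le_of_eq_of_le ?_ (hl (p, m, P, ⟨(C₀, C₁), hC⟩))
  simp only [hval, Bits.append_left]
  rfl

end Steps

open Enc

section Steps

variable {tag : ℕ → ℕ} {E : SDFEAlgs} {F : PPRF tag E.setupCoins} {G : PPRF tag E.encCoins}
  {O : Obfuscator} {padS padE : ℕ → ℕ}

/-- Encryption. -/
def SDFEAlgs.encrypt (E : SDFEAlgs) (l : ℕ) (v : Bits (E.pk l)) (x : Bits (E.inp l))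
    (e : Bits (E.encCoins l)) : Bits (E.ct l) :=
  (E.enc l).eval (Fin.append x (Fin.append v e))

variable (h : Efficiency E F G O) (hS : PolyBounded padS) (hE : PolyBounded padE)
  {N : ℕ → ℕ} (hN : PolyBounded N) {α : ℝ}

section PolyC

variable {I : Type} {φ : I → ℕ} {X : I → Type} [∀ i, Enc (X i)]

include h in
theorem Efficiency.polyC_encrypt {v : ∀ i, X i → Bits (E.pk (φ i))}
    {x : ∀ i, X i → Bits (E.inp (φ i))} {e : ∀ i, X i → Bits (E.encCoins (φ i))}
    (hv : PolyC φ v) (hx : PolyC φ x) (he : PolyC φ e) :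
    PolyC φ fun i w => E.encrypt (φ i) (v i w) (x i w) (e i w) :=
  (hx.append (hv.append he)).alg (A := fun i => E.enc (φ i)) (h.enc.polyIn φ)

include h hS hE in
theorem EncAlt.polyC_obf (alt : EncAlt E F G O padS padE) (t : ∀ i, Bits (tag (φ i)))
    {κ : ∀ i, X i → Bits (G.punctKey (φ i) 1)} {x : ∀ i, X i → Bits (E.inp (φ i) + E.inp (φ i))}
    {y : ∀ i, X i → Bits (E.ct (φ i))}
    {P : ∀ i, X i → Circuit (tag (φ i)) (E.pk (φ i)) (pkGates E F O padS (φ i))}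
    (hκ : PolyC φ κ) (hx : PolyC φ x) (hy : PolyC φ y) (hP : PolyC φ P)
    (c : ∀ i, Bits (O.coins (φ i) (tag (φ i)) (E.ct (φ i)) (encGates E F G O padS padE (φ i)))) :
    PolyC φ fun i w => O.obf (φ i) (alt.circ (φ i) (t i) ((κ i w, x i w, y i w), P i w)) (c i) :=
  PolyC.obf h.obf (PolyIn.self (B := φ)) (h.tag.polyIn φ) (h.ct.polyIn φ)
    ((h.encGates hS hE).polyIn φ)
    (PolyC.comp (alt.polyC.reindex fun i => ⟨φ i, t i⟩) ((hκ.pair (hx.pair hy)).pair hP)) c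

include h hS in
theorem SetupAlt.polyC_obf (alt : SetupAlt E F padS) (t : ∀ i, Bits (tag (φ i)))
    {κ : ∀ i, X i → Bits (F.punctKey (φ i) 1)} {v : ∀ i, X i → Bits (E.pk (φ i))}
    (hκ : PolyC φ κ) (hv : PolyC φ v)
    (c : ∀ i, Bits (O.coins (φ i) (tag (φ i)) (E.pk (φ i)) (setupGates E F padS (φ i)))) :
    PolyC φ fun i w => O.obf (φ i) (alt.circ (φ i) (t i) (κ i w, v i w)) (c i) :=
  PolyC.obf h.obf (PolyIn.self (B := φ)) (h.tag.polyIn φ) (h.pk.polyIn φ)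
    ((h.setupGates hS).polyIn φ)
    (PolyC.comp (alt.polyC.reindex fun i => ⟨φ i, t i⟩) (hκ.pair hv)) c

theorem PolyC.slot_zero {n : I → ℕ} {f : ∀ i, X i → Bits (1 * n i)} (hf : PolyC φ f) :
    PolyC φ fun i w => slot (f i w) 0 :=
  hf.mapBits (hf.cod.mono fun i => (one_mul (n i)).ge) fun _ b => finProdFinEquiv (0, b)

theorem PolyC.choose {n : I → ℕ} {f : ∀ i, X i → Bits (n i + n i)} (hf : PolyC φ f)
    (b : I → Bool) : PolyC φ fun i w => choose (b i) (f i w) :=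
  (PolyC.const hf.dom PolyT.bool b).ite hf.right hf.left

end PolyC

include h hS hE hN

/-- The pair of circuits depends on the plaintexts, whereas obfuscation security needs it fixed
before the game starts; hence the detour through plays that begin with the challenge. -/
theorem exists_bound_obf_enc (hO : O.UniformlySecure α)
    [hne : ∀ l, Nonempty (BundledPlay E F G O padS padE l (N l))] :
    ∃ C : ℝ, 0 ≤ C ∧ ∀ᶠ l in atTop, ∀ (p : BundledPlay E F G O padS padE l (N l))
      (m : Bits (tag l) → Bits (E.msk l)) (P : Circuit (tag l) (E.pk l) (pkGates E F O padS l))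
      (C₀ C₁ : Bits (E.inp l + E.inp l) →
        Circuit (tag l) (E.ct l) (encGates E F G O padS padE l)),
      (∀ x τ, (C₀ x).eval τ = (C₁ x).eval τ) →
      |(expect fun c => p.value m P fun x => O.obf l (C₀ x) c) -
        expect fun c => p.value m P fun x => O.obf l (C₁ x) c| ≤ C * subExp α l := by
  have hN' : PolyBounded fun l => 2 * N l + Circuit.cost 0 (E.inp l + E.inp l) 1 :=
    PolyIn.add (PolyIn.mul (.const 2) hN) (PolyIn.cost (.const 0) (PolyIn.add h.inp h.inp) (.const 1))
  have : ∀ l, Nonempty (BundledPlay E F G O padS padE l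
      (2 * N l + Circuit.cost 0 (E.inp l + E.inp l) 1)) := fun l =>
    (hne l).map fun p => { p with cost_le := p.cost_le.trans (by omega) }
  obtain ⟨C, hC, hb⟩ := exists_bound_obf_challenge h hS hE hN' hO
  refine ⟨C, hC, hb.mono fun l hl p m P C₀ C₁ heq => ?_⟩
  exact p.abs_le_of_fromChallenge m P
    -- The difference of the two averages is a single linear functional, on functions of a coin
    -- string labelled by which circuit it obfuscates.
    ((expectL _).comp (LinearMap.funLeft ℝ ℝ Sum.inl) -
      (expectL _).comp (LinearMap.funLeft ℝ ℝ Sum.inr))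
    (Sum.elim (fun c x => O.obf l (C₀ x) c) fun c x => O.obf l (C₁ x) c)
    (mul_nonneg hC (subExp_nonneg α l)) fun x p' => hl p' m P (C₀ x) (C₁ x) (heq x)

/-- Public key and secret keys do not involve `G`, so they can be fixed. The sample, a punctured key
with the value at `i` or with random coins, is used only to build the ciphertext. -/
theorem exists_bound_prf_challenge (alt : EncAlt E F G O padS padE) (hG : G.UniformlySecure α)
    [∀ l, Nonempty (BundledPlay E F G O padS padE l (N l))] :
    ∃ C : ℝ, 0 ≤ C ∧ ∀ᶠ l in atTop, ∀ (p : BundledPlay E F G O padS padE l (N l))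
      (m : Bits (tag l) → Bits (E.msk l)) (P : Circuit (tag l) (E.pk l) (pkGates E F O padS l))
      (i : Bits (tag l)) (v : Bits (E.pk l)) (b : Bool) (x : Bits (E.inp l + E.inp l))
      (c : Bits (O.coins l (tag l) (E.ct l) (encGates E F G O padS padE l))),
      |(expect fun g => expect fun r => p.value m P fun _ => O.obf l (alt.circ l i
          ((G.punctured l (G.genKey l g) (fun _ => i) r, x,
            E.encrypt l v (choose b x) (G.value l (G.genKey l g) i)), P)) c) -
        expect fun g => expect fun r => expect fun u => p.value m P fun _ => O.obf l (alt.circ l i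
          ((G.punctured l (G.genKey l g) (fun _ => i) r, x, E.encrypt l v (choose b x) u), P)) c| ≤
        C * subExp α l := by
  let T : ℕ → Type := fun l => BundledPlay E F G O padS padE l (N l) ×
    (Bits (tag l) → Bits (E.msk l)) × Circuit (tag l) (E.pk l) (pkGates E F O padS l) ×
    Bits (tag l) × Bits (E.pk l) × Bool × Bits (E.inp l + E.inp l) ×
    Bits (O.coins l (tag l) (E.ct l) (encGates E F G O padS padE l))
  have : ∀ l, Nonempty (T l) := fun l =>
    ⟨Classical.arbitrary _, fun _ _ => false, fun _ => false, fun _ => false, fun _ => false, false,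
      fun _ => false, fun _ => false⟩
  let φ : (Σ l, T l) → ℕ := fun i => i.1
  let nz : (Σ l, T l) → ℕ := fun i => G.punctKey i.1 1 + 1 * E.encCoins i.1
  have htag := h.tag.polyIn φ
  have hnz : PolyIn φ nz := (h.punctKeyG.polyIn φ).add ((PolyIn.const 1).mul (h.encCoins.polyIn φ))
  have hx : PolyIn φ fun i => E.inp i.1 + E.inp i.1 := (h.inp.polyIn φ).add (h.inp.polyIn φ)
  have hPT : PolyT φ fun i : Σ l, T l => Circuit (tag i.1) (E.pk i.1) (pkGates E F O padS i.1) :=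
    PolyIn.descLen htag (h.pk.polyIn φ) ((h.pkGates hS).polyIn φ)
  have hid := PolyC.id ((PolyT.bits hnz).prod (PolyT.bits hx))
  have z := hid.fst (PolyT.bits hnz) (PolyT.bits hx)
  have cx := PolyC.const (Y := fun i : Σ l, T l => Bits (E.inp i.1 + E.inp i.1)) hid.dom
    (PolyT.bits hx) fun i => i.2.2.2.2.2.2.2.1
  obtain ⟨D, hD, hval⟩ := exists_play_distinguishers h hN (φ := φ) (nz := nz)
    (fun i => i.2.1)
    (PolyC.const (PolyT.bits hnz) hPT fun i => i.2.2.2.1)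
    (PolyC.const (X := fun j : Σ i, Bits (tag (φ i)) => Bits (nz j.1))
      (Y := fun j : Σ i, Bits (tag (φ i)) => Bits (E.msk (φ j.1)))
      ((PolyT.bits hnz).reindex Sigma.fst) ((h.msk.polyIn φ).reindex Sigma.fst)
      fun j => j.1.2.2.1 j.2)
    (alt.polyC_obf h hS hE (fun i => i.2.2.2.2.1) z.left cx
      (h.polyC_encrypt (PolyC.const (Y := fun i : Σ l, T l => Bits (E.pk i.1)) hid.dom
        (PolyT.bits (h.pk.polyIn φ)) fun i => i.2.2.2.2.2.1)
        (cx.choose fun i => i.2.2.2.2.2.2.1) z.right.slot_zero)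
      (PolyC.const hid.dom hPT fun i => i.2.2.2.1) fun i => i.2.2.2.2.2.2.2.2)
  obtain ⟨C, hC, hb⟩ := hG T (fun l t => t.2.2.2.1) D hD (fun l t κ e =>
    t.1.value t.2.1 t.2.2.1 fun _ => O.obf l (alt.circ l t.2.2.2.1 ((κ, t.2.2.2.2.2.2.1,
      E.encrypt l t.2.2.2.2.1 (choose t.2.2.2.2.2.1 t.2.2.2.2.2.2.1) e), t.2.2.1))
      t.2.2.2.2.2.2.2) fun l t z => hval ⟨l, t⟩ z
  exact ⟨C, hC, hb.mono fun l hl p m P i v b x c => hl (p, m, P, i, v, b, x, c)⟩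

theorem exists_bound_prf_enc (alt : EncAlt E F G O padS padE) (hG : G.UniformlySecure α)
    [hne : ∀ l, Nonempty (BundledPlay E F G O padS padE l (N l))] :
    ∃ C : ℝ, 0 ≤ C ∧ ∀ᶠ l in atTop, ∀ (p : BundledPlay E F G O padS padE l (N l))
      (m : Bits (tag l) → Bits (E.msk l)) (P : Circuit (tag l) (E.pk l) (pkGates E F O padS l))
      (i : Bits (tag l)) (v : Bits (E.pk l)) (b : Bool)
      (c : Bits (O.coins l (tag l) (E.ct l) (encGates E F G O padS padE l))),
      |(expect fun g => expect fun r => p.value m P fun x => O.obf l (alt.circ l i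
          ((G.punctured l (G.genKey l g) (fun _ => i) r, x,
            E.encrypt l v (choose b x) (G.value l (G.genKey l g) i)), P)) c) -
        expect fun g => expect fun r => expect fun u => p.value m P fun x => O.obf l (alt.circ l i
          ((G.punctured l (G.genKey l g) (fun _ => i) r, x, E.encrypt l v (choose b x) u), P)) c| ≤
        C * subExp α l := by
  have hN' : PolyBounded fun l => 2 * N l + Circuit.cost 0 (E.inp l + E.inp l) 1 :=
    PolyIn.add (PolyIn.mul (.const 2) hN) (PolyIn.cost (.const 0) (PolyIn.add h.inp h.inp) (.const 1))
  have : ∀ l, Nonempty (BundledPlay E F G O padS padE l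
      (2 * N l + Circuit.cost 0 (E.inp l + E.inp l) 1)) := fun l =>
    (hne l).map fun p => { p with cost_le := p.cost_le.trans (by omega) }
  obtain ⟨C, hC, hb⟩ := exists_bound_prf_challenge h hS hE hN' alt hG
  refine ⟨C, hC, hb.mono fun l hl p m P i v b c => ?_⟩
  have hΦ := p.abs_le_of_fromChallenge m P
    (X := Bits (G.genCoins l) × Bits (G.punctCoins l 1) × Bits (E.encCoins l))
    -- One linear functional on functions of key coins, puncturing coins and encryption coins: the
    -- first part substitutes the PRF value for the encryption coins, the second averages over them.
    ((expectL _).comp (LinearMap.pi fun g => (expectL _).comp (LinearMap.pi fun r =>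
        LinearMap.proj (g, r, G.value l (G.genKey l g) i))) -
      (expectL _).comp (LinearMap.pi fun g => (expectL _).comp (LinearMap.pi fun r =>
        (expectL _).comp (LinearMap.pi fun u => LinearMap.proj (g, r, u)))))
    (fun e x => O.obf l (alt.circ l i ((G.punctured l (G.genKey l e.1) (fun _ => i) e.2.1, x,
      E.encrypt l v (choose b x) e.2.2), P)) c)
    (mul_nonneg hC (subExp_nonneg α l)) fun x p' => hl p' m P i v b x c
  exact hΦ

/-- The sample is the public key; it is given to the adversary and also placed inside the ciphertext
circuit. The secret keys `m` and the public key `v` at the tag `i` are fixed data, so no PRF key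
needs to be known. -/
theorem exists_bound_obf_setup (alt : EncAlt E F G O padS padE) (hO : O.UniformlySecure α)
    [∀ l, Nonempty (BundledPlay E F G O padS padE l (N l))] :
    ∃ C : ℝ, 0 ≤ C ∧ ∀ᶠ l in atTop, ∀ (p : BundledPlay E F G O padS padE l (N l))
      (m : Bits (tag l) → Bits (E.msk l))
      (C₀ C₁ : Circuit (tag l) (E.pk l) (setupGates E F padS l))
      (i : Bits (tag l)) (v : Bits (E.pk l)) (b : Bool) (κ : Bits (G.punctKey l 1))
      (u : Bits (E.encCoins l))
      (c : Bits (O.coins l (tag l) (E.ct l) (encGates E F G O padS padE l))),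
      (∀ τ, C₀.eval τ = C₁.eval τ) →
      |(expect fun d => p.value m (O.obf l C₀ d) fun x => O.obf l (alt.circ l i
          ((κ, x, E.encrypt l v (choose b x) u), O.obf l C₀ d)) c) -
        expect fun d => p.value m (O.obf l C₁ d) fun x => O.obf l (alt.circ l i
          ((κ, x, E.encrypt l v (choose b x) u), O.obf l C₁ d)) c| ≤ C * subExp α l := by
  let T : ℕ → Type := fun l => BundledPlay E F G O padS padE l (N l) ×
    (Bits (tag l) → Bits (E.msk l)) ×
    {c : Circuit (tag l) (E.pk l) (setupGates E F padS l) ×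
      Circuit (tag l) (E.pk l) (setupGates E F padS l) // ∀ τ, c.1.eval τ = c.2.eval τ} ×
    Bits (tag l) × Bits (E.pk l) × Bool × Bits (G.punctKey l 1) × Bits (E.encCoins l) ×
    Bits (O.coins l (tag l) (E.ct l) (encGates E F G O padS padE l))
  have : ∀ l, Nonempty (T l) := fun l =>
    ⟨Classical.arbitrary _, fun _ _ => false, ⟨(fun _ => false, fun _ => false), fun _ => rfl⟩,
      fun _ => false, fun _ => false, false, fun _ => false, fun _ => false, fun _ => false⟩
  let φ : (Σ l, T l) → ℕ := fun i => i.1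
  let nz : (Σ l, T l) → ℕ := fun i => descLen (tag i.1) (E.pk i.1) (pkGates E F O padS i.1) + 0
  have htag := h.tag.polyIn φ
  have hnz : PolyIn φ nz := (PolyIn.descLen htag (h.pk.polyIn φ)
    ((h.pkGates hS).polyIn φ)).add (.const 0)
  have hx : PolyIn φ fun i => E.inp i.1 + E.inp i.1 := (h.inp.polyIn φ).add (h.inp.polyIn φ)
  have hid := PolyC.id ((PolyT.bits hnz).prod (PolyT.bits hx))
  have z := hid.fst (PolyT.bits hnz) (PolyT.bits hx)
  have x := hid.snd (PolyT.bits hnz) (PolyT.bits hx)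
  obtain ⟨D, hD, hval⟩ := exists_play_distinguishers h hN (φ := φ) (nz := nz)
    (fun i => i.2.1) (PolyC.id (PolyT.bits hnz)).left
    (PolyC.const (X := fun j : Σ i, Bits (tag (φ i)) => Bits (nz j.1))
      (Y := fun j : Σ i, Bits (tag (φ i)) => Bits (E.msk (φ j.1)))
      ((PolyT.bits hnz).reindex Sigma.fst) ((h.msk.polyIn φ).reindex Sigma.fst)
      fun j => j.1.2.2.1 j.2)
    (alt.polyC_obf h hS hE (fun i => i.2.2.2.2.1)
      (PolyC.const (Y := fun i : Σ l, T l => Bits (G.punctKey i.1 1)) hid.dom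
        (PolyT.bits (h.punctKeyG.polyIn φ)) fun i => i.2.2.2.2.2.2.2.1) x
      (h.polyC_encrypt (PolyC.const (Y := fun i : Σ l, T l => Bits (E.pk i.1)) hid.dom
        (PolyT.bits (h.pk.polyIn φ)) fun i => i.2.2.2.2.2.1)
        (x.choose fun i => i.2.2.2.2.2.2.1)
        (PolyC.const (Y := fun i : Σ l, T l => Bits (E.encCoins i.1)) hid.dom
          (PolyT.bits (h.encCoins.polyIn φ)) fun i => i.2.2.2.2.2.2.2.2.1))
      z.left fun i => i.2.2.2.2.2.2.2.2.2)
  obtain ⟨C, hC, hb⟩ := hO T tag E.pk (setupGates E F padS) (fun l t => t.2.2.1.1.1)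
    (fun l t => t.2.2.1.1.2) D h.tag h.pk (h.setupGates hS) (fun l t => t.2.2.1.2) hD
  refine ⟨C, hC, hb.mono fun l hl p m C₀ C₁ i v b κ u c hC => ?_⟩
  refine le_of_eq_of_le ?_ (hl (p, m, ⟨(C₀, C₁), hC⟩, i, v, b, κ, u, c))
  simp only [hval, Bits.append_left]
  rfl

/-- The coins at `i` determine the public key and the master secret key at `i`; all other tags are
served by the punctured key. So the whole game can be simulated from the sample, including a query
at `i`. -/
theorem exists_bound_prf_setup (altS : SetupAlt E F padS) (alt : EncAlt E F G O padS padE)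
    (hF : F.UniformlySecure α) [∀ l, Nonempty (BundledPlay E F G O padS padE l (N l))] :
    ∃ C : ℝ, 0 ≤ C ∧ ∀ᶠ l in atTop, ∀ (p : BundledPlay E F G O padS padE l (N l))
      (i : Bits (tag l)) (b : Bool) (κ : Bits (G.punctKey l 1)) (u : Bits (E.encCoins l))
      (d : Bits (O.coins l (tag l) (E.pk l) (setupGates E F padS l)))
      (c : Bits (O.coins l (tag l) (E.ct l) (encGates E F G O padS padE l))),
      let f := fun (κ' : Bits (F.punctKey l 1)) (r : Bits (E.setupCoins l)) =>
        let P := O.obf l (altS.circ l i (κ', ((E.setup l).eval r).left)) d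
        p.value (fun τ => if τ = i then ((E.setup l).eval r).right else
            ((E.setup l).eval ((F.fnPunct l 1).eval (Fin.append κ' τ))).right) P
          fun x => O.obf l (alt.circ l i
            ((κ, x, E.encrypt l ((E.setup l).eval r).left (choose b x) u), P)) c
      |(expect fun g => expect fun r => f (F.punctured l (F.genKey l g) (fun _ => i) r)
          (F.value l (F.genKey l g) i)) -
        expect fun g => expect fun r => expect fun v =>
          f (F.punctured l (F.genKey l g) (fun _ => i) r) v| ≤ C * subExp α l := by
  let T : ℕ → Type := fun l => BundledPlay E F G O padS padE l (N l) × Bits (tag l) × Bool ×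
    Bits (G.punctKey l 1) × Bits (E.encCoins l) ×
    Bits (O.coins l (tag l) (E.pk l) (setupGates E F padS l)) ×
    Bits (O.coins l (tag l) (E.ct l) (encGates E F G O padS padE l))
  have : ∀ l, Nonempty (T l) := fun l =>
    ⟨Classical.arbitrary _, fun _ => false, false, fun _ => false, fun _ => false, fun _ => false,
      fun _ => false⟩
  let φ : (Σ l, T l) → ℕ := fun i => i.1
  let nz : (Σ l, T l) → ℕ := fun i => F.punctKey i.1 1 + 1 * E.setupCoins i.1
  have htag := h.tag.polyIn φ
  have hnz : PolyIn φ nz :=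
    (h.punctKeyF.polyIn φ).add ((PolyIn.const 1).mul (h.setupCoins.polyIn φ))
  have hx : PolyIn φ fun i => E.inp i.1 + E.inp i.1 := (h.inp.polyIn φ).add (h.inp.polyIn φ)
  have zid := PolyC.id (PolyT.bits hnz)
  have zv := (zid.right.slot_zero.alg (A := fun i => E.setup i.1) (h.setup.polyIn φ)).left
  have zP := altS.polyC_obf h hS (fun i : Σ l, T l => i.2.2.1) zid.left zv
    fun i => i.2.2.2.2.2.2.1
  have hid := PolyC.id ((PolyT.bits hnz).prod (PolyT.bits hx))
  have z := hid.fst (PolyT.bits hnz) (PolyT.bits hx)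
  have x := hid.snd (PolyT.bits hnz) (PolyT.bits hx)
  let J := Σ i : Σ l, T l, Bits (tag (φ i))
  let ψ : J → ℕ := fun j => φ j.1
  have jid := PolyC.id ((PolyT.bits hnz).reindex (Sigma.fst : J → _))
  have jτ := PolyC.const (Y := fun j : J => Bits (tag (ψ j))) jid.dom
    (PolyT.bits (h.tag.polyIn ψ)) fun j => j.2
  have ji := PolyC.const (Y := fun j : J => Bits (tag (ψ j))) jid.dom
    (PolyT.bits (h.tag.polyIn ψ)) fun j => j.1.2.2.1
  have jz := PolyC.left (m := fun j : J => F.punctKey (ψ j) 1)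
    (n := fun j : J => 1 * E.setupCoins (ψ j)) jid
  have jr := PolyC.right (m := fun j : J => F.punctKey (ψ j) 1)
    (n := fun j : J => 1 * E.setupCoins (ψ j)) jid
  have j1 := (jr.slot_zero.alg (A := fun j => E.setup (ψ j)) (h.setup.polyIn ψ)).right
  have j2 := (((jz.append jτ).alg (A := fun j => F.fnPunct (ψ j) 1) (h.fnPunctF.polyIn ψ)).alg
    (A := fun j => E.setup (ψ j)) (h.setup.polyIn ψ)).right
  have hm := (jτ.decEq ji).ite j1 j2
  obtain ⟨D, hD, hval⟩ := exists_play_distinguishers h hN (φ := φ) (nz := nz)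
    (fun i => i.2.1) zP hm
    (alt.polyC_obf h hS hE (fun i => i.2.2.1)
      (PolyC.const (Y := fun i : Σ l, T l => Bits (G.punctKey i.1 1)) hid.dom
        (PolyT.bits (h.punctKeyG.polyIn φ)) fun i => i.2.2.2.2.1) x
      (h.polyC_encrypt (PolyC.comp zv z) (x.choose fun i => i.2.2.2.1)
        (PolyC.const (Y := fun i : Σ l, T l => Bits (E.encCoins i.1)) hid.dom
          (PolyT.bits (h.encCoins.polyIn φ)) fun i => i.2.2.2.2.2.1))
      (PolyC.comp zP z) fun i => i.2.2.2.2.2.2.2)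
  simp only [decide_eq_true_eq] at hval
  obtain ⟨C, hC, hb⟩ := hF T (fun l t => t.2.1) D hD (fun l t κ' r =>
    t.1.value (fun τ => if τ = t.2.1 then ((E.setup l).eval r).right else
        ((E.setup l).eval ((F.fnPunct l 1).eval (Fin.append κ' τ))).right)
      (O.obf l (altS.circ l t.2.1 (κ', ((E.setup l).eval r).left)) t.2.2.2.2.2.1)
      fun x => O.obf l (alt.circ l t.2.1 ((t.2.2.2.1, x,
        E.encrypt l ((E.setup l).eval r).left (choose t.2.2.1 x) t.2.2.2.2.1),
        O.obf l (altS.circ l t.2.1 (κ', ((E.setup l).eval r).left)) t.2.2.2.2.2.1))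
        t.2.2.2.2.2.2) fun l t z => hval ⟨l, t⟩ z
  exact ⟨C, hC, hb.mono fun l hl p i b κ u d c => hl (p, i, b, κ, u, d, c)⟩

end Steps

open Enc

/-! ### The step that uses single-key security -/

section SingleKey

variable {tag : ℕ → ℕ} {E : SDFEAlgs} {F : PPRF tag E.setupCoins} {G : PPRF tag E.encCoins}
  {O : Obfuscator} {padS padE : ℕ → ℕ}

/-- The challenger's public key becomes the entry at `i` of the setup circuit, and its ciphertext
the entry at `i` of the encryption circuit; a key for `i` comes from its oracle. The other keys are
made from the punctured key `κ'`, which is a constant of the reduction. -/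
theorem exists_bound_singleKey (h : Efficiency E F G O) (hS : PolyBounded padS)
    (hE : PolyBounded padE) {N : ℕ → ℕ} (hN : PolyBounded N) {α : ℝ}
    (altS : SetupAlt E F padS) (alt : EncAlt E F G O padS padE)
    (hsec : UniformlySingleKeySecure E.scheme α)
    [∀ l, Nonempty (BundledPlay E F G O padS padE l (N l))] :
    ∃ C : ℝ, 0 ≤ C ∧ ∀ᶠ l in atTop, ∀ (p : BundledPlay E F G O padS padE l (N l))
      (i : Bits (tag l)) (κ' : Bits (F.punctKey l 1)) (κ : Bits (G.punctKey l 1))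
      (d : Bits (O.coins l (tag l) (E.pk l) (setupGates E F padS l)))
      (c : Bits (O.coins l (tag l) (E.ct l) (encGates E F G O padS padE l))),
      ((p.Lp ++ p.Lq).map Prod.snd).Nodup →
      let f := fun (b : Bool) (r : Bits (E.setupCoins l)) (u : Bits (E.encCoins l)) =>
        let P := O.obf l (altS.circ l i (κ', ((E.setup l).eval r).left)) d
        p.value (fun τ => if τ = i then ((E.setup l).eval r).right else
            ((E.setup l).eval ((F.fnPunct l 1).eval (Fin.append κ' τ))).right) P
          fun x => O.obf l (alt.circ l i
            ((κ, x, E.encrypt l ((E.setup l).eval r).left (choose b x) u), P)) c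
      |(expect fun r => expect fun u => f false r u) - expect fun r => expect fun u => f true r u| ≤
        C * subExp α l := by
  let T : ℕ → Type := fun l => BundledPlay E F G O padS padE l (N l) × Bits (tag l) ×
    Bits (F.punctKey l 1) × Bits (G.punctKey l 1) ×
    Bits (O.coins l (tag l) (E.pk l) (setupGates E F padS l)) ×
    Bits (O.coins l (tag l) (E.ct l) (encGates E F G O padS padE l))
  have : ∀ l, Nonempty (T l) := fun l =>
    ⟨Classical.arbitrary _, fun _ => false, fun _ => false, fun _ => false, fun _ => false,
      fun _ => false⟩
  let φ : (Σ l, T l) → ℕ := fun i => i.1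
  have hpk : PolyIn φ fun i => E.pk i.1 := h.pk.polyIn φ
  have hct : PolyIn φ fun i => E.ct i.1 := h.ct.polyIn φ
  have hx : PolyIn φ fun i => E.inp i.1 + E.inp i.1 := (h.inp.polyIn φ).add (h.inp.polyIn φ)
  have zP := altS.polyC_obf h hS (fun i : Σ l, T l => i.2.2.1)
    (PolyC.const (Y := fun i : Σ l, T l => Bits (F.punctKey i.1 1)) (PolyT.bits hpk)
      (PolyT.bits (h.punctKeyF.polyIn φ)) fun i => i.2.2.2.1) (PolyC.id (PolyT.bits hpk))
    fun i => i.2.2.2.2.2.1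
  have hxy := (PolyT.bits hx).prod (PolyT.bits hct)
  have hid := PolyC.id ((PolyT.bits hpk).prod hxy)
  have z := hid.fst (PolyT.bits hpk) hxy
  have x := (hid.snd (PolyT.bits hpk) hxy).fst (PolyT.bits hx) (PolyT.bits hct)
  have y := (hid.snd (PolyT.bits hpk) hxy).snd (PolyT.bits hx) (PolyT.bits hct)
  obtain ⟨A', hA', hval⟩ := exists_play_outer h hN (φ := φ) (nz := fun i => E.pk i.1)
    (ny := fun i => E.ct i.1) (fun i => i.2.1) zP
    (PolyC.const (X := fun j : Σ i, Bits (tag (φ i)) => Bits (E.pk (φ j.1)))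
      (Y := fun j : Σ i, Bits (tag (φ i)) => Bits (E.msk (φ j.1)))
      (h.pk.polyIn fun j : Σ i, Bits (tag (φ i)) => φ j.1)
      (h.msk.polyIn fun j : Σ i, Bits (tag (φ i)) => φ j.1) fun j => ((E.setup (φ j.1)).eval
        ((F.fnPunct (φ j.1) 1).eval (Fin.append j.1.2.2.2.1 j.2))).right)
    (alt.polyC_obf h hS hE (fun i => i.2.2.1)
      (PolyC.const (Y := fun i : Σ l, T l => Bits (G.punctKey i.1 1)) hid.dom
        (PolyT.bits (h.punctKeyG.polyIn φ)) fun i => i.2.2.2.2.1) x y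
      (PolyC.comp zP z) fun i => i.2.2.2.2.2.2) fun i => i.2.2.1
  obtain ⟨C, hC, hb⟩ := hsec T A' hA'
  refine ⟨C, hC, hb.mono fun l hl p i κ' κ d c hnd => ?_⟩
  have hexp : ∀ b, (E.scheme l).experiment 1 (A' ⟨l, p, i, κ', κ, d, c⟩) b =
      expect fun r => expect fun u => p.value (fun τ => if τ = i then ((E.setup l).eval r).right else
          ((E.setup l).eval ((F.fnPunct l 1).eval (Fin.append κ' τ))).right)
        (O.obf l (altS.circ l i (κ', ((E.setup l).eval r).left)) d)
        fun x => O.obf l (alt.circ l i ((κ, x, E.encrypt l ((E.setup l).eval r).left (choose b x) u),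
          O.obf l (altS.circ l i (κ', ((E.setup l).eval r).left)) d)) c := by
    intro b
    refine (experiment_eq_untagged _ _ _ _).trans (congrArg expect (funext fun r => ?_))
    -- At the tag `i` the game uses the challenger's master secret key, so its key state is the
    -- oracle's answer.
    have hk : keyState E l (fun τ => if τ = i then ((E.setup l).eval r).right else
        ((E.setup l).eval ((F.fnPunct l 1).eval (Fin.append κ' τ))).right) i =
        (E.scheme l).qkg ((E.scheme l).setup r).2 := by
      funext f
      simp only [keyState, if_true]
      rfl
    have h1 := hval ⟨l, p, i, κ', κ, d, c⟩ (fun τ => if τ = i then ((E.setup l).eval r).right else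
      ((E.setup l).eval ((F.fnPunct l 1).eval (Fin.append κ' τ))).right)
      ((E.setup l).eval r).left (fun τ hτ => if_neg hτ) hnd
      fun x u => E.encrypt l ((E.setup l).eval r).left (choose b x) u
    refine Eq.trans ?_ h1
    simp only [φ]
    rw [hk]
    rfl
  have h2 := hl (p, i, κ', κ, d, c)
  rw [hexp, hexp] at h2
  exact h2

end SingleKey

open Enc

/-! ### Expectations over several strings -/

section Averages

variable {a b c d : ℕ}

theorem expect_rotate (f : Bits a → Bits b → Bits c → ℝ) :
    (expect fun x => expect fun y => expect fun z => f x y z) =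
      expect fun z => expect fun x => expect fun y => f x y z :=
  (congrArg expect (funext fun _ => expect_comm _)).trans (expect_comm _)

/-- Average over four strings. -/
def avg4 (a b c d : ℕ) : ((Bits a × Bits b × Bits c × Bits d) → ℝ) →ₗ[ℝ] ℝ :=
  (expectL a).comp (LinearMap.pi fun x => (expectL b).comp (LinearMap.pi fun y =>
    (expectL c).comp (LinearMap.pi fun z => (expectL d).comp (LinearMap.pi fun w =>
      LinearMap.proj (x, y, z, w)))))

theorem avg4_apply (f : Bits a × Bits b × Bits c × Bits d → ℝ) : avg4 a b c d f =
    expect fun x => expect fun y => expect fun z => expect fun w => f (x, y, z, w) := rfl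

theorem abs_avg4_sub_le {f g : Bits a × Bits b × Bits c × Bits d → ℝ} {ε : ℝ}
    (h : ∀ x, |f x - g x| ≤ ε) : |avg4 a b c d f - avg4 a b c d g| ≤ ε :=
  abs_expect_sub_le fun _ => abs_expect_sub_le fun _ => abs_expect_sub_le fun _ =>
    abs_expect_sub_le fun _ => h _

end Averages

/-! ### Evaluation of the circuits of the scheme -/

section Hybrids

variable {tag : ℕ → ℕ} {E : SDFEAlgs} {F : PPRF tag E.setupCoins} {G : PPRF tag E.encCoins}
  {O : Obfuscator} {padS padE : ℕ → ℕ} {l N : ℕ}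

theorem eval_setupCircuit (K : Bits (F.key l)) (τ : Bits (tag l)) :
    (setupCircuit E F padS l K).eval τ = ((E.setup l).eval (F.value l K τ)).left := by
  rw [setupCircuit, Circuit.eval_pad, Circuit.eval_comp, Circuit.eval_take, Circuit.eval_hardwire]
  rfl

theorem eval_encCircuit (P : Circuit (tag l) (E.pk l) (pkGates E F O padS l)) (K : Bits (G.key l))
    (x : Bits (E.inp l)) (τ : Bits (tag l)) : (encCircuit E F G O padS padE l P K x).eval τ =
      E.encrypt l (P.eval τ) x (G.value l K τ) := by
  rw [encCircuit, Circuit.eval_pad, Circuit.eval_comp, Circuit.eval_pair, Circuit.eval_hardwire,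
    Circuit.eval_hardwire]
  rfl

theorem PPRF.PuncturedCorrectness.eval_fnPunct {inLen outLen : ℕ → ℕ} {F : PPRF inLen outLen}
    (hF : F.PuncturedCorrectness) (g : Bits (F.genCoins l)) (i : Bits (inLen l))
    (r : Bits (F.punctCoins l 1)) {τ : Bits (inLen l)} (hτ : τ ≠ i) :
    (F.fnPunct l 1).eval (Fin.append (F.punctured l (F.genKey l g) (fun _ => i) r) τ) =
      F.value l (F.genKey l g) τ :=
  hF l 1 (fun _ => i) (fun a b _ => Subsingleton.elim a b) g r τ (by simpa using hτ)

/-- Away from `i` the punctured key still gives the true coins, and at `i` the hardwired ciphertext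
was made with the true coins: the circuit encrypts honestly, and only the choice of plaintext varies
with the tag. -/
theorem EncAlt.eval_circ_punctured (alt : EncAlt E F G O padS padE) (hG : G.PuncturedCorrectness)
    (i : Bits (tag l)) (P : Circuit (tag l) (E.pk l) (pkGates E F O padS l))
    (g : Bits (G.genCoins l)) (r : Bits (G.punctCoins l 1)) (b : Bool)
    (x : Bits (E.inp l + E.inp l)) (τ : Bits (tag l)) :
    (alt.circ l i ((G.punctured l (G.genKey l g) (fun _ => i) r, x,
      E.encrypt l (P.eval i) (choose b x) (G.value l (G.genKey l g) i)), P)).eval τ =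
      E.encrypt l (P.eval τ) (choose (if τ = i then b else τ.lt i) x)
        (G.value l (G.genKey l g) τ) := by
  rw [alt.eval_circ]
  split_ifs with hτ
  · rw [hτ]
  · rw [hG.eval_fnPunct g i r hτ]
    rfl

theorem SetupAlt.eval_circ_punctured (alt : SetupAlt E F padS) (hF : F.PuncturedCorrectness)
    (i : Bits (tag l)) (g : Bits (F.genCoins l)) (r : Bits (F.punctCoins l 1))
    (τ : Bits (tag l)) : (alt.circ l i (F.punctured l (F.genKey l g) (fun _ => i) r,
      ((E.setup l).eval (F.value l (F.genKey l g) i)).left)).eval τ =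
      (setupCircuit E F padS l (F.genKey l g)).eval τ := by
  rw [alt.eval_circ, eval_setupCircuit]
  split_ifs with hτ
  · rw [hτ]
  · rw [hF.eval_fnPunct g i r hτ]

theorem tagMsk_eq_punctured (hF : F.PuncturedCorrectness) (i : Bits (tag l))
    (g : Bits (F.genCoins l)) (r : Bits (F.punctCoins l 1)) :
    tagMsk E F l (F.genKey l g) = fun τ =>
      if τ = i then ((E.setup l).eval (F.value l (F.genKey l g) i)).right else
        ((E.setup l).eval ((F.fnPunct l 1).eval (Fin.append
          (F.punctured l (F.genKey l g) (fun _ => i) r) τ))).right := by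
  funext τ
  rw [tagMsk]
  split_ifs with hτ
  · rw [hτ]
  · rw [hF.eval_fnPunct g i r hτ]

/-! ### Hybrid games -/

/-- The obfuscated setup circuit. -/
def publicKey (E : SDFEAlgs) (F : PPRF tag E.setupCoins) (O : Obfuscator) (padS : ℕ → ℕ) (l : ℕ)
    (r : Bits (F.genCoins l)) (d : Bits (O.coins l (tag l) (E.pk l) (setupGates E F padS l))) :
    Circuit (tag l) (E.pk l) (pkGates E F O padS l) :=
  O.obf l (setupCircuit E F padS l (F.genKey l r)) d

variable (p : BundledPlay E F G O padS padE l N)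

/-- The game of the scheme, with the given tags. -/
def BundledPlay.real (b : Bool) : ℝ :=
  expect fun r : Bits (F.genCoins l) => expect fun d => expect fun r' : Bits (G.genCoins l) =>
    expect fun c => p.value (tagMsk E F l (F.genKey l r)) (publicKey E F O padS l r d) fun x =>
      O.obf l (encCircuit E F G O padS padE l (publicKey E F O padS l r d) (G.genKey l r')
        (choose b x)) c

/-- The game with the ciphertexts made by `alt`. -/
def EncAlt.value (alt : EncAlt E F G O padS padE) (p : BundledPlay E F G O padS padE l N)
    (m : Bits (tag l) → Bits (E.msk l)) (P : Circuit (tag l) (E.pk l) (pkGates E F O padS l))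
    (i : Bits (tag l)) (v : Bits (E.pk l)) (b : Bool) (κ : Bits (G.punctKey l 1))
    (u : Bits (E.encCoins l))
    (c : Bits (O.coins l (tag l) (E.ct l) (encGates E F G O padS padE l))) : ℝ :=
  p.value m P fun x => O.obf l (alt.circ l i ((κ, x, E.encrypt l v (choose b x) u), P)) c

variable (altS : SetupAlt E F padS) (alt : EncAlt E F G O padS padE)

/-- The game in which the tag `i` has the setup coins `v` and the encryption coins `u`. -/
def tagValue (i : Bits (tag l)) (b : Bool) (κ : Bits (G.punctKey l 1)) (u : Bits (E.encCoins l))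
    (d : Bits (O.coins l (tag l) (E.pk l) (setupGates E F padS l)))
    (c : Bits (O.coins l (tag l) (E.ct l) (encGates E F G O padS padE l)))
    (κ' : Bits (F.punctKey l 1)) (v : Bits (E.setupCoins l)) : ℝ :=
  alt.value p (fun τ => if τ = i then ((E.setup l).eval v).right else
      ((E.setup l).eval ((F.fnPunct l 1).eval (Fin.append κ' τ))).right)
    (O.obf l (altS.circ l i (κ', ((E.setup l).eval v).left)) d) i ((E.setup l).eval v).left b κ u c

/-- The key of `F`, punctured at `i`. -/
def punctAt {inLen outLen : ℕ → ℕ} (F : PPRF inLen outLen) (l : ℕ) (i : Bits (inLen l))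
    (g : Bits (F.genCoins l)) (r : Bits (F.punctCoins l 1)) : Bits (F.punctKey l 1) :=
  F.punctured l (F.genKey l g) (fun _ => i) r

/-- The hybrid game with punctured encryption circuits. -/
def hybridEnc (i : Bits (tag l)) (b : Bool) : ℝ :=
  expect fun r : Bits (F.genCoins l) => expect fun d => expect fun r' : Bits (G.genCoins l) =>
    expect fun ρ' => expect fun c =>
      alt.value p (tagMsk E F l (F.genKey l r)) (publicKey E F O padS l r d) i
        ((publicKey E F O padS l r d).eval i) b (punctAt G l i r' ρ')
        (G.value l (G.genKey l r') i) c

/-- The hybrid game with random encryption coins at `i`. -/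
def hybridCoins (i : Bits (tag l)) (b : Bool) : ℝ :=
  expect fun r : Bits (F.genCoins l) => expect fun d => avg4 _ _ _ _ fun y :
    Bits (O.coins l (tag l) (E.ct l) (encGates E F G O padS padE l)) × Bits (G.genCoins l) ×
      Bits (G.punctCoins l 1) × Bits (E.encCoins l) =>
      alt.value p (tagMsk E F l (F.genKey l r)) (publicKey E F O padS l r d) i
        ((publicKey E F O padS l r d).eval i) b (punctAt G l i y.2.1 y.2.2.1) y.2.2.2 y.1

/-- The hybrid game with a punctured setup circuit. -/
def hybridSetup (i : Bits (tag l)) (b : Bool) : ℝ :=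
  avg4 _ _ _ _ fun y : Bits (O.coins l (tag l) (E.ct l) (encGates E F G O padS padE l)) ×
      Bits (G.genCoins l) × Bits (G.punctCoins l 1) × Bits (E.encCoins l) =>
    expect fun d => expect fun r : Bits (F.genCoins l) => expect fun ρ =>
      tagValue p altS alt i b (punctAt G l i y.2.1 y.2.2.1) y.2.2.2 d y.1 (punctAt F l i r ρ)
        (F.value l (F.genKey l r) i)

/-- The hybrid game with random setup coins at `i`. -/
def hybridIdeal (i : Bits (tag l)) (b : Bool) : ℝ :=
  avg4 _ _ _ _ fun y : Bits (O.coins l (tag l) (E.ct l) (encGates E F G O padS padE l)) ×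
      Bits (G.genCoins l) × Bits (G.punctCoins l 1) × Bits (E.encCoins l) =>
    expect fun d => expect fun r : Bits (F.genCoins l) => expect fun ρ => expect fun v =>
      tagValue p altS alt i b (punctAt G l i y.2.1 y.2.2.1) y.2.2.2 d y.1 (punctAt F l i r ρ) v

variable {p altS alt} {ε : ℝ}

section

variable (hobf : ∀ (m : Bits (tag l) → Bits (E.msk l))
  (P : Circuit (tag l) (E.pk l) (pkGates E F O padS l))
  (C₀ C₁ : Bits (E.inp l + E.inp l) → Circuit (tag l) (E.ct l) (encGates E F G O padS padE l)),
  (∀ x τ, (C₀ x).eval τ = (C₁ x).eval τ) → |(expect fun c => p.value m P fun x => O.obf l (C₀ x) c) -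
    expect fun c => p.value m P fun x => O.obf l (C₁ x) c| ≤ ε)

include hobf

/-- Used at the two ends of the chain: the first tag with `false` and the last tag with `true`,
where the hybrid circuit encrypts the same plaintext at every tag. -/
theorem abs_real_sub_hybridEnc_le (hG : G.PuncturedCorrectness) {i : Bits (tag l)} {b b' : Bool}
    (h : ∀ τ, (if τ = i then b' else τ.lt i) = b) :
    |p.real b - hybridEnc p alt i b'| ≤ ε := by
  refine abs_expect_sub_le fun r => abs_expect_sub_le fun d => abs_expect_sub_le fun r' => ?_
  -- The real game has no puncturing coins; a dummy average over them is inserted so that the two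
  -- sides can be compared coin by coin.
  rw [← expect_const (n := G.punctCoins l 1) (expect fun c => p.value _ _ fun x => _)]
  refine abs_expect_sub_le fun ρ' => hobf _ _ _ _ fun x τ => ?_
  rw [eval_encCircuit]
  refine Eq.trans ?_ (alt.eval_circ_punctured hG i _ r' ρ' b' x τ).symm
  rw [h]

/-- Used for consecutive tags: all tags up to and including `i` being switched is the same as all
tags strictly below the successor of `i`. -/
theorem abs_hybridEnc_sub_hybridEnc_le (hG : G.PuncturedCorrectness) {i i' : Bits (tag l)}
    {b b' : Bool} (h : ∀ τ, (if τ = i then b else τ.lt i) = if τ = i' then b' else τ.lt i') :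
    |hybridEnc p alt i b - hybridEnc p alt i' b'| ≤ ε := by
  refine abs_expect_sub_le fun r => abs_expect_sub_le fun d => abs_expect_sub_le fun r' =>
    abs_expect_sub_le fun ρ' => hobf _ _ _ _ fun x τ => ?_
  refine (alt.eval_circ_punctured hG i _ r' ρ' b x τ).trans
    (Eq.trans ?_ (alt.eval_circ_punctured hG i' _ r' ρ' b' x τ).symm)
  rw [h]

end

theorem abs_hybridEnc_sub_hybridCoins_le (i : Bits (tag l)) (b : Bool)
    (hprf : ∀ m P v c, |(expect fun g => expect fun r =>
        alt.value p m P i v b (punctAt G l i g r) (G.value l (G.genKey l g) i) c) -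
      expect fun g => expect fun r => expect fun u =>
        alt.value p m P i v b (punctAt G l i g r) u c| ≤ ε) :
    |hybridEnc p alt i b - hybridCoins p alt i b| ≤ ε := by
  refine abs_expect_sub_le fun r => abs_expect_sub_le fun d => ?_
  -- The obfuscation coins are averaged first, so that they are fixed when pseudorandomness is
  -- applied.
  rw [expect_rotate, avg4_apply]
  exact abs_expect_sub_le fun c => hprf _ _ _ c

/-- The circuit with the punctured key and the true public key hardwired at `i` computes the same
function as the setup circuit. The coins of the ciphertext are moved outside, so that only the
obfuscation of the public key is left to average. -/
theorem abs_hybridCoins_sub_hybridSetup_le (hO : O.Functionality) (hF : F.PuncturedCorrectness)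
    (i : Bits (tag l)) (b : Bool)
    (hobf : ∀ m C₀ C₁ v κ u c, (∀ τ, C₀.eval τ = C₁.eval τ) →
      |(expect fun d => alt.value p m (O.obf l C₀ d) i v b κ u c) -
        expect fun d => alt.value p m (O.obf l C₁ d) i v b κ u c| ≤ ε) :
    |hybridCoins p alt i b - hybridSetup p altS alt i b| ≤ ε := by
  have h1 : hybridCoins p alt i b = avg4 _ _ _ _ fun y => expect fun r => expect fun d =>
      alt.value p (tagMsk E F l (F.genKey l r)) (publicKey E F O padS l r d) i
        ((publicKey E F O padS l r d).eval i) b (punctAt G l i y.2.1 y.2.2.1) y.2.2.2 y.1 := by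
    rw [map_expect]
    simp only [map_expect]
    rfl
  rw [h1]
  refine abs_avg4_sub_le fun y => ?_
  rw [← expect_rotate]
  refine abs_expect_sub_le fun r => ?_
  rw [← expect_const (n := F.punctCoins l 1) (expect fun d => alt.value p _ _ _ _ _ _ _ _)]
  refine abs_expect_sub_le fun ρ => ?_
  -- By functionality of the obfuscator, the public key at `i` does not depend on the obfuscation
  -- coins and can be treated as fixed.
  have h2 : ∀ d, (publicKey E F O padS l r d).eval i =
      ((E.setup l).eval (F.value l (F.genKey l r) i)).left := fun d => by
    rw [publicKey, hO, eval_setupCircuit]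
  simp only [h2, tagValue, punctAt]
  rw [← tagMsk_eq_punctured hF i r ρ]
  exact hobf _ _ _ _ _ _ _ fun τ => (altS.eval_circ_punctured hF i r ρ τ).symm

theorem abs_hybridSetup_sub_hybridIdeal_le (i : Bits (tag l)) (b : Bool)
    (hprf : ∀ κ u d c, |(expect fun g => expect fun r =>
        tagValue p altS alt i b κ u d c (punctAt F l i g r) (F.value l (F.genKey l g) i)) -
      expect fun g => expect fun r => expect fun v =>
        tagValue p altS alt i b κ u d c (punctAt F l i g r) v| ≤ ε) :
    |hybridSetup p altS alt i b - hybridIdeal p altS alt i b| ≤ ε :=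
  abs_avg4_sub_le fun _ => abs_expect_sub_le fun d => hprf _ _ d _

/-- The setup coins and encryption coins at `i` are moved innermost: for all other coins fixed they
are the coins of an independent instance of the single-key scheme. -/
theorem abs_hybridIdeal_sub_le (i : Bits (tag l))
    (hkey : ∀ κ d c κ', |(expect fun v => expect fun u => tagValue p altS alt i false κ u d c κ' v) -
      expect fun v => expect fun u => tagValue p altS alt i true κ u d c κ' v| ≤ ε) :
    |hybridIdeal p altS alt i false - hybridIdeal p altS alt i true| ≤ ε := by
  have h1 : ∀ b, hybridIdeal p altS alt i b = expect fun c => expect fun r' => expect fun ρ' =>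
      expect fun d => expect fun r => expect fun ρ => expect fun v => expect fun u =>
        tagValue p altS alt i b (punctAt G l i r' ρ') u d c (punctAt F l i r ρ) v := by
    intro b
    rw [hybridIdeal, avg4_apply]
    refine congrArg expect (funext fun c => congrArg expect (funext fun r' =>
      congrArg expect (funext fun ρ' => ?_)))
    refine (expect_comm _).trans (congrArg expect (funext fun d => ?_))
    refine (expect_comm _).trans (congrArg expect (funext fun r => ?_))
    refine (expect_comm _).trans (congrArg expect (funext fun ρ => ?_))
    exact expect_comm _
  rw [h1, h1]
  exact abs_expect_sub_le fun c => abs_expect_sub_le fun r' => abs_expect_sub_le fun ρ' =>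
    abs_expect_sub_le fun d => abs_expect_sub_le fun r => abs_expect_sub_le fun ρ => hkey _ d c _

end Hybrids

/-- The position of a string in the lexicographic order. -/
theorem Bits.exists_rank (t : ℕ) :
    ∃ e : Bits t ≃ Fin (2 ^ t), ∀ x y : Bits t, x.lt y = decide (e x < e y) := by
  have hc : Fintype.card (Lex (Fin t → Bool)) = 2 ^ t := by
    rw [show Fintype.card (Lex (Fin t → Bool)) = Fintype.card (Fin t → Bool) from
      Fintype.card_congr ofLex]
    simp
  let o := Fintype.orderIsoFinOfCardEq (Lex (Fin t → Bool)) hc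
  refine ⟨toLex.trans o.symm.toEquiv, fun x y => ?_⟩
  rw [Bool.eq_iff_iff, decide_eq_true_iff]
  exact (decide_eq_true_iff.trans (o.symm.lt_iff_lt (x := toLex x) (y := toLex y)).symm)

theorem subExp_anti {α β : ℝ} (h : α ≤ β) {l : ℕ} (hl : 1 ≤ l) : subExp β l ≤ subExp α l := by
  refine Real.rpow_le_rpow_of_exponent_le one_le_two (neg_le_neg ?_)
  exact Real.rpow_le_rpow_of_exponent_le (by exact_mod_cast hl) h

theorem exists_bound_of_le {T : ℕ → Type} {g : ∀ l, T l → ℝ} {α β : ℝ} (hα : α ≤ β)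
    (h : ∃ C : ℝ, 0 ≤ C ∧ ∀ᶠ l in atTop, ∀ t, g l t ≤ C * subExp β l) :
    ∃ C : ℝ, 0 ≤ C ∧ ∀ᶠ l in atTop, ∀ t, g l t ≤ C * subExp α l := by
  obtain ⟨C, hC, h⟩ := h
  refine ⟨C, hC, (h.and (eventually_ge_atTop 1)).mono fun l hl t => (hl.1 t).trans ?_⟩
  exact mul_le_mul_of_nonneg_left (subExp_anti hα hl.2) hC

theorem Obfuscator.UniformlySecure.mono {O : Obfuscator} {α β : ℝ} (hO : O.UniformlySecure β)
    (hα : α ≤ β) : O.UniformlySecure α := fun T _ n m s C₀ C₁ D hn hm hs hC hD =>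
  exists_bound_of_le hα (hO T n m s C₀ C₁ D hn hm hs hC hD)

theorem PPRF.UniformlySecure.mono {inLen outLen : ℕ → ℕ} {F : PPRF inLen outLen} {α β : ℝ}
    (hF : F.UniformlySecure β) (hα : α ≤ β) : F.UniformlySecure α := fun T _ S D hD f hf =>
  exists_bound_of_le hα (hF T S D hD f hf)

theorem UniformlySingleKeySecure.mono {S : ℕ → SDFE} {α β : ℝ}
    (hS : UniformlySingleKeySecure S β) (hα : α ≤ β) : UniformlySingleKeySecure S α :=
  fun T _ A hA => exists_bound_of_le hα (hS T A hA)

/-! ### The chain of hybrids over all tags -/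

section Chain

variable {tag : ℕ → ℕ} {E : SDFEAlgs} {F : PPRF tag E.setupCoins} {G : PPRF tag E.encCoins}
  {O : Obfuscator} {padS padE : ℕ → ℕ}

/-- Passing through all tags in the lexicographic order. -/
theorem BundledPlay.abs_real_sub_le {l N : ℕ} (p : BundledPlay E F G O padS padE l N)
    {alt : EncAlt E F G O padS padE} (hG : G.PuncturedCorrectness) {ε : ℝ}
    (hobf : ∀ (m : Bits (tag l) → Bits (E.msk l))
      (P : Circuit (tag l) (E.pk l) (pkGates E F O padS l))
      (C₀ C₁ : Bits (E.inp l + E.inp l) → Circuit (tag l) (E.ct l) (encGates E F G O padS padE l)),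
      (∀ x τ, (C₀ x).eval τ = (C₁ x).eval τ) →
        |(expect fun c => p.value m P fun x => O.obf l (C₀ x) c) -
          expect fun c => p.value m P fun x => O.obf l (C₁ x) c| ≤ ε)
    (hstep : ∀ i, |hybridEnc p alt i false - hybridEnc p alt i true| ≤ 7 * ε) :
    |p.real false - p.real true| ≤ 9 * 2 ^ tag l * ε := by
  obtain ⟨e, he⟩ := Bits.exists_rank (tag l)
  have hpos : 0 < 2 ^ tag l := Nat.two_pow_pos _
  have hε : 0 ≤ ε := (abs_nonneg _).trans
    (hobf (fun _ _ => false) (fun _ => false) (fun _ _ => false) (fun _ _ => false) fun _ _ => rfl)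
  have hτ : ∀ (τ) (i : Fin (2 ^ tag l)), τ = e.symm i ↔ (e τ : ℕ) = i := fun τ i => by
    rw [Equiv.eq_symm_apply, Fin.ext_iff]
  have hlt : ∀ (τ : Bits (tag l)) (i : Fin (2 ^ tag l)), τ.lt (e.symm i) = decide ((e τ : ℕ) < i) := fun τ i => by
    rw [he, e.apply_symm_apply]; rfl
  -- One `ε` to enter the chain; each tag then costs `7 * ε` for the exchange at the tag and one `ε`
  -- to pass to its successor.
  have key : ∀ k (hk : k < 2 ^ tag l),
      |p.real false - hybridEnc p alt (e.symm ⟨k, hk⟩) false| ≤ (1 + 8 * k) * ε := by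
    intro k
    induction k with
    | zero =>
      intro hk
      refine (abs_real_sub_hybridEnc_le hobf hG fun τ => ?_).trans (by simp)
      rw [hlt]
      simp
    | succ k ih =>
      intro hk
      have h1 := ih (by omega)
      have h2 := hstep (e.symm ⟨k, by omega⟩)
      -- Ranks are integers: being `k` or less than `k` is being less than `k + 1`.
      have h3 := abs_hybridEnc_sub_hybridEnc_le (alt := alt) hobf hG (i := e.symm ⟨k, by omega⟩)
        (i' := e.symm ⟨k + 1, hk⟩) (b := true) (b' := false) fun τ => by
          simp only [hτ, hlt]
          rw [Bool.eq_iff_iff]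
          split_ifs <;> simp only [decide_eq_true_iff, true_iff, iff_false] <;> omega
      rw [abs_le] at h1 h2 h3 ⊢
      push_cast
      constructor <;> linarith
  have h1 := key (2 ^ tag l - 1) (by omega)
  have h2 := hstep (e.symm ⟨2 ^ tag l - 1, by omega⟩)
  have h3 := abs_real_sub_hybridEnc_le (alt := alt) hobf hG
    (i := e.symm ⟨2 ^ tag l - 1, by omega⟩) (b := true) (b' := true) fun τ => by
      simp only [hτ, hlt]
      have := (e τ).2
      split_ifs <;> simp
      omega
  rw [Nat.cast_sub (by omega)] at h1
  push_cast at h1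
  -- The total is `(1 + 8 * (2 ^ tag - 1)) + 7 + 1 = 8 * 2 ^ tag + 1`; the last `ε` is absorbed into
  -- the ninth multiple of `2 ^ tag * ε`.
  have h4 : ε ≤ 2 ^ tag l * ε := le_mul_of_one_le_left hε (one_le_pow₀ one_le_two)
  rw [abs_le] at h1 h2 h3 ⊢
  constructor <;> linarith

/-- With `ε` the sum of the five bounds, the exchange at a tag costs `7 * ε`: three steps down to
the ideal hybrid, the single-key step, and three steps back. Distinct tags are needed in the
single-key step only. -/
theorem exists_bound_real (h : Efficiency E F G O) (hS : PolyBounded padS)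
    (hE : PolyBounded padE) {N : ℕ → ℕ} (hN : PolyBounded N) {α : ℝ}
    (altS : SetupAlt E F padS) (alt : EncAlt E F G O padS padE)
    (hO : O.UniformlySecure α) (hF : F.UniformlySecure α) (hG : G.UniformlySecure α)
    (hsec : UniformlySingleKeySecure E.scheme α) (hfun : O.Functionality)
    (hFc : F.PuncturedCorrectness) (hGc : G.PuncturedCorrectness)
    [∀ l, Nonempty (BundledPlay E F G O padS padE l (N l))] :
    ∃ C : ℝ, 0 ≤ C ∧ ∀ᶠ l in atTop, ∀ p : BundledPlay E F G O padS padE l (N l),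
      ((p.Lp ++ p.Lq).map Prod.snd).Nodup →
        |p.real false - p.real true| ≤ C * (2 ^ tag l * subExp α l) := by
  obtain ⟨C₁, p₁, h₁⟩ := exists_bound_obf_enc h hS hE hN hO
  obtain ⟨C₂, p₂, h₂⟩ := exists_bound_prf_enc h hS hE hN alt hG
  obtain ⟨C₃, p₃, h₃⟩ := exists_bound_obf_setup h hS hE hN alt hO
  obtain ⟨C₄, p₄, h₄⟩ := exists_bound_prf_setup h hS hE hN altS alt hF
  obtain ⟨C₅, p₅, h₅⟩ := exists_bound_singleKey h hS hE hN altS alt hsec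
  refine ⟨9 * (C₁ + C₂ + C₃ + C₄ + C₅), by positivity, ?_⟩
  filter_upwards [h₁, h₂, h₃, h₄, h₅] with l h₁ h₂ h₃ h₄ h₅ p hp
  set ε := (C₁ + C₂ + C₃ + C₄ + C₅) * subExp α l with hε
  have hle : ∀ C, C ≤ C₁ + C₂ + C₃ + C₄ + C₅ → C * subExp α l ≤ ε := fun C hC =>
    mul_le_mul_of_nonneg_right hC (subExp_nonneg α l)
  have k₁ := hle C₁ (by linarith)
  have k₂ := hle C₂ (by linarith)
  have k₃ := hle C₃ (by linarith)
  have k₄ := hle C₄ (by linarith)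
  have k₅ := hle C₅ (by linarith)
  -- The three steps do not depend on which plaintext is encrypted at `i`, so they serve both for
  -- descending and for returning.
  have hside : ∀ i b, |hybridEnc p alt i b - hybridIdeal p altS alt i b| ≤ 3 * ε := fun i b => by
    have e₁ := abs_hybridEnc_sub_hybridCoins_le (p := p) (alt := alt) i b fun m P v c =>
      (h₂ p m P i v b c).trans k₂
    have e₂ := abs_hybridCoins_sub_hybridSetup_le (p := p) (alt := alt) (altS := altS) hfun hFc i b
      fun m D₀ D₁ v κ u c heq => (h₃ p m D₀ D₁ i v b κ u c heq).trans k₃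
    have e₃ := abs_hybridSetup_sub_hybridIdeal_le (p := p) (alt := alt) (altS := altS) i b
      fun κ u d c => (h₄ p i b κ u d c).trans k₄
    rw [abs_le] at e₁ e₂ e₃ ⊢
    constructor <;> linarith
  refine (p.abs_real_sub_le hGc (alt := alt) (ε := ε)
    (fun m P D₀ D₁ heq => (h₁ p m P D₀ D₁ heq).trans k₁) fun i => ?_).trans_eq (by rw [hε]; ring)
  have e₁ := hside i false
  have e₂ := hside i true
  have e₃ := abs_hybridIdeal_sub_le (p := p) (alt := alt) (altS := altS) i fun κ d c κ' =>
    (h₅ p i κ' κ d c hp).trans k₅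
  rw [abs_le] at e₁ e₂ e₃ ⊢
  constructor <;> linarith

end Chain

/-! ### Negligible functions -/

theorem PolyBounded.negligible_mul {n : ℕ → ℕ} (hn : PolyBounded n) {f : ℕ → ℝ}
    (hf : Negligible f) : Negligible fun l => n l * f l := by
  obtain ⟨p, hp⟩ := hn
  have h : Negligible fun l => (p.map (Nat.castRingHom ℝ)).eval (l : ℝ) * f l :=
    SuperpolynomialDecay.polynomial_mul hf _
  refine SuperpolynomialDecay.trans_abs_le h fun l => ?_
  rw [Polynomial.eval_natCast_map, abs_mul, abs_mul]
  refine mul_le_mul_of_nonneg_right ?_ (abs_nonneg _)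
  rw [Nat.abs_cast, eq_natCast, Nat.abs_cast]
  exact_mod_cast hp l

/-- `2 ^ (-s) ≤ l ^ z` means `s * log 2 ≥ -z * log l`, so the hypothesis is applied to `-z / log 2`.
-/
theorem negligible_two_rpow_neg {s : ℕ → ℝ}
    (hs : ∀ z : ℝ, ∀ᶠ l : ℕ in atTop, z * Real.log l ≤ s l) :
    Negligible fun l => (2 : ℝ) ^ (-s l) := by
  refine (superpolynomialDecay_iff_isBigO _ tendsto_natCast_atTop_atTop).2 fun z => ?_
  refine IsBigO.of_bound 1 ?_
  filter_upwards [hs (-z / Real.log 2), eventually_ge_atTop 1] with l h hl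
  have hl' : (0 : ℝ) < l := by exact_mod_cast hl
  have h2 : 0 < Real.log 2 := Real.log_pos one_lt_two
  rw [one_mul, Real.norm_of_nonneg (by positivity), Real.norm_of_nonneg (by positivity),
    ← Real.rpow_intCast, Real.rpow_def_of_pos two_pos, Real.rpow_def_of_pos hl']
  refine Real.exp_le_exp.2 ?_
  rw [div_mul_eq_mul_div, div_le_iff₀ h2] at h
  linarith

theorem negligible_inv_two_pow {tag : ℕ → ℕ}
    (h : (fun l : ℕ => Real.log (l : ℝ)) =o[atTop] fun l : ℕ => (tag l : ℝ)) :
    Negligible fun l => ((2 : ℝ) ^ tag l)⁻¹ := by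
  have h1 := negligible_two_rpow_neg (s := fun l => (tag l : ℝ)) fun z => by
    filter_upwards [(h.const_mul_left z).bound one_pos] with l hl
    rw [one_mul, Real.norm_natCast] at hl
    exact (le_abs_self _).trans hl
  simpa only [Real.rpow_neg two_pos.le, Real.rpow_natCast] using h1

/-- The exponent is `l ^ α - tag l`; both the polylogarithmic `tag` and any multiple of `log l` are
of smaller order than `l ^ α`. -/
theorem negligible_two_pow_mul_subExp {tag : ℕ → ℕ} {c : ℕ} {α : ℝ} (hα : 0 < α)
    (h : (fun l : ℕ => (tag l : ℝ)) =O[atTop] fun l : ℕ => Real.log (l : ℝ) ^ c) :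
    Negligible fun l => 2 ^ tag l * subExp α l := by
  have hlog : ∀ c : ℕ, (fun l : ℕ => Real.log (l : ℝ) ^ c) =o[atTop] fun l : ℕ => (l : ℝ) ^ α := by
    intro c
    have := (isLittleO_log_rpow_rpow_atTop (c : ℝ) hα).comp_tendsto tendsto_natCast_atTop_atTop
    simpa only [Function.comp_def, Real.rpow_natCast] using this
  have h1 := negligible_two_rpow_neg (s := fun l => (l : ℝ) ^ α - tag l) fun z => by
    have h2 := ((hlog 1).const_mul_left z).add (h.trans_isLittleO (hlog c))
    filter_upwards [h2.bound one_pos] with l hl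
    rw [one_mul, Real.norm_of_nonneg (Real.rpow_nonneg (Nat.cast_nonneg l) α)] at hl
    have := (Real.le_norm_self _).trans hl
    linarith [pow_one (Real.log l)]
  refine h1.congr fun l => ?_
  rw [neg_sub, sub_eq_add_neg, Real.rpow_add two_pos, Real.rpow_natCast]
  rfl

/-! ### Random tags -/

section Tags

variable {tag : ℕ → ℕ} {E : SDFEAlgs} {F : PPRF tag E.setupCoins} {G : PPRF tag E.encCoins}
  {O : Obfuscator} {padS padE : ℕ → ℕ} {l : ℕ}

theorem abs_avgL_sub_le {t : ℕ} (k : ℕ) {f g b : List (Bits t) → ℝ}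
    (h : ∀ L, L.length = k → |f L - g L| ≤ b L) : |avgL t k f - avgL t k g| ≤ avgL t k b := by
  rw [abs_le, ← map_sub, ← map_neg]
  exact ⟨avgL_mono k fun L hL => (abs_le.1 (h L hL)).1,
    avgL_mono k fun L hL => (abs_le.1 (h L hL)).2⟩

/-- An adversary with the tags `t₁` and `t₂`. -/
def Adversary.play (A : Adversary (bundled E F G O padS padE l).pk (E.fn l) (E.inp l)
    (E.sk l + tag l) (bundled E F G O padS padE l).ct) (t₁ t₂ : List (Bits (tag l)))
    (h₁ : t₁.length = A.pre.length) (h₂ : t₂.length = A.post.length) :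
    BundledPlay E F G O padS padE l A.cost where
  A := A
  cost_le := le_rfl
  Lp := A.pre.zip t₁
  Lq := A.post.zip t₂
  map_Lp := List.map_fst_zip h₁.ge
  map_Lq := List.map_fst_zip h₂.ge

theorem BundledPlay.abs_real_le_one {N : ℕ} (p : BundledPlay E F G O padS padE l N) (b : Bool) :
    |p.real b| ≤ 1 := by
  have h : ∀ {n : ℕ} {f : Bits n → ℝ}, (∀ x, |f x| ≤ 1) → |expect f| ≤ 1 := fun {n f} hf => by
    have := abs_expect_sub_le (f := f) (g := fun _ => 0) (c := 1) fun x => by simpa using hf x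
    rwa [expect_const, sub_zero] at this
  exact h fun _ => h fun _ => h fun _ => h fun _ =>
    abs_game_le_one (isState_keyState _) _ _

/-- For distinct tags the hypothesis bounds the gap. Otherwise the gap is at most 2, and the
birthday bound controls the probability, with the cost of the adversary in place of the number of
rounds. -/
theorem advantage_bundled_le (A : Adversary (bundled E F G O padS padE l).pk (E.fn l) (E.inp l)
    (E.sk l + tag l) (bundled E F G O padS padE l).ct) {ε : ℝ} (hε : 0 ≤ ε)
    (h : ∀ p : BundledPlay E F G O padS padE l A.cost,
      ((p.Lp ++ p.Lq).map Prod.snd).Nodup → |p.real false - p.real true| ≤ ε) :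
    (bundled E F G O padS padE l).advantage ⊤ A ≤
      2 * (A.cost * (A.cost * ((2 : ℝ) ^ tag l)⁻¹)) + ε := by
  classical
  have hlen : A.pre.length + A.post.length ≤ A.cost := by
    -- Empty tags are attached only to bring the rounds into the form required by the lemma.
    simpa using length_add_length_le_cost A (tg := 0) (Lp := A.pre.map fun R => (R, fun _ => false))
      (Lq := A.post.map fun R => (R, fun _ => false)) (by simp [Function.comp_def])
      (by simp [Function.comp_def])
  have hlen' : ((A.pre.length + A.post.length : ℕ) : ℝ) ≤ A.cost := by exact_mod_cast hlen
  let B : List (Bits (tag l)) → ℝ := fun L => if L.Nodup then 0 else 1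
  have hB : avgL (tag l) (A.pre.length + A.post.length) B ≤
      A.cost * (A.cost * ((2 : ℝ) ^ tag l)⁻¹) := by
    refine (avgL_not_nodup_le _ [] List.nodup_nil).trans ?_
    rw [List.length_nil, Nat.cast_zero, zero_add, mul_div_assoc, div_eq_mul_inv]
    gcongr
  have hle : (bundled E F G O padS padE l).advantage ⊤ A ≤
      avgL (tag l) A.pre.length fun t₁ => avgL (tag l) A.post.length fun t₂ =>
        ((2 : ℝ) • B + (fun _ => ε : List (Bits (tag l)) → ℝ)) (t₁ ++ t₂) := by
    refine (congrArg₂ (fun x y : ℝ => |x - y|) (experiment_bundled A false)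
      (experiment_bundled A true)).trans_le ?_
    refine abs_avgL_sub_le _ fun t₁ h₁ => abs_avgL_sub_le _ fun t₂ h₂ => ?_
    change |(A.play t₁ t₂ h₁ h₂).real false - (A.play t₁ t₂ h₁ h₂).real true| ≤
      2 * (if (t₁ ++ t₂).Nodup then 0 else 1) + ε
    split_ifs with hd
    · refine (h _ ?_).trans_eq (by ring)
      change ((A.pre.zip t₁ ++ A.post.zip t₂).map Prod.snd).Nodup
      rwa [List.map_append, List.map_snd_zip h₁.le, List.map_snd_zip h₂.le]
    · have e₁ := (A.play t₁ t₂ h₁ h₂).abs_real_le_one false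
      have e₂ := (A.play t₁ t₂ h₁ h₂).abs_real_le_one true
      refine (abs_sub _ _).trans ?_
      linarith
  refine hle.trans ?_
  rw [← avgL_add, map_add, map_smul, avgL_const, smul_eq_mul]
  linarith

end Tags

/-- The four assumptions come with different exponents; the smallest one serves for all. The
adversary's cost is polynomial, so the collision term and the hybrid term are both negligible. -/
theorem adaptivelySecure_bundled {tag : ℕ → ℕ} {E : SDFEAlgs} {F : PPRF tag E.setupCoins}
    {G : PPRF tag E.encCoins} {O : Obfuscator} {padS padE : ℕ → ℕ}
    (tag_large : (fun l : ℕ => Real.log (l : ℝ)) =o[atTop] fun l : ℕ => (tag l : ℝ))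
    {k : ℕ} (tag_small : (fun l : ℕ => (tag l : ℝ)) =O[atTop] fun l : ℕ => Real.log (l : ℝ) ^ k)
    (h : Efficiency E F G O) (hE_secure : SubExpAdaptivelySingleKeySecure E.scheme)
    (hO : O.SubExpSecure) (hF : F.SubExpSecure) (hG : G.SubExpSecure) (hS : PolyBounded padS)
    (hE : PolyBounded padE) (altS : SetupAlt E F padS) (alt : EncAlt E F G O padS padE) :
    AdaptivelySecure (bundled E F G O padS padE) := by
  intro A hA
  obtain ⟨α₁, h₁, -, hO'⟩ := Obfuscator.exists_uniformlySecure hO.2.2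
  obtain ⟨α₂, h₂, -, hF'⟩ := PPRF.exists_uniformlySecure hF.2.2
  obtain ⟨α₃, h₃, -, hG'⟩ := PPRF.exists_uniformlySecure hG.2.2
  obtain ⟨α₄, h₄, -, hE'⟩ := exists_uniformlySingleKeySecure hE_secure
  set α := min (min α₁ α₂) (min α₃ α₄)
  have hpos : 0 < α := lt_min (lt_min h₁ h₂) (lt_min h₃ h₄)
  -- The uniform bounds need a nonempty family of plays; the adversary itself with arbitrary tags is
  -- one.
  have : ∀ l, Nonempty (BundledPlay E F G O padS padE l (A l).cost) := fun l =>
    ⟨Adversary.play (A l) (List.replicate (A l).pre.length fun _ => false)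
      (List.replicate (A l).post.length fun _ => false) List.length_replicate
      List.length_replicate⟩
  obtain ⟨C, hC, hb⟩ := exists_bound_real h hS hE hA altS alt
    (hO'.mono ((min_le_left _ _).trans (min_le_left _ _)))
    (hF'.mono ((min_le_left _ _).trans (min_le_right _ _)))
    (hG'.mono ((min_le_right _ _).trans (min_le_left _ _)))
    (hE'.mono ((min_le_right _ _).trans (min_le_right _ _))) hO.2.1 hF.2.1 hG.2.1
  have hneg : Negligible fun l => 2 * ((A l).cost * ((A l).cost * ((2 : ℝ) ^ tag l)⁻¹)) +
      C * (2 ^ tag l * subExp α l) :=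
    ((hA.negligible_mul (hA.negligible_mul (negligible_inv_two_pow tag_large))).const_mul 2).add
      ((negligible_two_pow_mul_subExp hpos tag_small).const_mul C)
  refine hneg.trans_eventually_abs_le ?_
  filter_upwards [hb] with l hl
  have hε : 0 ≤ C * (2 ^ tag l * subExp α l) :=
    mul_nonneg hC (mul_nonneg (by positivity) (subExp_nonneg α l))
  have hadv : 0 ≤ (bundled E F G O padS padE l).advantage ⊤ (A l) := abs_nonneg _
  rw [Function.comp_apply, Function.comp_apply, abs_of_nonneg hadv, abs_of_nonneg (by positivity)]
  exact advantage_bundled_le (A l) hε hl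

end KeyBundling

end

theorem mainTheorem8 (tag : ℕ → ℕ) (E : SDFEAlgs) (F : PPRF tag E.setupCoins)
    (G : PPRF tag E.encCoins) (O : Obfuscator)
    (tag_large : (fun l : ℕ => Real.log (l : ℝ)) =o[atTop] fun l : ℕ => (tag l : ℝ))
    (tag_small : ∃ c : ℕ, (fun l : ℕ => (tag l : ℝ)) =O[atTop] fun l : ℕ => Real.log (l : ℝ) ^ c)
    (hE : E.Efficient) (hE_secure : SubExpAdaptivelySingleKeySecure E.scheme)
    (hO : O.SubExpSecure) (hF : F.SubExpSecure) (hG : G.SubExpSecure) :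
    ∃ pS : ℕ → ℕ, PolyBounded pS ∧
      ∀ padS : ℕ → ℕ, PolyBounded padS → (∀ l, pS l ≤ padS l) →
        ∃ pE : ℕ → ℕ, PolyBounded pE ∧
          ∀ padE : ℕ → ℕ, PolyBounded padE → (∀ l, pE l ≤ padE l) →
            AdaptivelySecure (bundled E F G O padS padE) := by
  obtain ⟨c, tag_small⟩ := tag_small
  have h := Efficiency.of hE hF.1 hG.1 hO.1
  obtain ⟨pS, hpS, hS⟩ := exists_setupAlt h
  refine ⟨pS, hpS, fun padS hpadS hle => ?_⟩
  obtain ⟨altS⟩ := hS padS hpadS hle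
  -- Only now, with `padS` fixed, is the size of the obfuscated setup circuit inside the encryption
  -- circuit determined.
  obtain ⟨pE, hpE, hE'⟩ := exists_encAlt h hpadS
  refine ⟨pE, hpE, fun padE hpadE hle' => ?_⟩
  obtain ⟨alt⟩ := hE' padE hpadE hle'
  exact adaptivelySecure_bundled tag_large tag_small h hE_secure hO hF hG hpadS hpadE altS alt
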